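/- **Conventions.** Minkowski metric $g=\mathrm{diag}(1,-1,-1,-1)$; $\sigma^0=I$ and $\sigma^1,\sigma^2,\sigma^3$ are the Pauli matrices; $\epsilon_{12}=1$, $\epsilon_{ab}=-\epsilon_{ba}$, $\epsilon^{ab}=-\epsilon_{ab}$, $\chi^a=\epsilon^{ab}\chi_b$ (likewise for barred indices); $A\mapsto\delta(A)$ is the covering map of $SL(2,\mathbb C)$ onto the proper orthochronous Lorentz group, $\sigma^\mu(\delta(A)x)_\mu=A\,(\sigma^\mu x_\mu)A^*$; $D_m$ is the Pauli–Jordan function, $D_m(x)=\frac{i}{(2\pi)^3}\int d^4p\,\delta(p^2-m^2)\,\mathrm{sgn}(p_0)\,e^{-ip\cdot x}$; all relations between fields are understood in the sense of distributions on a common invariant dense domain. **Setting.** Consider a Wightman theory on a Hilbert space (unitary representation $U_{a,A}$ of the universal cover of the Poincaré group with spectrum condition, unique invariant vacuum $\Omega$, tempered covariant local fields, $\Omega$ cyclic) whose fields are $s$ Hermitian scalar fields $\phi^{(j)}=(\phi^{(j)})^\dagger$ and $f$ Majorana spin-$\frac12$ fields $f^{(A)}_a$, $\bar f^{(A)}_{\bar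 a}=(f^{(A)}_a)^\dagger$, $a=1,2$. Assume: 1. *The fields are free*, with masses $m_j\ge0$, $M_A\ge 0$: $(\partial^2+m_j^2)\phi^{(j)}=0$, $\; i\sigma^\mu_{a\bar b}\partial_\mu\bar f^{(A)\bar b}=M_Af^{(A)}_a$, $\;-i\sigma^\mu_{a\bar b}\partial_\mu f^{(A)a}=M_A\bar f^{(A)}_{\bar b}$; the commutators of two scalar fields and the anticommutators of two spinor field components are of the form $-i\,d(\partial)D(x-y)$ with polynomials $d$ ($D$ being the Pauli–Jordan function of the mass of the first field), and scalar fields commute with spinor fields. 2. *The fields are linearly independent over the ring $\mathbb C[\partial_0,\dots,\partial_3]$ up to equations of motion of single fields*: every relation $\sum_jp_j(\partial)\phi^{(j)}=0$ or $\sum_{A,a}\big(p_{A}^{a}(\partial)f^{(A)}_a+q_A^{a}(\partial)\bar f^{(A)}_{\bar a}\big)=0$ follows, for each $j$ resp. each $A$ separately, from the Klein–Gordon resp. Dirac equations above. 3. *The fields form a supersymmetric multiplet*: there are operators $Q_a$, $\bar Q_{\bar a}=(Q_a)^\dagger$ with $Q_a\Omega=\bar Q_{\bar a}\Omega=0$,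 $\{Q_a,Q_b\}=0$, $\{Q_a,\bar Q_{\bar b}\}=2\sigma^\mu_{a\bar b}P_\mu$, $[Q_a,P_\mu]=0$, $U_{a,A}^{-1}Q_bU_{a,A}=A_b{}^cQ_c$, where $U_{a,1}=e^{ia^\mu P_\mu}$; and each $i[Q_a,\phi^{(j)}]$ is a linear combination of derivatives (of any order, constant coefficients) of the components $f^{(B)}_b,\bar f^{(B)}_{\bar b}$, while each $\{Q_a,f^{(A)}_b\}$ and $\{Q_a,\bar f^{(A)}_{\bar b}\}$ is a linear combination of derivatives of the $\phi^{(j)}$. **Theorem.** Then $s=2f$, and the multiplet is a direct sum of irreducible Wess–Zumino multiplets. That is, there are complex coefficients $c_{Aj}$, with $c_{Aj}\ne0$ only if $m_j=M_A$, such that for the complex scalar fields $\phi^{(A)}=\sum_jc_{Aj}\phi^{(j)}$: * the real subspaces $V_A=\mathrm{span}_{\mathbb R}\{(\mathrm{Re}\,c_{Aj})_j,(\mathrm{Im}\,c_{Aj})_j\}\subset\mathbb R^s$ are two-dimensional and $\mathbb R^s=\bigoplus_AV_A$; * for every $A$, the pair $(\phi^{(A)},f^{(A)})$ is a Wess–Zumino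 multiplet of mass $m=M_A$: $(\partial^2+m^2)\phi=0$, $f$ satisfies the Dirac equation with mass $m$, and $$[Q_a,\phi]=0,\quad i[Q_a,\phi^\dagger]=2f_a,\quad \{Q_a,f_b\}=-im\,\epsilon_{ab}\phi,\quad \{Q_a,\bar f_{\bar b}\}=\sigma^\mu_{a\bar b}\partial_\mu\phi,$$ together with the adjoint relations for $\bar Q_{\bar a}$; * each of these multiplets is irreducible: if $V'\subseteq V_A$ and $W'\subseteq\mathbb R e_A\subset\mathbb R^f$ are real subspaces such that $Q_a,\bar Q_{\bar a}$ map the Hermitian scalars $\sum_jv_j\phi^{(j)}$, $v\in V'$, to linear combinations of derivatives of the Majorana fields $\sum_Bw_Bf^{(B)}$, $w\in W'$, and conversely, then $V'=W'=0$ or $(V',W')=(V_A,\mathbb Re_A)$. Moreover, if the Majorana fields are canonically normalized, $\{f^{(A)}_a(x),\bar f^{(B)}_{\bar b}(y)\}=\delta_{AB}\,\sigma^\mu_{a\bar b}\partial_\mu D_{M_A}(x-y)$, then also $[\phi^{(A)}(x),\phi^{(B)}(y)^\dagger]=-2i\,\delta_{AB}D_{M_A}(x-y)$, $[\phi^{(A)}(x),\phi^{(B)}(y)]=0$,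 $\{f^{(A)}_a(x),f^{(B)}_b(y)\}=i\,\delta_{AB}\,\epsilon_{ab}M_AD_{M_A}(x-y)$ and $[\phi^{(A)}(x),f^{(B)}(y)]=0$. -/

import Mathlib

open scoped SchwartzMap InnerProductSpace MatrixGroups LineDeriv Matrix

noncomputable section

namespace SusyQFT

/-! ### Minkowski space, Weyl indices, and `SL(2,ℂ)` -/

/-- Minkowski space `ℝ⁴`; the coordinates are the contravariant components `x^μ`. -/
abbrev Spacetime : Type := EuclideanSpace ℝ (Fin 4)

/-- The diagonal `(1,-1,-1,-1)` of the Minkowski pseudo-metric. -/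
def metric : Fin 4 → ℝ := ![1, -1, -1, -1]

/-- The Minkowski product `x · y = g_{μν} x^μ y^ν`. -/
def minkowski (x y : Spacetime) : ℝ := ∑ μ, metric μ * x μ * y μ

/-- The closed forward cone. -/
def forwardCone : Set Spacetime := {p | 0 ≤ p 0 ∧ 0 ≤ minkowski p p}

/-- The matrices `σ^μ`: the identity and the three Pauli matrices. -/
def pauli : Fin 4 → Matrix (Fin 2) (Fin 2) ℂ :=
  ![1, !![0, 1; 1, 0], !![0, -Complex.I; Complex.I, 0], !![1, 0; 0, -1]]

/-- The antisymmetric tensor with lower indices, `ε_{12} = 1`. -/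
def epsLow : Matrix (Fin 2) (Fin 2) ℂ := !![0, 1; -1, 0]

/-- The antisymmetric tensor with upper indices, `ε^{ab} = -ε_{ab}`;
Weyl indices are raised by `χ^a = ε^{ab} χ_b`. -/
def epsUp : Matrix (Fin 2) (Fin 2) ℂ := -epsLow

/-- The Hermitian matrix `σ(x) = σ^μ x_μ = σ^μ g_{μν} x^ν`. -/
def hermMatrix (x : Spacetime) : Matrix (Fin 2) (Fin 2) ℂ :=
  ∑ μ, ((metric μ * x μ : ℝ) : ℂ) • pauli μ

/-- The covering homomorphism `A ↦ δ(A)` onto the proper orthochronous Lorentz group,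
`σ(δ(A) x) = A σ(x) A*`, written out in components with `tr (σ^μ σ^ν) = 2 δ^{μν}`. -/
def lorentz (A : SL(2, ℂ)) (x : Spacetime) : Spacetime :=
  WithLp.toLp 2 fun μ =>
    metric μ * ((pauli μ * (A.1 * hermMatrix x * (A.1)ᴴ)).trace.re / 2)

/-! ### Operator-valued distributions and constant coefficient differential operators -/

/-- Test functions. -/
abbrev Test : Type := 𝓢(Spacetime, ℂ)

/-- Polynomials in `∂_0, ∂_1, ∂_2, ∂_3` with constant coefficients. -/
abbrev DiffPoly : Type := MvPolynomial (Fin 4) ℂ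

/-- The operator `-∂_μ` on test functions. -/
def negPartial (μ : Fin 4) : Module.End ℂ Test :=
  -(LineDeriv.lineDerivOpCLM ℂ Test (EuclideanSpace.single μ (1 : ℝ))).toLinearMap

/-- The transpose `p(-∂)` of the differential operator `p(∂)`, acting on test functions. -/
def testPoly (p : DiffPoly) : Module.End ℂ Test :=
  ∑ n ∈ p.support, p.coeff n •
    (negPartial 0 ^ n 0 * negPartial 1 ^ n 1 * negPartial 2 ^ n 2 * negPartial 3 ^ n 3)

section Fields

variable {H : Type*} [NormedAddCommGroup H] [InnerProductSpace ℂ H]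

/-- Operator-valued distributions: smeared fields `g ↦ φ(g) = ∫ φ(x) g(x) dx`, acting on a
common invariant domain. -/
abbrev Field (dom : Submodule ℂ H) : Type _ := Test →ₗ[ℂ] Module.End ℂ dom

variable {dom : Submodule ℂ H}

/-- The field `p(∂)φ`, in the sense of distributions: `(p(∂)φ)(g) = φ(p(-∂)g)`. -/
def act (p : DiffPoly) (φ : Field dom) : Field dom := φ ∘ₗ testPoly p

/-- The commutator `[R, φ(x)]`. -/
def commField (R : Module.End ℂ dom) (φ : Field dom) : Field dom :=
  (LinearMap.mulLeft ℂ R - LinearMap.mulRight ℂ R) ∘ₗ φ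

/-- The anticommutator `{R, φ(x)}`. -/
def anticommField (R : Module.End ℂ dom) (φ : Field dom) : Field dom :=
  (LinearMap.mulLeft ℂ R + LinearMap.mulRight ℂ R) ∘ₗ φ

/-- The commutator `[R, S]`. -/
def comm (R S : Module.End ℂ dom) : Module.End ℂ dom := R * S - S * R

/-- The anticommutator `{R, S}`. -/
def anticomm (R S : Module.End ℂ dom) : Module.End ℂ dom := R * S + S * R

/-- `S = R†` on the common domain. -/
def IsAdjointOn (R S : Module.End ℂ dom) : Prop :=
  ∀ χ η : dom, ⟪((R χ : dom) : H), (η : H)⟫_ℂ = ⟪(χ : H), ((S η : dom) : H)⟫_ℂ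

/-- `φ'(x) = φ(x)†`; in smeared form `φ(g)† = φ'(ḡ)`. -/
def IsAdjointField (φ φ' : Field dom) : Prop :=
  ∀ g h : Test, (∀ x, h x = (starRingEnd ℂ) (g x)) → IsAdjointOn (φ g) (φ' h)

end Fields

/-! ### Wightman theories of Hermitian scalars and Majorana spinors -/

/-- The kinematical part of a Wightman theory: an invariant domain, a unitary representation of
the universal cover of the Poincaré group satisfying the spectrum condition, and the vacuum. -/
structure Frame (H : Type*) [NormedAddCommGroup H] [InnerProductSpace ℂ H] where
  dom : Submodule ℂ H
  dom_dense : Dense (dom : Set H)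
  U : Spacetime → SL(2, ℂ) → (H ≃ₗᵢ[ℂ] H)
  U_one : ∀ χ, U 0 1 χ = χ
  U_mul : ∀ a b A B χ, U a A (U b B χ) = U (a + lorentz A b) (A * B) χ
  U_continuous : ∀ χ, Continuous fun q : Spacetime × SL(2, ℂ) => U q.1 q.2 χ
  U_dom : ∀ a A, ∀ χ ∈ dom, U a A χ ∈ dom
  /-- The joint spectrum of the energy-momentum operators lies in the closed forward cone. -/
  spectrum : ∀ g : Test,
    (∀ p ∈ forwardCone, ∫ a, g a * Complex.exp (Complex.I * (minkowski p a : ℂ)) = 0) →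
      ∀ χ : H, ∫ a, g a • U a 1 χ = 0
  vac : dom
  vac_norm : ‖(vac : H)‖ = 1
  vac_invariant : ∀ a A, U a A vac = vac
  vac_unique : ∀ χ : H, (∀ a A, U a A χ = χ) → ∃ z : ℂ, χ = z • (vac : H)

/-- The operator `U_{a,A}` on the invariant domain. -/
def Frame.Ud {H : Type*} [NormedAddCommGroup H] [InnerProductSpace ℂ H] (F : Frame H)
    (a : Spacetime) (A : SL(2, ℂ)) : Module.End ℂ F.dom :=
  (F.U a A).toLinearEquiv.toLinearMap.restrict (F.U_dom a A)

/-- Components of a Majorana field: `inl a` is `f_a`, `inr a` is the conjugate `f̄_ā`. -/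
abbrev SpinorIndex : Type := Fin 2 ⊕ Fin 2

/-- The `SL(2,ℂ)` representation `A ⊕ Ā` on the components `(f_a, f̄_ā)`. -/
def spinorRep (A : SL(2, ℂ)) : Matrix SpinorIndex SpinorIndex ℂ :=
  Matrix.fromBlocks A.1 0 0 (A.1.map (starRingEnd ℂ))

/-- The supports of `g` and `h` are spacelike separated. -/
def SpacelikeSeparated (g h : Test) : Prop :=
  ∀ x ∈ tsupport g, ∀ y ∈ tsupport h, minkowski (x - y) (x - y) < 0

/-- A Wightman theory whose fields are `s` Hermitian scalar fields and `f` Majorana fields of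
spin `1/2`. -/
structure ScalarMajoranaTheory (H : Type*) [NormedAddCommGroup H] [InnerProductSpace ℂ H]
    (s f : ℕ) extends Frame H where
  scalar : Fin s → Field dom
  spinor : Fin f → SpinorIndex → Field dom
  scalar_hermitian : ∀ j, IsAdjointField (scalar j) (scalar j)
  spinor_majorana : ∀ A a, IsAdjointField (spinor A (Sum.inl a)) (spinor A (Sum.inr a))
  scalar_tempered : ∀ j (χ : dom), Continuous fun g : Test => ((scalar j g χ : dom) : H)
  spinor_tempered : ∀ A c (χ : dom), Continuous fun g : Test => ((spinor A c g χ : dom) : H)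
  /-- `U⁻¹ φ(x) U = φ(δ(A)⁻¹ (x - a))`. -/
  scalar_covariant : ∀ (a : Spacetime) (A : SL(2, ℂ)) (g h : Test),
    (∀ x, h (lorentz A x + a) = g x) → ∀ j,
      scalar j h * toFrame.Ud a A = toFrame.Ud a A * scalar j g
  /-- `U⁻¹ f_b(x) U = A_b^c f_c(δ(A)⁻¹ (x - a))`, and the conjugate relation. -/
  spinor_covariant : ∀ (a : Spacetime) (A : SL(2, ℂ)) (g h : Test),
    (∀ x, h (lorentz A x + a) = g x) → ∀ B b,
      spinor B b h * toFrame.Ud a A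
        = toFrame.Ud a A * ∑ c, spinorRep A b c • spinor B c g
  scalar_local : ∀ j k g h, SpacelikeSeparated g h → comm (scalar j g) (scalar k h) = 0
  mixed_local : ∀ j B c g h, SpacelikeSeparated g h → comm (scalar j g) (spinor B c h) = 0
  spinor_local : ∀ A B c d g h, SpacelikeSeparated g h →
    anticomm (spinor A c g) (spinor B d h) = 0
  /-- The fields generate a dense subspace from the vacuum. -/
  cyclic : ∀ W : Submodule ℂ dom, vac ∈ W → (∀ j g, ∀ χ ∈ W, scalar j g χ ∈ W) →
    (∀ A c g, ∀ χ ∈ W, spinor A c g χ ∈ W) → Dense ((fun χ : dom => (χ : H)) '' (W : Set dom))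

/-! ### Free fields -/

/-- The symbol `∂_0² - ∂_1² - ∂_2² - ∂_3² + m²` of the Klein-Gordon operator. -/
def kleinGordon (m : ℝ) : DiffPoly :=
  ∑ μ, MvPolynomial.C (metric μ : ℂ) * MvPolynomial.X μ ^ 2 + MvPolynomial.C ((m : ℂ) ^ 2)

/-- The symbol `σ^μ_{ab̄} ∂_μ`. -/
def slash : Matrix (Fin 2) (Fin 2) DiffPoly := fun a b =>
  ∑ μ, MvPolynomial.C (pauli μ a b) * MvPolynomial.X μ

/-- The symbol of the Dirac system in Weyl notation; the rows are the equations
`i σ^μ_{ab̄} ∂_μ f̄^{b̄} - M f_a = 0` and `- i σ^μ_{ab̄} ∂_μ f^a - M f̄_b̄ = 0`. -/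
def dirac (M : ℝ) : Matrix SpinorIndex SpinorIndex DiffPoly :=
  Matrix.fromBlocks
    (-(MvPolynomial.C (σ := Fin 4) (M : ℂ) • (1 : Matrix (Fin 2) (Fin 2) DiffPoly)))
    (MvPolynomial.C (σ := Fin 4) Complex.I • (slash * epsUp.map MvPolynomial.C))
    (-(MvPolynomial.C (σ := Fin 4) Complex.I • (slashᵀ * epsUp.map MvPolynomial.C)))
    (-(MvPolynomial.C (σ := Fin 4) (M : ℂ) • (1 : Matrix (Fin 2) (Fin 2) DiffPoly)))

/-- The point `(± ω, ± p)` with `ω = √(p² + m²)` of the mass shell, for the sign `η`. -/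
def shellPoint (m η : ℝ) (p : EuclideanSpace ℝ (Fin 3)) : Spacetime :=
  WithLp.toLp 2 (Fin.cons (η * √(‖p‖ ^ 2 + m ^ 2)) fun i => η * p i)

/-- The Fourier transform `ĝ(k) = ∫ g(x) e^{-i k·x} dx` with the Minkowski product. -/
def minkowskiFourier (g : Test) (k : Spacetime) : ℂ :=
  ∫ x, g x * Complex.exp (-(Complex.I * (minkowski k x : ℂ)))

/-- The Pauli-Jordan causal function
`D_m(x) = i (2π)⁻³ ∫ d⁴p δ(p² - m²) sgn(p_0) e^{-i p·x}`, smeared as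
`∫∫ D_m(x - y) g(x) h(y) dx dy`. -/
def pauliJordan (m : ℝ) (g h : Test) : ℂ :=
  Complex.I * ((2 * Real.pi : ℝ) : ℂ)⁻¹ ^ 3 *
    ∫ p : EuclideanSpace ℝ (Fin 3), ((2 * √(‖p‖ ^ 2 + m ^ 2) : ℝ) : ℂ)⁻¹ *
      (minkowskiFourier g (shellPoint m 1 p) * minkowskiFourier h (shellPoint m (-1) p)
        - minkowskiFourier g (shellPoint m (-1) p) * minkowskiFourier h (shellPoint m 1 p))

section Theory

variable {H : Type*} [NormedAddCommGroup H] [InnerProductSpace ℂ H] {s f : ℕ}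

/-- The fields are free of masses `m_j`, `M_A`: they satisfy the Klein-Gordon and Dirac equations
and causal (anti)commutation relations with c-number values built from derivatives of
the Pauli-Jordan function. -/
structure IsFree (T : ScalarMajoranaTheory H s f) (m : Fin s → ℝ) (M : Fin f → ℝ) : Prop where
  scalar_mass_nonneg : ∀ j, 0 ≤ m j
  spinor_mass_nonneg : ∀ A, 0 ≤ M A
  scalar_eq : ∀ j, act (kleinGordon (m j)) (T.scalar j) = 0
  spinor_eq : ∀ A r, ∑ c, act (dirac (M A) r c) (T.spinor A c) = 0
  scalar_ccr : ∃ d : Fin s → Fin s → DiffPoly, ∀ j k g h,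
    comm (T.scalar j g) (T.scalar k h)
      = (-Complex.I * pauliJordan (m j) (testPoly (d j k) g) h) • (1 : Module.End ℂ T.dom)
  spinor_car : ∃ d : Fin f → SpinorIndex → Fin f → SpinorIndex → DiffPoly, ∀ A c B c' g h,
    anticomm (T.spinor A c g) (T.spinor B c' h)
      = (-Complex.I * pauliJordan (M A) (testPoly (d A c B c') g) h) • (1 : Module.End ℂ T.dom)
  mixed_ccr : ∀ j A c g h, comm (T.scalar j g) (T.spinor A c h) = 0

/-- The fields are linearly independent over the ring of partial derivative operators, up to
the equations of motion of the single fields: every linear relation with coefficients in that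
ring is a consequence of the Klein-Gordon and Dirac equations. -/
structure IsIndependent (T : ScalarMajoranaTheory H s f) (m : Fin s → ℝ) (M : Fin f → ℝ) :
    Prop where
  scalar : ∀ p : Fin s → DiffPoly, ∑ j, act (p j) (T.scalar j) = 0 →
    ∀ j, kleinGordon (m j) ∣ p j
  spinor : ∀ p : Fin f → SpinorIndex → DiffPoly,
    ∑ A, ∑ c, act (p A c) (T.spinor A c) = 0 →
      ∀ A, p A ∈ Submodule.span DiffPoly (Set.range (dirac (M A)))

/-! ### Supersymmetry -/

/-- Supercharges `Q_a`, `Q̄_ā = (Q_a)†`, making the fields into a supersymmetric multiplet. -/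
structure Supersymmetry (T : ScalarMajoranaTheory H s f) where
  Q : Fin 2 → Module.End ℂ T.dom
  Qbar : Fin 2 → Module.End ℂ T.dom
  /-- The infinitesimal generators of the translations, `U_{a,1} = exp (i a^μ P_μ)`. -/
  P : Fin 4 → Module.End ℂ T.dom
  Q_adjoint : ∀ a, IsAdjointOn (Q a) (Qbar a)
  P_generator : ∀ μ (χ : T.dom),
    HasDerivAt (fun t : ℝ => T.U (EuclideanSpace.single μ t) 1 (χ : H))
      (Complex.I • ((P μ χ : T.dom) : H)) 0
  Q_vac : ∀ a, Q a T.vac = 0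
  Qbar_vac : ∀ a, Qbar a T.vac = 0
  Q_Q : ∀ a b, anticomm (Q a) (Q b) = 0
  Q_Qbar : ∀ a b, anticomm (Q a) (Qbar b) = (2 : ℂ) • ∑ μ, pauli μ a b • P μ
  Q_P : ∀ a μ, comm (Q a) (P μ) = 0
  /-- `U⁻¹ Q_b U = A_b^c Q_c`. -/
  Q_covariant : ∀ (x : Spacetime) (A : SL(2, ℂ)) (b : Fin 2),
    Q b * T.Ud x A = T.Ud x A * ∑ c, A.1 b c • Q c
  /-- `i [Q_a, φ^j]` is a linear combination of derivatives of the spinor fields. -/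
  scalar_tensor : ∃ p : Fin 2 → Fin s → Fin f → SpinorIndex → DiffPoly, ∀ a j,
    Complex.I • commField (Q a) (T.scalar j) = ∑ B, ∑ c, act (p a j B c) (T.spinor B c)
  /-- `{Q_a, f^A_b}` and `{Q_a, f̄^A_b̄}` are linear combinations of derivatives of the scalar
  fields. -/
  spinor_tensor : ∃ q : Fin 2 → Fin f → SpinorIndex → Fin s → DiffPoly, ∀ a A c,
    anticommField (Q a) (T.spinor A c) = ∑ j, act (q a A c j) (T.scalar j)

/-- Supercharges acting on a complex scalar field `φ` (with adjoint `φ†`) and a Majorana field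
as in the Wess-Zumino multiplet of mass `μ`. -/
structure IsWessZumino {T : ScalarMajoranaTheory H s f} (S : Supersymmetry T)
    (φ φd : Field T.dom) (F : SpinorIndex → Field T.dom) (μ : ℝ) : Prop where
  adjoint : IsAdjointField φ φd
  majorana : ∀ a, IsAdjointField (F (Sum.inl a)) (F (Sum.inr a))
  scalar_eq : act (kleinGordon μ) φ = 0
  spinor_eq : ∀ r, ∑ c, act (dirac μ r c) (F c) = 0
  Q_φ : ∀ a, commField (S.Q a) φ = 0
  Qbar_φd : ∀ a, commField (S.Qbar a) φd = 0
  Q_φd : ∀ a, Complex.I • commField (S.Q a) φd = (2 : ℂ) • F (Sum.inl a)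
  Qbar_φ : ∀ a, Complex.I • commField (S.Qbar a) φ = (2 : ℂ) • F (Sum.inr a)
  Q_f : ∀ a b, anticommField (S.Q a) (F (Sum.inl b)) = (-Complex.I * μ * epsLow a b) • φ
  Qbar_fbar : ∀ a b,
    anticommField (S.Qbar a) (F (Sum.inr b)) = (Complex.I * μ * epsLow a b) • φd
  Q_fbar : ∀ a b, anticommField (S.Q a) (F (Sum.inr b)) = act (slash a b) φ
  Qbar_f : ∀ a b, anticommField (S.Qbar a) (F (Sum.inl b)) = act (slash b a) φd

/-- The scalar field `∑_j c_j φ^j`. -/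
def scalarComb (T : ScalarMajoranaTheory H s f) (c : Fin s → ℂ) : Field T.dom :=
  ∑ j, c j • T.scalar j

/-- The component `c` of the Majorana field `∑_A w_A f^A`, `w` real. -/
def spinorComb (T : ScalarMajoranaTheory H s f) (w : Fin f → ℝ) (c : SpinorIndex) :
    Field T.dom :=
  ∑ A, (w A : ℂ) • T.spinor A c

/-- The linear combinations of derivatives of the Hermitian scalar fields `∑_j v_j φ^j`, `v ∈ V`. -/
def scalarSpan (T : ScalarMajoranaTheory H s f) (V : Submodule ℝ (Fin s → ℝ)) :
    Submodule ℂ (Field T.dom) :=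
  Submodule.span ℂ {F | ∃ p : DiffPoly, ∃ v ∈ V, F = act p (scalarComb T fun j => (v j : ℂ))}

/-- The linear combinations of derivatives of the components of the Majorana fields
`∑_A w_A f^A`, `w ∈ W`. -/
def spinorSpan (T : ScalarMajoranaTheory H s f) (W : Submodule ℝ (Fin f → ℝ)) :
    Submodule ℂ (Field T.dom) :=
  Submodule.span ℂ {F | ∃ p : DiffPoly, ∃ w ∈ W, ∃ c, F = act p (spinorComb T w c)}

/-- The Hermitian scalars given by `V` and the Majorana fields given by `W` form a
supersymmetric multiplet by themselves. -/
structure IsSubmultiplet {T : ScalarMajoranaTheory H s f} (S : Supersymmetry T)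
    (V : Submodule ℝ (Fin s → ℝ)) (W : Submodule ℝ (Fin f → ℝ)) : Prop where
  scalar : ∀ v ∈ V, ∀ a,
    commField (S.Q a) (scalarComb T fun j => (v j : ℂ)) ∈ spinorSpan T W ∧
    commField (S.Qbar a) (scalarComb T fun j => (v j : ℂ)) ∈ spinorSpan T W
  spinor : ∀ w ∈ W, ∀ a c,
    anticommField (S.Q a) (spinorComb T w c) ∈ scalarSpan T V ∧
    anticommField (S.Qbar a) (spinorComb T w c) ∈ scalarSpan T V

/-- A nonzero multiplet without proper nonzero submultiplets. -/
structure IsIrreducibleMultiplet {T : ScalarMajoranaTheory H s f} (S : Supersymmetry T)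
    (V : Submodule ℝ (Fin s → ℝ)) (W : Submodule ℝ (Fin f → ℝ)) : Prop where
  isSubmultiplet : IsSubmultiplet S V W
  nonzero : ¬ (V = ⊥ ∧ W = ⊥)
  minimal : ∀ V' ≤ V, ∀ W' ≤ W, IsSubmultiplet S V' W' →
    (V' = ⊥ ∧ W' = ⊥) ∨ (V' = V ∧ W' = W)

/-- The real and imaginary parts of `φ = ∑_j c_j φ^j` span this space of Hermitian scalars. -/
def realSpan (c : Fin s → ℂ) : Submodule ℝ (Fin s → ℝ) :=
  Submodule.span ℝ {fun j => (c j).re, fun j => (c j).im}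

/-- The multiplet is the direct sum, over `A`, of irreducible Wess-Zumino multiplets, consisting of
the complex scalar `∑_j c_{Aj} φ^j` and the Majorana field `f^A`, both of mass `M_A`. -/
structure IsWessZuminoDecomposition {T : ScalarMajoranaTheory H s f} (S : Supersymmetry T)
    (M : Fin f → ℝ) (c : Fin f → Fin s → ℂ) : Prop where
  finrank_eq : ∀ A, Module.finrank ℝ (realSpan (c A)) = 2
  isInternal : DirectSum.IsInternal fun A => realSpan (c A)
  isIrreducible : ∀ A,
    IsIrreducibleMultiplet S (realSpan (c A)) (Submodule.span ℝ {Pi.single A (1 : ℝ)})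
  isWessZumino : ∀ A, IsWessZumino S (scalarComb T (c A))
    (scalarComb T fun j => (starRingEnd ℂ) (c A j)) (T.spinor A) (M A)

/-- Canonical normalization of the Majorana fields:
`{f^A_a(x), f̄^B_b̄(y)} = δ_{AB} σ^μ_{ab̄} ∂_μ D_{M_A}(x - y)`. -/
def IsNormalized (T : ScalarMajoranaTheory H s f) (M : Fin f → ℝ) : Prop :=
  ∀ A B a b g h, anticomm (T.spinor A (Sum.inl a) g) (T.spinor B (Sum.inr b) h)
    = (if A = B then pauliJordan (M A) (testPoly (slash a b) g) h else 0) •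
      (1 : Module.End ℂ T.dom)

/-- The remaining causal (anti)commutators of mutually independent Wess-Zumino multiplets with
complex scalars `∑_j c_{Aj} φ^j` and Majorana fields `f^A`. -/
structure HasWessZuminoCommutators (T : ScalarMajoranaTheory H s f)
    (M : Fin f → ℝ) (c : Fin f → Fin s → ℂ) : Prop where
  φ_φd : ∀ A B g h,
    comm (scalarComb T (c A) g) (scalarComb T (fun j => (starRingEnd ℂ) (c B j)) h)
      = (if A = B then -2 * Complex.I * pauliJordan (M A) g h else 0) •
        (1 : Module.End ℂ T.dom)
  φ_φ : ∀ A B g h, comm (scalarComb T (c A) g) (scalarComb T (c B) h) = 0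
  f_f : ∀ A B a b g h, anticomm (T.spinor A (Sum.inl a) g) (T.spinor B (Sum.inl b) h)
    = (if A = B then Complex.I * epsLow a b * M A * pauliJordan (M A) g h else 0) •
      (1 : Module.End ℂ T.dom)
  φ_f : ∀ A B d g h, comm (scalarComb T (c A) g) (T.spinor B d h) = 0

end Theory

end SusyQFT

end

open SusyQFT

noncomputable section

namespace SusyQFT

/-! ### The ring of constant coefficient differential operators -/

/-! Differentiating translation covariance gives i[P_μ, φ] = ∂_μ φ (`Frame.commField_generator`), so
the superalgebra makes {Q_a, Q̄_b} act on every field as -2i σ^μ_{ab} ∂_μ. Most of the later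
relations are graded Jacobi identities combined with this one. Indices below run over 0, 1 as in the
code.

The decisive point is that supercharges produce no derivatives on scalars: i[Q_a, φ^j] = ∑_B α_{jB}
f^B_a with constants α. The polynomial coefficients are only defined modulo the Dirac module.
Multiplying by the Dirac symbol of opposite mass turns membership in that module into divisibility
by the Klein-Gordon polynomial (`mem_span_dirac_iff`), and this in turn follows from vanishing on an
open part of the mass shell (`kleinGordon_dvd`). Covariance therefore becomes a statement about a
matrix function on the shell. The part of the shell in question lies in a single SL(2,ℂ) orbit, so
the function is determined by its value at one point, and the stabilizer of that point leaves a
single constant free (`eq_smul_of_stabilizer`). The Klein-Gordon equation forces α_{jB} = 0 unless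
m_j = M_B.

The complex scalars come from the opposite arrow. The on-shell values of the coefficients of {Q_0,
f̄^A_0} define c_{Aj}, and the Jacobi identities for (Q, Q) and (Q, Q̄) give ∑ c α = 0 and ∑ c̄ α =
2δ (`exists_dual_coefficients`). A combination of scalars commuting with Q_0 and Q̄_0 is annihilated
by ∂_0 + ∂_3 and hence vanishes, so no nonzero coefficient vector is orthogonal to α and ᾱ. Thus (α,
ᾱ) is an invertible s × 2f matrix. In real terms v ↦ (∑_j v_j α_{jB})_B identifies ℝ^s with ℂ^f, and
V_A is the A-th coordinate line.

The Wess-Zumino relations follow from Jacobi identities. The only delicate one is {Q_a, f_b}: it is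
antisymmetric in a, b, and {Q_0, f_1} + iMφ vanishes because it commutes with Q_0 and Q̄_0. For
irreducibility, f^A generates (∂_0 + ∂_3)φ^A, whose on-shell coefficients recover all of V_A.

For the causal commutators, the Jacobi identity moves a supercharge from one field to the other,
which determines the scalar commutators only after applying σ^μ_{aa} ∂_μ. Summing over a leaves a
time derivative of the Pauli-Jordan function, and Fourier inversion on the mass shell removes it
(`pauliJordan_eq_zero`). -/

theorem lineDeriv_comm (v w : Spacetime) (g : Test) : ∂_{v} (∂_{w} g) = ∂_{w} (∂_{v} g) := by
  have key : ∀ (v w : Spacetime) x, (∂_{v} (∂_{w} g)) x = fderiv ℝ (fderiv ℝ g) x v w := by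
    intro v w x
    have h : ((∂_{w} g : Test) : Spacetime → ℂ) = fun y => fderiv ℝ g y w := by
      ext y; rfl
    rw [SchwartzMap.lineDerivOp_apply_eq_fderiv, h, fderiv_clm_apply _ (by fun_prop)]
    · simp
    · exact ((g.smooth 2).fderiv_right (m := 1) (by norm_num)).differentiable (by norm_num) x
  ext x
  rw [key, key]
  exact ((g.smooth 2).contDiffAt.isSymmSndFDerivAt (by simp)) v w

theorem negPartial_apply (μ : Fin 4) (g : Test) :
    negPartial μ g = -∂_{EuclideanSpace.single μ (1 : ℝ)} g := rfl

theorem negPartial_commute (μ ν : Fin 4) : Commute (negPartial μ) (negPartial ν) := by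
  refine LinearMap.ext fun g => ?_
  simp only [Module.End.mul_apply, negPartial_apply, LineDeriv.lineDerivOp_neg, neg_neg]
  exact lineDeriv_comm _ _ g

/-- The monomial `(-∂)^n`. -/
def negPartialPow (n : Fin 4 →₀ ℕ) : Module.End ℂ Test :=
  negPartial 0 ^ n 0 * negPartial 1 ^ n 1 * negPartial 2 ^ n 2 * negPartial 3 ^ n 3

theorem negPartialPow_add (n k : Fin 4 →₀ ℕ) :
    negPartialPow (n + k) = negPartialPow n * negPartialPow k := by
  have c : ∀ μ ν (i j : ℕ), Commute (negPartial μ ^ i) (negPartial ν ^ j) :=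
    fun μ ν i j => (negPartial_commute μ ν).pow_pow i j
  simp only [negPartialPow, Finsupp.add_apply, pow_add]
  rw [((c 3 0 _ _).mul_right (c 3 1 _ _) |>.mul_right (c 3 2 _ _)).mul_mul_mul_comm,
    ((c 2 0 _ _).mul_right (c 2 1 _ _)).mul_mul_mul_comm, (c 1 0 _ _).mul_mul_mul_comm]

theorem negPartialPow_zero : negPartialPow 0 = 1 := by simp [negPartialPow]

theorem testPoly_eq_sum (p : DiffPoly) {t : Finset (Fin 4 →₀ ℕ)} (h : p.support ⊆ t) :
    testPoly p = ∑ n ∈ t, p.coeff n • negPartialPow n :=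
  Finset.sum_subset h fun n _ hn => by rw [MvPolynomial.notMem_support_iff.mp hn, zero_smul]

theorem testPoly_add (p q : DiffPoly) : testPoly (p + q) = testPoly p + testPoly q := by
  classical
  rw [testPoly_eq_sum p (t := p.support ∪ q.support) Finset.subset_union_left,
    testPoly_eq_sum q (t := p.support ∪ q.support) Finset.subset_union_right,
    testPoly_eq_sum (p + q) MvPolynomial.support_add, ← Finset.sum_add_distrib]
  simp [add_smul]

theorem testPoly_monomial (n : Fin 4 →₀ ℕ) (c : ℂ) :
    testPoly (MvPolynomial.monomial n c) = c • negPartialPow n := by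
  rw [testPoly_eq_sum _ (t := {n}) MvPolynomial.support_monomial_subset]
  simp

theorem testPoly_C (c : ℂ) : testPoly (MvPolynomial.C c) = c • 1 := by
  rw [MvPolynomial.C_apply, testPoly_monomial, negPartialPow_zero]

theorem testPoly_X (μ : Fin 4) : testPoly (MvPolynomial.X μ) = negPartial μ := by
  rw [MvPolynomial.X, testPoly_monomial, one_smul]
  fin_cases μ <;> simp [negPartialPow]

theorem testPoly_mul (p q : DiffPoly) : testPoly (p * q) = testPoly p * testPoly q := by
  induction p using MvPolynomial.induction_on' with
  | monomial n c =>
    induction q using MvPolynomial.induction_on' with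
    | monomial k d =>
      rw [MvPolynomial.monomial_mul, testPoly_monomial, testPoly_monomial, testPoly_monomial,
        negPartialPow_add, smul_mul_smul_comm]
    | add q₁ q₂ h₁ h₂ => rw [mul_add, testPoly_add, testPoly_add, h₁, h₂, mul_add]
  | add p₁ p₂ h₁ h₂ => rw [add_mul, testPoly_add, testPoly_add, h₁, h₂, add_mul]

/-- `p ↦ p(-∂)` as a homomorphism of algebras. -/
def testPolyHom : DiffPoly →ₐ[ℂ] Module.End ℂ Test :=
  AlgHom.ofLinearMap
    { toFun := testPoly
      map_add' := testPoly_add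
      map_smul' := fun c p => by
        rw [MvPolynomial.smul_eq_C_mul, testPoly_mul, testPoly_C, smul_mul_assoc, one_mul,
          RingHom.id_apply] }
    (by change testPoly 1 = 1
        rw [← MvPolynomial.C_1, testPoly_C, one_smul]) testPoly_mul

theorem testPolyHom_apply (p : DiffPoly) : testPolyHom p = testPoly p := rfl

/-- An intertwining relation for the operators `p(-∂)` follows from that for `-∂_μ`. -/
theorem testPoly_intertwine {E : Type*} [AddCommGroup E] (L : Test →+ E)
    (R : DiffPoly → E → E) (hC : ∀ c g, L (testPoly (.C c) g) = R (.C c) (L g))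
    (hX : ∀ μ g, L (testPoly (.X μ) g) = R (.X μ) (L g))
    (hadd : ∀ p q e, R (p + q) e = R p e + R q e) (hmul : ∀ p q e, R (p * q) e = R p (R q e))
    (p : DiffPoly) (g : Test) : L (testPoly p g) = R p (L g) := by
  induction p using MvPolynomial.induction_on generalizing g with
  | C c => exact hC c g
  | add p q hp hq => rw [testPoly_add, LinearMap.add_apply, map_add, hp, hq, hadd]
  | mul_X p μ hp => rw [testPoly_mul, Module.End.mul_apply, hp, hX, hmul]

end SusyQFT

namespace SusyQFT

/-! ### Complex conjugation of test functions -/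

/-- Complex conjugation of the coefficients of a differential operator. -/
def conjPoly : DiffPoly →+* DiffPoly := MvPolynomial.map (starRingEnd ℂ)

/-- The complex conjugate of a test function. -/
def conjTest (g : Test) : Test :=
  SchwartzMap.postcompCLM (Complex.conjCLE : ℂ →L[ℝ] ℂ) g

theorem conjTest_apply (g : Test) (x : Spacetime) : conjTest g x = (starRingEnd ℂ) (g x) := by
  simp [conjTest]

theorem conjTest_add (g h : Test) : conjTest (g + h) = conjTest g + conjTest h := by
  ext x; simp [conjTest_apply]

theorem conjTest_smul (c : ℂ) (g : Test) :
    conjTest (c • g) = (starRingEnd ℂ) c • conjTest g := by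
  ext x; simp [conjTest_apply]

theorem conjTest_negPartial (μ : Fin 4) (g : Test) :
    conjTest (negPartial μ g) = negPartial μ (conjTest g) := by
  ext x
  have h : ((conjTest g : Test) : Spacetime → ℂ) = (Complex.conjCLE : ℂ →L[ℝ] ℂ) ∘ g := by
    ext y; simp [conjTest_apply]
  rw [conjTest_apply, negPartial_apply, negPartial_apply, neg_apply,
    neg_apply, SchwartzMap.lineDerivOp_apply_eq_fderiv,
    SchwartzMap.lineDerivOp_apply_eq_fderiv, h,
    (((Complex.conjCLE : ℂ →L[ℝ] ℂ).hasFDerivAt).comp x (g.hasFDerivAt x)).fderiv]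
  simp

theorem conjTest_testPoly (p : DiffPoly) (g : Test) :
    conjTest (testPoly p g) = testPoly (conjPoly p) (conjTest g) := by
  refine testPoly_intertwine (AddMonoidHom.mk' conjTest conjTest_add)
    (fun p e => testPoly (conjPoly p) e) ?_ ?_ ?_ ?_ p g
  · intro c g
    simp [testPoly_C, conjPoly, conjTest_smul]
  · intro μ g
    simp [testPoly_X, conjPoly, conjTest_negPartial]
  · intro p q e
    rw [map_add, testPoly_add]; rfl
  · intro p q e
    rw [map_mul, testPoly_mul]; rfl

/-! ### Lorentz transformations -/

theorem pauli_isHermitian (μ : Fin 4) : (pauli μ)ᴴ = pauli μ := by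
  ext a b
  fin_cases μ <;> fin_cases a <;> fin_cases b <;> simp [pauli]

theorem hermMatrix_isHermitian (x : Spacetime) : (hermMatrix x)ᴴ = hermMatrix x := by
  simp [hermMatrix, Matrix.conjTranspose_sum, Matrix.conjTranspose_smul, pauli_isHermitian]

theorem hermMatrix_eq (x : Spacetime) : hermMatrix x =
    !![(x 0 - x 3 : ℂ), -x 1 + Complex.I * x 2; -x 1 - Complex.I * x 2, x 0 + x 3] := by
  ext a b
  fin_cases a <;> fin_cases b <;>
    simp [hermMatrix, Fin.sum_univ_four, metric, pauli] <;> ring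

theorem metric_mul_self (μ : Fin 4) : metric μ * metric μ = 1 := by
  fin_cases μ <;> simp [metric]

/-- Every Hermitian matrix is of the form `σ(x)`. -/
theorem hermMatrix_components {B : Matrix (Fin 2) (Fin 2) ℂ} (hB : Bᴴ = B) :
    hermMatrix (WithLp.toLp 2 fun μ => metric μ * ((pauli μ * B).trace.re / 2)) = B := by
  have h00 : (B 0 0).im = 0 := by
    have := congrFun (congrFun hB 0) 0
    exact Complex.conj_eq_iff_im.mp this
  have h11 : (B 1 1).im = 0 := by
    have := congrFun (congrFun hB 1) 1
    exact Complex.conj_eq_iff_im.mp this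
  have h10 : (starRingEnd ℂ) (B 0 1) = B 1 0 := congrFun (congrFun hB 1) 0
  have e1 := congrArg Complex.re h10
  have e2 := congrArg Complex.im h10
  simp at e1 e2
  rw [hermMatrix_eq]
  ext a b
  fin_cases a <;> fin_cases b <;> apply Complex.ext <;>
    simp [metric, pauli, Matrix.trace_fin_two, Matrix.vecMul, dotProduct, Fin.sum_univ_two, h00, h11, ← e1, ← e2] <;> ring

theorem components_hermMatrix (x : Spacetime) (μ : Fin 4) :
    metric μ * ((pauli μ * hermMatrix x).trace.re / 2) = x μ := by
  rw [hermMatrix_eq]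
  fin_cases μ <;>
    simp [metric, pauli, Matrix.trace_fin_two] <;> ring

theorem hermMatrix_injective : Function.Injective hermMatrix := fun x y h => by
  ext μ
  rw [← components_hermMatrix x, h, components_hermMatrix]

theorem hermMatrix_lorentz (A : SL(2, ℂ)) (x : Spacetime) :
    hermMatrix (lorentz A x) = A.1 * hermMatrix x * (A.1)ᴴ :=
  hermMatrix_components (by
    simp only [Matrix.conjTranspose_mul, Matrix.conjTranspose_conjTranspose,
      hermMatrix_isHermitian, Matrix.mul_assoc])

theorem hermMatrix_add (x y : Spacetime) : hermMatrix (x + y) = hermMatrix x + hermMatrix y := by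
  simp [hermMatrix, mul_add, add_smul, Finset.sum_add_distrib]

theorem hermMatrix_smul (r : ℝ) (x : Spacetime) : hermMatrix (r • x) = (r : ℂ) • hermMatrix x := by
  simp only [hermMatrix, Finset.smul_sum, smul_smul]
  refine Finset.sum_congr rfl fun μ _ => ?_
  congr 1
  simp; ring

theorem lorentz_inv_lorentz (A : SL(2, ℂ)) (x : Spacetime) : lorentz A⁻¹ (lorentz A x) = x := by
  apply hermMatrix_injective
  have h : (A⁻¹).1 * A.1 = 1 := congrArg Subtype.val (inv_mul_cancel A)
  rw [hermMatrix_lorentz, hermMatrix_lorentz]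
  calc _ = ((A⁻¹).1 * A.1) * hermMatrix x * ((A⁻¹).1 * A.1)ᴴ := by
        simp only [Matrix.conjTranspose_mul, Matrix.mul_assoc]
    _ = _ := by rw [h]; simp

/-- The Lorentz transformation `δ(A)` as a linear equivalence. -/
def lorentzEquiv (A : SL(2, ℂ)) : Spacetime ≃L[ℝ] Spacetime :=
  LinearEquiv.toContinuousLinearEquiv
    { toFun := lorentz A
      map_add' := fun x y => hermMatrix_injective (by
        simp only [hermMatrix_lorentz, hermMatrix_add, mul_add, add_mul])
      map_smul' := fun r x => hermMatrix_injective (by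
        simp only [hermMatrix_lorentz, hermMatrix_smul, RingHom.id_apply, mul_smul_comm,
          smul_mul_assoc])
      invFun := lorentz A⁻¹
      left_inv := lorentz_inv_lorentz A
      right_inv := fun x => by
        simpa using lorentz_inv_lorentz A⁻¹ x }

theorem lorentzEquiv_symm_apply (A : SL(2, ℂ)) (x : Spacetime) :
    (lorentzEquiv A).symm x = lorentz A⁻¹ x := rfl

/-- The Lorentz transformed test function `g ∘ δ(A)`. -/
def lorentzTest (A : SL(2, ℂ)) (g : Test) : Test :=
  SchwartzMap.compCLMOfContinuousLinearEquiv ℂ (lorentzEquiv A) g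

theorem lorentzTest_apply (A : SL(2, ℂ)) (g : Test) (x : Spacetime) :
    lorentzTest A g x = g (lorentz A x) := rfl

/-- The action of `SL(2,ℂ)` on constant coefficient differential operators. -/
def lorentzPoly (A : SL(2, ℂ)) : DiffPoly →ₐ[ℂ] DiffPoly :=
  MvPolynomial.aeval fun μ => ∑ ν,
    MvPolynomial.C ((lorentz A⁻¹ (EuclideanSpace.single μ 1) ν : ℝ) : ℂ) * MvPolynomial.X ν

/-- Chain rule: ∂_μ g pulled back along δ(A) is the derivative of g ∘ δ(A) in the direction δ(A)⁻¹
e_μ, which is why `lorentzPoly` contains the inverse. -/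
theorem lorentzTest_testPoly (A : SL(2, ℂ)) (p : DiffPoly) (g : Test) :
    lorentzTest A (testPoly p g) = testPoly (lorentzPoly A p) (lorentzTest A g) := by
  refine testPoly_intertwine
    (SchwartzMap.compCLMOfContinuousLinearEquiv ℂ (lorentzEquiv A)).toLinearMap.toAddMonoidHom
    (fun p e => testPoly (lorentzPoly A p) e) ?_ ?_ ?_ ?_ p g
  · intro c g
    simp [testPoly_C, lorentzPoly]
  · intro μ g
    have hb : EuclideanSpace.single μ (1 : ℝ) =
        lorentzEquiv A ((lorentzEquiv A).symm (EuclideanSpace.single μ 1)) := by simp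
    have hs : (lorentzEquiv A).symm (EuclideanSpace.single μ 1) =
        ∑ ν, (lorentz A⁻¹ (EuclideanSpace.single μ 1) ν) • EuclideanSpace.single ν (1 : ℝ) := by
      rw [lorentzEquiv_symm_apply]
      ext ν
      simp [Pi.single_apply]
    have := SchwartzMap.lineDerivOp_compCLMOfContinuousLinearEquiv (𝕜 := ℂ)
      ((lorentzEquiv A).symm (EuclideanSpace.single μ 1)) (lorentzEquiv A) g
    rw [← hb] at this
    simp only [LinearMap.toAddMonoidHom_coe, ContinuousLinearMap.coe_coe, testPoly_X,
      negPartial_apply, map_neg, ← this]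
    rw [hs, LineDeriv.lineDerivOp_left_sum]
    simp only [lorentzPoly, MvPolynomial.aeval_X, ← testPolyHom_apply, map_sum, map_mul]
    simp only [testPolyHom_apply, testPoly_C, testPoly_X, LinearMap.sum_apply,
      LineDeriv.lineDerivOp_left_smul, smul_mul_assoc, one_mul, LinearMap.smul_apply,
      negPartial_apply, smul_neg, Finset.sum_neg_distrib, Complex.coe_smul]
  · intro p q e
    rw [map_add, testPoly_add]; rfl
  · intro p q e
    rw [map_mul, testPoly_mul]; rfl

end SusyQFT

namespace SusyQFT

/-! ### Translations of test functions -/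

open Filter Topology

/-- The translated test function `x ↦ g(x - a)`. -/
abbrev translate (a : Spacetime) (g : Test) : Test := SchwartzMap.compSubConstCLM ℂ a g

theorem translate_zero (g : Test) : translate 0 g = g := by
  ext x; simp

theorem iteratedFDeriv_translate (a : Spacetime) (g : Test) (n : ℕ) (x : Spacetime) :
    iteratedFDeriv ℝ n (translate a g) x = iteratedFDeriv ℝ n g (x - a) := by
  have : ((translate a g : Test) : Spacetime → ℂ) = fun y => g (y - a) := rfl
  rw [this, iteratedFDeriv_comp_sub]

theorem fderiv_iteratedFDeriv (g : Test) (n : ℕ) (x e : Spacetime) :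
    fderiv ℝ (iteratedFDeriv ℝ n g) x e = iteratedFDeriv ℝ n (∂_{e} g : Test) x := by
  have hd : Differentiable ℝ (iteratedFDeriv ℝ n g) :=
    (g.smooth ⊤).differentiable_iteratedFDeriv (mod_cast ENat.natCast_lt_top n)
  have comm : ∀ (n : ℕ) (m : Fin n → Spacetime) (g : Test), ∂^{m} (∂_{e} g) = ∂_{e} (∂^{m} g) := by
    intro n
    induction n with
    | zero => intro m g; rfl
    | succ n ih =>
      intro m g
      rw [LineDeriv.iteratedLineDerivOp_succ_left, ih, lineDeriv_comm,
        ← LineDeriv.iteratedLineDerivOp_succ_left]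
  ext m
  rw [← SchwartzMap.iteratedLineDerivOp_eq_iteratedFDeriv (f := ∂_{e} g), comm,
    SchwartzMap.lineDerivOp_apply_eq_fderiv]
  have : ((∂^{m} g : Test) : Spacetime → ℂ) = fun y => iteratedFDeriv ℝ n g y m := by
    ext y; exact SchwartzMap.iteratedLineDerivOp_eq_iteratedFDeriv
  rw [this, fderiv_continuousMultilinear_apply_const_apply (hd x)]

theorem hasDerivAt_iteratedFDeriv_translate (g : Test) (n : ℕ) (x e : Spacetime) (t : ℝ) :
    HasDerivAt (fun s : ℝ => iteratedFDeriv ℝ n (translate (s • e) g) x)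
      (-iteratedFDeriv ℝ n (translate (t • e) (∂_{e} g)) x) t := by
  have hd : Differentiable ℝ (iteratedFDeriv ℝ n g) :=
    (g.smooth ⊤).differentiable_iteratedFDeriv (mod_cast ENat.natCast_lt_top n)
  simp only [iteratedFDeriv_translate]
  have h1 : HasDerivAt (fun s : ℝ => x - s • e) (-e) t := by
    simpa using ((hasDerivAt_id t).smul_const e).const_sub x
  have := (hd (x - t • e)).hasFDerivAt.comp_hasDerivAt t h1
  rw [map_neg, fderiv_iteratedFDeriv] at this
  exact this

/-- A translation by at most ‖e‖ costs only the weight (‖x‖ + ‖e‖)^k. The next two bounds integrate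
this one once and twice in t, with g replaced by its derivative along e, and so give a Taylor
remainder of order t² in each seminorm. -/
theorem seminorm_translate_le (k n : ℕ) (g : Test) (e : Spacetime) :
    ∃ C, 0 ≤ C ∧ ∀ t : ℝ, |t| ≤ 1 → ∀ x,
      ‖x‖ ^ k * ‖iteratedFDeriv ℝ n (translate (t • e) g) x‖ ≤ C := by
  refine ⟨2 ^ (k - 1) * (SchwartzMap.seminorm ℝ k n g + ‖e‖ ^ k * SchwartzMap.seminorm ℝ 0 n g),
    by positivity, fun t ht x => ?_⟩
  rw [iteratedFDeriv_translate]
  have hx : ‖x‖ ≤ ‖x - t • e‖ + ‖e‖ := by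
    calc ‖x‖ = ‖(x - t • e) + t • e‖ := by rw [sub_add_cancel]
      _ ≤ ‖x - t • e‖ + ‖t • e‖ := norm_add_le _ _
      _ ≤ _ := by
        rw [norm_smul, Real.norm_eq_abs]
        gcongr
        exact mul_le_of_le_one_left (norm_nonneg _) ht
  have h1 := SchwartzMap.le_seminorm ℝ k n g (x - t • e)
  have h2 := SchwartzMap.norm_iteratedFDeriv_le_seminorm ℝ g n (x - t • e)
  calc ‖x‖ ^ k * ‖iteratedFDeriv ℝ n g (x - t • e)‖
      ≤ (‖x - t • e‖ + ‖e‖) ^ k * ‖iteratedFDeriv ℝ n g (x - t • e)‖ := by gcongr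
    _ ≤ (2 ^ (k - 1) * (‖x - t • e‖ ^ k + ‖e‖ ^ k)) * ‖iteratedFDeriv ℝ n g (x - t • e)‖ := by
        gcongr
        exact add_pow_le (norm_nonneg _) (norm_nonneg _) k
    _ = 2 ^ (k - 1) * (‖x - t • e‖ ^ k * ‖iteratedFDeriv ℝ n g (x - t • e)‖
          + ‖e‖ ^ k * ‖iteratedFDeriv ℝ n g (x - t • e)‖) := by ring
    _ ≤ _ := by gcongr

/-- If `u` moves with velocity at most `C` in the weighted norm, so does its increment. -/
theorem weighted_mean_value {E : Type*} [NormedAddCommGroup E] [NormedSpace ℝ E] {u u' : ℝ → E}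
    {w C : ℝ} (hw : 0 ≤ w) {t : ℝ} (hu : ∀ s, HasDerivAt u (u' s) s)
    (hC : ∀ s, |s| ≤ |t| → w * ‖u' s‖ ≤ C) : w * ‖u t - u 0‖ ≤ C * |t| := by
  have h := (convex_Icc (-|t|) |t|).norm_image_sub_le_of_norm_hasDerivWithin_le
    (f := fun s => w • u s) (f' := fun s => w • u' s) (x := 0) (y := t) (C := C)
    (fun s _ => ((hu s).const_smul w).hasDerivWithinAt)
    (fun s hs => by
      rw [norm_smul, Real.norm_eq_abs, abs_of_nonneg hw]
      exact hC s (abs_le.mpr hs))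
    ⟨by simp, by simp⟩ ⟨neg_abs_le t, le_abs_self t⟩
  rwa [← smul_sub, norm_smul, Real.norm_eq_abs, abs_of_nonneg hw, sub_zero,
    Real.norm_eq_abs] at h

theorem seminorm_translate_sub_le (k n : ℕ) (g : Test) (e : Spacetime) :
    ∃ C, 0 ≤ C ∧ ∀ t : ℝ, |t| ≤ 1 → ∀ x,
      ‖x‖ ^ k * ‖iteratedFDeriv ℝ n (translate (t • e) g) x - iteratedFDeriv ℝ n g x‖ ≤ C * |t| := by
  obtain ⟨C, hC0, hC⟩ := seminorm_translate_le k n (∂_{e} g) e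
  refine ⟨C, hC0, fun t ht x => ?_⟩
  have := weighted_mean_value (w := ‖x‖ ^ k) (by positivity) (t := t)
    (hasDerivAt_iteratedFDeriv_translate g n x e)
    (fun s hs => by rw [norm_neg]; exact hC s (hs.trans ht) x)
  rwa [zero_smul, translate_zero] at this

theorem seminorm_translate_sub_add_le (k n : ℕ) (g : Test) (e : Spacetime) :
    ∃ C, 0 ≤ C ∧ ∀ t : ℝ, |t| ≤ 1 → ∀ x,
      ‖x‖ ^ k * ‖iteratedFDeriv ℝ n (translate (t • e) g) x - iteratedFDeriv ℝ n g x
        + t • iteratedFDeriv ℝ n (∂_{e} g : Test) x‖ ≤ C * |t| * |t| := by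
  obtain ⟨C, hC0, hC⟩ := seminorm_translate_sub_le k n (∂_{e} g) e
  refine ⟨C, hC0, fun t ht x => ?_⟩
  have := weighted_mean_value (w := ‖x‖ ^ k) (C := C * |t|) (by positivity) (t := t)
    (fun s => (hasDerivAt_iteratedFDeriv_translate g n x e s).add
      ((hasDerivAt_id s).smul_const (iteratedFDeriv ℝ n (∂_{e} g : Test) x)))
    (fun s hs => by
      rw [one_smul, neg_add_eq_sub, norm_sub_rev]
      exact (hC s (hs.trans ht) x).trans (by gcongr))
  simp only [Pi.add_apply, zero_smul, translate_zero, add_zero, id] at this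
  rwa [add_sub_right_comm] at this

/-- The second-order remainder C t², divided by t, tends to zero in every Schwartz seminorm. -/
theorem tendsto_translate (g : Test) (e : Spacetime) :
    Tendsto (fun t : ℝ => t⁻¹ • (translate (t • e) g - g)) (𝓝[≠] 0) (𝓝 (-∂_{e} g)) := by
  rw [(schwartz_withSeminorms ℝ Spacetime ℂ).tendsto_nhds]
  rintro ⟨k, n⟩ ε hε
  obtain ⟨C, hC0, hC⟩ := seminorm_translate_sub_add_le k n g e
  have hlim : Tendsto (fun t : ℝ => C * |t|) (𝓝[≠] 0) (𝓝 0) := by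
    have : Continuous fun t : ℝ => C * |t| := by fun_prop
    simpa using (this.tendsto 0).mono_left nhdsWithin_le_nhds
  have hsmall : ∀ᶠ t : ℝ in 𝓝[≠] 0, |t| ≤ 1 := by
    have : ∀ᶠ t : ℝ in 𝓝 0, |t| < 1 :=
      (continuous_abs.tendsto (0 : ℝ)).eventually_lt_const (by simp)
    exact (this.mono fun t h => h.le).filter_mono nhdsWithin_le_nhds
  filter_upwards [hlim.eventually_lt_const hε, hsmall, self_mem_nhdsWithin] with t h1 h2 h3
  refine lt_of_le_of_lt ?_ h1
  rw [SchwartzMap.schwartzSeminormFamily_apply]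
  refine SchwartzMap.seminorm_le_bound ℝ k n _ (by positivity) fun x => ?_
  have ht : 0 < |t| := abs_pos.mpr h3
  have heq : ((t⁻¹ • (translate (t • e) g - g) - -∂_{e} g : Test) : Spacetime → ℂ) =
      t⁻¹ • (((translate (t • e) g : Test) : Spacetime → ℂ) - (g : Spacetime → ℂ)
        + t • ((∂_{e} g : Test) : Spacetime → ℂ)) := by
    have h3' : t ≠ 0 := h3
    ext y
    simp [smul_add, h3']
  have hc : ∀ h : Test, ContDiffAt ℝ n h x := fun h => h.contDiffAt n
  have h := hC t h2 x
  have c1 : ContDiffAt ℝ n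
      (((translate (t • e) g : Test) : Spacetime → ℂ) - (g : Spacetime → ℂ)) x :=
    (hc _).sub (hc _)
  have c2 : ContDiffAt ℝ n (t • ((∂_{e} g : Test) : Spacetime → ℂ)) x := (hc _).const_smul t
  have c3 : ContDiffAt ℝ n (((translate (t • e) g : Test) : Spacetime → ℂ) - (g : Spacetime → ℂ)
      + t • ((∂_{e} g : Test) : Spacetime → ℂ)) x := c1.add c2
  rw [heq, iteratedFDeriv_const_smul_apply c3, iteratedFDeriv_add_apply c1 c2,
    iteratedFDeriv_sub_apply (hc _) (hc _), iteratedFDeriv_const_smul_apply (hc _), norm_smul,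
    norm_inv, Real.norm_eq_abs]
  calc _ = |t|⁻¹ * (‖x‖ ^ k * ‖iteratedFDeriv ℝ n (translate (t • e) g) x - iteratedFDeriv ℝ n g x
        + t • iteratedFDeriv ℝ n (∂_{e} g : Test) x‖) := by ring
    _ ≤ |t|⁻¹ * (C * |t| * |t|) := by gcongr
    _ = C * |t| := by field_simp

/-- Temperate distributions are differentiable along translations. -/
theorem hasDerivAt_translate {V : Type*} [NormedAddCommGroup V] [NormedSpace ℂ V]
    (L : Test →ₗ[ℂ] V) (hL : Continuous L) (g : Test) (μ : Fin 4) :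
    HasDerivAt (fun t : ℝ => L (translate (EuclideanSpace.single μ t) g)) (L (negPartial μ g)) 0 := by
  rw [hasDerivAt_iff_tendsto_slope]
  have h := (hL.tendsto _).comp (tendsto_translate g (EuclideanSpace.single μ 1))
  rw [negPartial_apply]
  refine h.congr fun t => ?_
  have he : t • EuclideanSpace.single μ (1 : ℝ) = EuclideanSpace.single μ t := by
    ext ν; simp
  have h0 : translate (EuclideanSpace.single μ (0 : ℝ)) g = g := by
    rw [show EuclideanSpace.single μ (0 : ℝ) = 0 by ext ν; simp, translate_zero]
  simp only [slope, vsub_eq_sub, sub_zero, Function.comp_apply, he, h0, ← map_sub]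
  exact (L.restrictScalars ℝ).map_smul _ _

end SusyQFT

namespace SusyQFT

/-! ### Fields as a module over the differential operators -/

section Fields

variable {H : Type*} [NormedAddCommGroup H] [InnerProductSpace ℂ H] {dom : Submodule ℂ H}

instance endAddCommGroup : AddCommGroup (Module.End ℂ dom) := LinearMap.addCommGroup

instance fieldAddCommGroup : AddCommGroup (Field dom) := LinearMap.addCommGroup

theorem act_apply (p : DiffPoly) (φ : Field dom) (g : Test) : act p φ g = φ (testPoly p g) := rfl

/-- The module structure `p ↦ p(∂)` on fields. -/
def actHom : DiffPoly →ₐ[ℂ] Module.End ℂ (Field dom) :=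
  AlgHom.ofLinearMap
    { toFun := fun p =>
        { toFun := act p
          map_add' := fun _ _ => rfl
          map_smul' := fun _ _ => rfl }
      map_add' := fun p q => by
        ext φ g : 2
        change φ (testPoly (p + q) g) = φ (testPoly p g) + φ (testPoly q g)
        rw [testPoly_add, LinearMap.add_apply, map_add]
      map_smul' := fun c p => by
        ext φ g : 2
        have : testPoly (c • p) = c • testPoly p := map_smul testPolyHom c p
        change φ (testPoly (c • p) g) = c • φ (testPoly p g)
        rw [this, LinearMap.smul_apply, map_smul] }
    (by
      ext φ g : 2
      have : testPoly 1 = 1 := map_one testPolyHom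
      change φ (testPoly 1 g) = φ g
      rw [this, Module.End.one_apply])
    (fun p q => by
      ext φ g : 2
      change φ (testPoly (p * q) g) = φ (testPoly q (testPoly p g))
      -- Transposition reverses the order of composition; commutativity of the polynomial ring
      -- repairs it.
      rw [mul_comm, testPoly_mul, Module.End.mul_apply])

theorem act_eq (p : DiffPoly) (φ : Field dom) : act p φ = actHom p φ := rfl

theorem act_add (p q : DiffPoly) (φ : Field dom) : act (p + q) φ = act p φ + act q φ := by
  simp [act_eq]

theorem act_mul (p q : DiffPoly) (φ : Field dom) : act (p * q) φ = act p (act q φ) := by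
  simp [act_eq]

theorem act_smul (c : ℂ) (p : DiffPoly) (φ : Field dom) : act (c • p) φ = c • act p φ := by
  simp [act_eq]

theorem act_C_mul (c : ℂ) (p : DiffPoly) (φ : Field dom) :
    act (MvPolynomial.C c * p) φ = c • act p φ := by
  rw [← MvPolynomial.smul_eq_C_mul, act_smul]

theorem act_one (φ : Field dom) : act 1 φ = φ := by simp [act_eq]

theorem act_C (c : ℂ) (φ : Field dom) : act (MvPolynomial.C c) φ = c • φ := by
  rw [← mul_one (MvPolynomial.C c), act_C_mul, act_one]

theorem act_zero_left (φ : Field dom) : act 0 φ = 0 := by simp [act_eq]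

theorem act_neg (p : DiffPoly) (φ : Field dom) : act (-p) φ = -act p φ := by simp [act_eq]

theorem act_sub (p q : DiffPoly) (φ : Field dom) : act (p - q) φ = act p φ - act q φ := by
  simp [act_eq]

theorem act_sum {ι : Type*} (t : Finset ι) (p : ι → DiffPoly) (φ : Field dom) :
    act (∑ i ∈ t, p i) φ = ∑ i ∈ t, act (p i) φ := by
  simp [act_eq]

theorem act_field_zero (p : DiffPoly) : act p (0 : Field dom) = 0 := by simp [act_eq]

theorem act_field_add (p : DiffPoly) (φ ψ : Field dom) :
    act p (φ + ψ) = act p φ + act p ψ := by simp [act_eq]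

theorem act_field_smul (p : DiffPoly) (c : ℂ) (φ : Field dom) :
    act p (c • φ) = c • act p φ := by simp [act_eq]

theorem act_field_sum {ι : Type*} (t : Finset ι) (p : DiffPoly) (φ : ι → Field dom) :
    act p (∑ i ∈ t, φ i) = ∑ i ∈ t, act p (φ i) := by
  simp [act_eq]

theorem act_comm (p q : DiffPoly) (φ : Field dom) : act p (act q φ) = act q (act p φ) := by
  rw [← act_mul, mul_comm, act_mul]

theorem commField_apply (R : Module.End ℂ dom) (φ : Field dom) (g : Test) :
    commField R φ g = R * φ g - φ g * R := rfl

theorem anticommField_apply (R : Module.End ℂ dom) (φ : Field dom) (g : Test) :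
    anticommField R φ g = R * φ g + φ g * R := rfl

theorem commField_act (R : Module.End ℂ dom) (p : DiffPoly) (φ : Field dom) :
    commField R (act p φ) = act p (commField R φ) := rfl

theorem commField_add (R : Module.End ℂ dom) (φ ψ : Field dom) :
    commField R (φ + ψ) = commField R φ + commField R ψ := LinearMap.comp_add _ _ _

theorem commField_smul (R : Module.End ℂ dom) (c : ℂ) (φ : Field dom) :
    commField R (c • φ) = c • commField R φ := LinearMap.comp_smul _ _ _

theorem commField_sum {ι : Type*} (t : Finset ι) (R : Module.End ℂ dom) (φ : ι → Field dom) :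
    commField R (∑ i ∈ t, φ i) = ∑ i ∈ t, commField R (φ i) :=
  map_sum (⟨⟨commField R, commField_add R⟩, commField_smul R⟩ : Field dom →ₗ[ℂ] Field dom) φ t

theorem anticommField_smul (R : Module.End ℂ dom) (c : ℂ) (φ : Field dom) :
    anticommField R (c • φ) = c • anticommField R φ := LinearMap.comp_smul _ _ _

/-- The graded Jacobi identity for two odd operators and an even field. -/
theorem anticommField_commField (R S : Module.End ℂ dom) (φ : Field dom) :
    anticommField R (commField S φ) + anticommField S (commField R φ)
      = commField (anticomm R S) φ := by
  ext g : 1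
  simp only [LinearMap.add_apply, anticommField_apply, commField_apply, anticomm]
  simp only [mul_add, mul_sub, add_mul, sub_mul, mul_assoc]
  abel

/-- The graded Jacobi identity for two odd operators and an odd field. -/
theorem commField_anticommField (R S : Module.End ℂ dom) (φ : Field dom) :
    commField R (anticommField S φ) + commField S (anticommField R φ)
      = commField (anticomm R S) φ := by
  ext g : 1
  simp only [LinearMap.add_apply, anticommField_apply, commField_apply, anticomm]
  simp only [mul_add, add_mul, mul_assoc]
  abel

/-! ### Adjoints -/

theorem IsAdjointOn.symm {R S : Module.End ℂ dom} (h : IsAdjointOn R S) : IsAdjointOn S R :=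
  fun χ η => by
    rw [← inner_conj_symm, ← h η χ, inner_conj_symm]

theorem IsAdjointOn.add {R S R' S' : Module.End ℂ dom} (h : IsAdjointOn R S)
    (h' : IsAdjointOn R' S') : IsAdjointOn (R + R') (S + S') := fun χ η => by
  simp [h χ η, h' χ η]

theorem IsAdjointOn.sub {R S R' S' : Module.End ℂ dom} (h : IsAdjointOn R S)
    (h' : IsAdjointOn R' S') : IsAdjointOn (R - R') (S - S') := fun χ η => by
  simp [h χ η, h' χ η]

theorem IsAdjointOn.smul {R S : Module.End ℂ dom} (h : IsAdjointOn R S) (c : ℂ) :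
    IsAdjointOn (c • R) ((starRingEnd ℂ) c • S) := fun χ η => by
  simp [h χ η, mul_comm]

theorem IsAdjointOn.mul {R S R' S' : Module.End ℂ dom} (h : IsAdjointOn R S)
    (h' : IsAdjointOn R' S') : IsAdjointOn (R * R') (S' * S) := fun χ η => by
  rw [Module.End.mul_apply, Module.End.mul_apply, h, h']

/-- The vector Sη - S'η lies in the domain itself, so it can be paired with itself. Relations for
`Qbar` are obtained in this way from those for `Q`. -/
theorem IsAdjointOn.unique {R S S' : Module.End ℂ dom} (h : IsAdjointOn R S)
    (h' : IsAdjointOn R S') : S = S' := by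
  ext η : 1
  rw [← sub_eq_zero, ← Submodule.coe_eq_zero, ← inner_self_eq_zero (𝕜 := ℂ)]
  nth_rw 2 [Submodule.coe_sub]
  rw [inner_sub_right, ← h, ← h', sub_self]

theorem isAdjointField_iff {φ φ' : Field dom} :
    IsAdjointField φ φ' ↔ ∀ g, IsAdjointOn (φ g) (φ' (conjTest g)) := by
  refine ⟨fun h g => h g _ (conjTest_apply g), fun h g k hk => ?_⟩
  rw [show k = conjTest g by ext x; rw [hk, conjTest_apply]]
  exact h g

theorem conjTest_conjTest (g : Test) : conjTest (conjTest g) = g := by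
  ext x; simp [conjTest_apply]

theorem IsAdjointField.symm {φ φ' : Field dom} (h : IsAdjointField φ φ') :
    IsAdjointField φ' φ := by
  rw [isAdjointField_iff] at h ⊢
  intro g
  have := (h (conjTest g)).symm
  rwa [conjTest_conjTest] at this

theorem IsAdjointField.unique {φ φ' φ'' : Field dom} (h : IsAdjointField φ φ')
    (h' : IsAdjointField φ φ'') : φ' = φ'' := by
  ext g : 1
  rw [isAdjointField_iff] at h h'
  rw [← conjTest_conjTest g]
  exact (h (conjTest g)).unique (h' (conjTest g))

theorem isAdjointField_zero : IsAdjointField (0 : Field dom) 0 := fun g k _ χ η => by simp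

theorem IsAdjointField.add {φ φ' ψ ψ' : Field dom} (h : IsAdjointField φ φ')
    (h' : IsAdjointField ψ ψ') : IsAdjointField (φ + ψ) (φ' + ψ') :=
  fun g k hk => (h g k hk).add (h' g k hk)

theorem IsAdjointField.smul {φ φ' : Field dom} (h : IsAdjointField φ φ') (c : ℂ) :
    IsAdjointField (c • φ) ((starRingEnd ℂ) c • φ') :=
  fun g k hk => (h g k hk).smul c

theorem IsAdjointField.sum {ι : Type*} (t : Finset ι) {φ φ' : ι → Field dom}
    (h : ∀ i ∈ t, IsAdjointField (φ i) (φ' i)) :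
    IsAdjointField (∑ i ∈ t, φ i) (∑ i ∈ t, φ' i) := by
  classical
  induction t using Finset.induction_on with
  | empty => exact isAdjointField_zero
  | insert i t hi ih =>
    rw [Finset.sum_insert hi, Finset.sum_insert hi]
    exact (h i (Finset.mem_insert_self i t)).add
      (ih fun k hk => h k (Finset.mem_insert_of_mem hk))

theorem IsAdjointField.act {φ φ' : Field dom} (h : IsAdjointField φ φ') (p : DiffPoly) :
    IsAdjointField (act p φ) (act (conjPoly p) φ') := by
  rw [isAdjointField_iff] at h ⊢
  intro g
  rw [act_apply, act_apply, ← conjTest_testPoly]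
  exact h _

/-- Taking adjoints reverses the commutator; the resulting sign is absorbed by conjugating the
factor i. -/
theorem IsAdjointField.commField {φ φ' : Field dom} (h : IsAdjointField φ φ')
    {R S : Module.End ℂ dom} (hR : IsAdjointOn R S) :
    IsAdjointField (Complex.I • commField R φ) (Complex.I • commField S φ') := by
  intro g k hk
  have := ((hR.mul (h g k hk)).sub ((h g k hk).mul hR)).smul Complex.I
  have e : (Complex.I • SusyQFT.commField S φ') k
      = (starRingEnd ℂ) Complex.I • (φ' k * S - S * φ' k) := by
    refine LinearMap.ext fun χ => ?_
    simp only [LinearMap.smul_apply, commField_apply, LinearMap.sub_apply, Complex.conj_I]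
    module
  rw [e]
  exact this

theorem IsAdjointField.anticommField {φ φ' : Field dom} (h : IsAdjointField φ φ')
    {R S : Module.End ℂ dom} (hR : IsAdjointOn R S) :
    IsAdjointField (anticommField R φ) (anticommField S φ') := by
  intro g k hk
  have := (hR.mul (h g k hk)).add ((h g k hk).mul hR)
  rw [add_comm (φ' k * S)] at this
  exact this

end Fields

end SusyQFT

namespace SusyQFT

/-! ### Covariance of fields -/

section Covariance

variable {H : Type*} [NormedAddCommGroup H] [InnerProductSpace ℂ H]

theorem lorentz_one (x : Spacetime) : lorentz 1 x = x :=
  hermMatrix_injective (by rw [hermMatrix_lorentz]; simp)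

theorem conjTest_translate (a : Spacetime) (g : Test) :
    conjTest (translate a g) = translate a (conjTest g) := by
  ext x; simp [conjTest_apply]

theorem Frame.Ud_apply (F : Frame H) (a : Spacetime) (A : SL(2, ℂ)) (χ : F.dom) :
    ((F.Ud a A χ : F.dom) : H) = F.U a A χ := rfl

theorem Frame.Ud_mul_cancel (F : Frame H) {a : Spacetime} {A : SL(2, ℂ)}
    {R S : Module.End ℂ F.dom} (h : F.Ud a A * R = F.Ud a A * S) : R = S := by
  refine LinearMap.ext fun χ => Subtype.ext ((F.U a A).injective ?_)
  have := congrArg (fun T : Module.End ℂ F.dom => ((T χ : F.dom) : H)) h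
  simpa only [Module.End.mul_apply, Frame.Ud_apply] using this

/-- The infinitesimal form `i [P_μ, φ] = ∂_μ φ` of translation covariance. -/
theorem Frame.commField_generator (F : Frame H) {φ φ' : Field F.dom} (hadj : IsAdjointField φ φ')
    (htemp : ∀ χ : F.dom, Continuous fun g : Test => ((φ' g χ : F.dom) : H))
    (hcov : ∀ a g, φ (translate a g) * F.Ud a 1 = F.Ud a 1 * φ g)
    {μ : Fin 4} {P : Module.End ℂ F.dom}
    (hP : ∀ χ : F.dom, HasDerivAt (fun t : ℝ => F.U (EuclideanSpace.single μ t) 1 (χ : H))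
      (Complex.I • ((P χ : F.dom) : H)) 0) :
    Complex.I • commField P φ = act (MvPolynomial.X μ) φ := by
  rw [isAdjointField_iff] at hadj
  refine LinearMap.ext fun g => LinearMap.ext fun χ => ext_inner_left ℂ fun η => ?_
  have hsingle : EuclideanSpace.single μ (0 : ℝ) = 0 := by ext ν; simp
  -- The matrix element ⟨η, U_t φ(g) χ⟩ = ⟨φ'(τ_t ḡ) η, U_t χ⟩ is differentiated at t = 0 in both
  -- forms. Only the test function and the unitaries are differentiated, so no continuity of the
  -- operator φ(g) is needed.
  have hL := hasDerivAt_translate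
    (F.dom.subtype ∘ₗ LinearMap.applyₗ η ∘ₗ φ') (htemp η) (conjTest g) μ
  have h1 := hL.inner ℂ (hP χ)
  have h2 := (hasDerivAt_const (0 : ℝ) (η : H)).inner ℂ (hP (φ g χ))
  have heq : (fun t : ℝ => ⟪(F.dom.subtype ∘ₗ LinearMap.applyₗ η ∘ₗ φ')
        (translate (EuclideanSpace.single μ t) (conjTest g)),
        F.U (EuclideanSpace.single μ t) 1 (χ : H)⟫_ℂ)
      = fun t : ℝ => ⟪(η : H), F.U (EuclideanSpace.single μ t) 1 ((φ g χ : F.dom) : H)⟫_ℂ := by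
    funext t
    have hc := congrArg (fun T : Module.End ℂ F.dom => ((T χ : F.dom) : H))
      (hcov (EuclideanSpace.single μ t) g)
    simp only [Module.End.mul_apply, Frame.Ud_apply] at hc
    rw [← hc, ← conjTest_translate]
    have := (hadj (translate (EuclideanSpace.single μ t) g)).symm η
      (F.Ud (EuclideanSpace.single μ t) 1 χ)
    exact this
  rw [heq] at h1
  have h3 := h1.unique h2
  have e1 : ⟪((φ' (conjTest g) η : F.dom) : H), Complex.I • ((P χ : F.dom) : H)⟫_ℂ
      = ⟪(η : H), Complex.I • ((φ g (P χ) : F.dom) : H)⟫_ℂ := by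
    rw [inner_smul_right, inner_smul_right, (hadj g).symm η (P χ)]
  have e2 : ⟪((φ' (negPartial μ (conjTest g)) η : F.dom) : H), (χ : H)⟫_ℂ
      = ⟪(η : H), ((φ (negPartial μ g) χ : F.dom) : H)⟫_ℂ := by
    rw [← conjTest_negPartial, (hadj _).symm η χ]
  simp only [LinearMap.comp_apply, LinearMap.applyₗ_apply_apply, Submodule.subtype_apply, hsingle,
    translate_zero, inner_zero_left, add_zero] at h3
  have hU0 : F.U 0 1 (χ : H) = χ := F.U_one _
  rw [hU0, e1, e2] at h3
  rw [act_apply, testPoly_X]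
  change ⟪(η : H), ((Complex.I • (P (φ g χ) - φ g (P χ)) : F.dom) : H)⟫_ℂ
    = ⟪(η : H), ((φ (negPartial μ g) χ : F.dom) : H)⟫_ℂ
  rw [Submodule.coe_smul, Submodule.coe_sub, smul_sub, inner_sub_right, ← h3]
  ring

variable {s f : ℕ} {T : ScalarMajoranaTheory H s f}

theorem commField_P_scalar (S : Supersymmetry T) (μ : Fin 4) (j : Fin s) :
    Complex.I • commField (S.P μ) (T.scalar j) = act (MvPolynomial.X μ) (T.scalar j) :=
  T.commField_generator (T.scalar_hermitian j) (T.scalar_tempered j)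
    (fun a g => T.scalar_covariant a 1 g _ (fun x => by simp [lorentz_one]) j)
    (S.P_generator μ)

theorem commField_P_spinor (S : Supersymmetry T) (μ : Fin 4) (B : Fin f) (c : SpinorIndex) :
    Complex.I • commField (S.P μ) (T.spinor B c) = act (MvPolynomial.X μ) (T.spinor B c) := by
  have hone : spinorRep 1 = 1 := by
    simp only [spinorRep, Matrix.SpecialLinearGroup.coe_one]
    rw [Matrix.map_one _ (map_zero _) (map_one _), Matrix.fromBlocks_one]
  have hcov : ∀ c a g, T.spinor B c (translate a g) * T.Ud a 1
      = T.Ud a 1 * T.spinor B c g := fun c a g => by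
    rw [T.spinor_covariant a 1 g _ (fun x => by simp [lorentz_one]) B c, hone]
    simp [Matrix.one_apply]
  rcases c with a | a
  · exact T.commField_generator (T.spinor_majorana B a) (T.spinor_tempered B _) (hcov _)
      (S.P_generator μ)
  · exact T.commField_generator (T.spinor_majorana B a).symm (T.spinor_tempered B _) (hcov _)
      (S.P_generator μ)

/-- {Q_a, Q̄_b} is 2 σ^μ_{ab} P_μ, and P_μ acts on fields as -i ∂_μ. All statements in which two
supercharges produce a derivative come from here. -/
theorem commField_anticomm (S : Supersymmetry T) {φ : Field T.dom}
    (h : ∀ μ, Complex.I • commField (S.P μ) φ = act (MvPolynomial.X μ) φ) (a b : Fin 2) :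
    commField (anticomm (S.Q a) (S.Qbar b)) φ = (-2 * Complex.I) • act (slash a b) φ := by
  have hP : ∀ μ, commField (S.P μ) φ = (-Complex.I) • act (MvPolynomial.X μ) φ := fun μ => by
    rw [← h, smul_smul]; simp
  have hlin : commField (anticomm (S.Q a) (S.Qbar b)) φ
      = (2 : ℂ) • ∑ μ, pauli μ a b • commField (S.P μ) φ := by
    rw [S.Q_Qbar]
    refine LinearMap.ext fun g => ?_
    simp only [commField_apply, LinearMap.smul_apply, LinearMap.sum_apply, smul_mul_assoc,
      mul_smul_comm, Finset.sum_mul, Finset.mul_sum, smul_sub, Finset.sum_sub_distrib]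
  simp only [hlin, hP, slash, act_sum, act_C_mul, Finset.smul_sum, smul_smul]
  refine Finset.sum_congr rfl fun μ _ => ?_
  congr 1
  ring

theorem commField_anticomm_scalar (S : Supersymmetry T) (a b : Fin 2) (j : Fin s) :
    commField (anticomm (S.Q a) (S.Qbar b)) (T.scalar j)
      = (-2 * Complex.I) • act (slash a b) (T.scalar j) :=
  commField_anticomm S (fun μ => commField_P_scalar S μ j) a b

theorem commField_anticomm_spinor (S : Supersymmetry T) (a b : Fin 2) (B : Fin f)
    (c : SpinorIndex) :
    commField (anticomm (S.Q a) (S.Qbar b)) (T.spinor B c)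
      = (-2 * Complex.I) • act (slash a b) (T.spinor B c) :=
  commField_anticomm S (fun μ => commField_P_spinor S μ B c) a b

/-- Lorentz covariance of the coefficients of `i [Q_a, φ^j]`. -/
theorem lorentz_covariance_field (S : Supersymmetry T) {p : Fin 2 → Fin f → SpinorIndex → DiffPoly}
    {j : Fin s} (hp : ∀ a, Complex.I • commField (S.Q a) (T.scalar j)
      = ∑ B, ∑ c, act (p a B c) (T.spinor B c)) (A : SL(2, ℂ)) (b : Fin 2) :
    ∑ B, ∑ e, act (∑ d, MvPolynomial.C (spinorRep A d e) * lorentzPoly A (p b B d)) (T.spinor B e)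
      = ∑ c, A.1 b c • ∑ B, ∑ e, act (p c B e) (T.spinor B e) := by
  refine LinearMap.ext fun g => T.Ud_mul_cancel (a := 0) (A := A) ?_
  set h := lorentzTest A⁻¹ g with hh
  have hg : lorentzTest A h = g := by
    ext x
    rw [lorentzTest_apply, hh, lorentzTest_apply, lorentz_inv_lorentz]
  set U := T.Ud 0 A with hU
  have hφ : T.scalar j h * U = U * T.scalar j g :=
    T.scalar_covariant 0 A g h (fun x => by rw [← hg, add_zero]; rfl) j
  have hQ : S.Q b * U = U * ∑ c, A.1 b c • S.Q c := S.Q_covariant 0 A b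
  have hψ : ∀ B d, T.spinor B d (testPoly (p b B d) h) * U
      = U * ∑ e, spinorRep A d e • T.spinor B e (testPoly (lorentzPoly A (p b B d)) g) := fun B d =>
    T.spinor_covariant 0 A _ _ (fun x => by
      rw [← hg, ← lorentzTest_testPoly, add_zero]; rfl) B d
  have key : (∑ B, ∑ c, act (p b B c) (T.spinor B c)) h * U
      = U * (∑ c, A.1 b c • ∑ B, ∑ e, act (p c B e) (T.spinor B e)) g := by
    rw [← hp]
    simp only [← hp]
    simp only [LinearMap.smul_apply, LinearMap.sum_apply, commField_apply, smul_mul_assoc]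
    have e1 : S.Q b * T.scalar j h * U = U * ((∑ c, A.1 b c • S.Q c) * T.scalar j g) := by
      rw [mul_assoc, hφ, ← mul_assoc, hQ, mul_assoc]
    have e2 : T.scalar j h * S.Q b * U = U * (T.scalar j g * ∑ c, A.1 b c • S.Q c) := by
      rw [mul_assoc, hQ, ← mul_assoc, hφ, mul_assoc]
    rw [sub_mul, e1, e2, ← mul_sub, ← mul_smul_comm]
    congr 1
    simp only [Finset.sum_mul, Finset.mul_sum, smul_mul_assoc, mul_smul_comm, Finset.smul_sum,
      ← Finset.sum_sub_distrib, smul_sub]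
    refine Finset.sum_congr rfl fun c _ => ?_
    rw [smul_comm, smul_comm Complex.I (A.1 b c) (T.scalar j g * _)]
  rw [← key]
  simp only [LinearMap.sum_apply, Finset.sum_mul, act_apply, hψ, Finset.mul_sum]
  refine Finset.sum_congr rfl fun B _ => ?_
  rw [Finset.sum_comm]
  refine Finset.sum_congr rfl fun e _ => ?_
  rw [← testPolyHom_apply, map_sum, LinearMap.sum_apply, map_sum, Finset.mul_sum]
  refine Finset.sum_congr rfl fun d _ => ?_
  rw [testPolyHom_apply, testPoly_mul, testPoly_C, smul_mul_assoc, one_mul, LinearMap.smul_apply,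
    map_smul]

end Covariance

end SusyQFT

namespace SusyQFT

/-! ### The Dirac system modulo the Klein-Gordon polynomial -/

theorem slash_eq : slash = !![.X 0 + .X 3, .X 1 - .C Complex.I * .X 2;
    .X 1 + .C Complex.I * .X 2, .X 0 - .X 3] := by
  ext1 a b
  fin_cases a <;> fin_cases b <;> simp [slash, Fin.sum_univ_four, pauli] <;> ring

theorem kleinGordon_eq (m : ℝ) : kleinGordon m =
    .X 0 ^ 2 - .X 1 ^ 2 - .X 2 ^ 2 - .X 3 ^ 2 + .C ((m : ℂ) ^ 2) := by
  simp only [kleinGordon, Fin.sum_univ_four, metric]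
  simp
  ring

theorem C_I_mul_C_I : (MvPolynomial.C Complex.I : DiffPoly) * MvPolynomial.C Complex.I = -1 := by
  rw [← map_mul, Complex.I_mul_I, map_neg, map_one]

/-- The Dirac symbol written out. -/
theorem dirac_eq (M : ℝ) : dirac M = Matrix.fromBlocks
    !![-.C (M : ℂ), 0; 0, -.C (M : ℂ)]
    !![.C Complex.I * slash 0 1, -(.C Complex.I * slash 0 0);
       .C Complex.I * slash 1 1, -(.C Complex.I * slash 1 0)]
    !![-(.C Complex.I * slash 1 0), .C Complex.I * slash 0 0;
       -(.C Complex.I * slash 1 1), .C Complex.I * slash 0 1]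
    !![-.C (M : ℂ), 0; 0, -.C (M : ℂ)] := by
  rw [dirac]
  congr 1
  all_goals
    ext1 a b
    fin_cases a <;> fin_cases b <;>
      simp [epsUp, epsLow, Matrix.mul_apply, Fin.sum_univ_two]

/-- The Weyl form of (i∂̸ - M)(i∂̸ + M) = -(∂² + M²). The symbol of opposite mass serves as an
adjugate, reducing questions about the row module to divisibility by one polynomial. -/
theorem dirac_mul_dirac_neg (M : ℝ) :
    dirac M * dirac (-M) = (-kleinGordon M) • (1 : Matrix SpinorIndex SpinorIndex DiffPoly) := by
  have hI := C_I_mul_C_I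
  rw [dirac_eq, dirac_eq, Matrix.fromBlocks_multiply, ← Matrix.fromBlocks_one,
    Matrix.fromBlocks_smul, slash_eq, kleinGordon_eq]
  congr 1
  all_goals
    ext1 a b
    fin_cases a <;> fin_cases b <;>
      simp <;> try ring1
  all_goals
    linear_combination (MvPolynomial.X 0 ^ 2 - MvPolynomial.X 1 ^ 2 - MvPolynomial.X 3 ^ 2 +
      (MvPolynomial.C Complex.I ^ 2 - 1) * MvPolynomial.X 2 ^ 2) * hI

theorem dirac_neg_mul_dirac (M : ℝ) :
    dirac (-M) * dirac M = (-kleinGordon M) • (1 : Matrix SpinorIndex SpinorIndex DiffPoly) := by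
  have h := dirac_mul_dirac_neg (-M)
  rw [neg_neg] at h
  rw [h, kleinGordon, kleinGordon]
  simp

theorem kleinGordon_ne_zero (m : ℝ) : kleinGordon m ≠ 0 := by
  intro h
  have := congrArg (MvPolynomial.eval ![(1 + m : ℂ), 0, 0, 0]) h
  have h2 := congrArg (MvPolynomial.eval ![(2 + m : ℂ), 0, 0, 0]) h
  simp [kleinGordon_eq] at this h2
  have h3 := congrArg Complex.re this
  have h4 := congrArg Complex.re h2
  simp [pow_two] at h3 h4
  nlinarith

/-- Linear relations following from the Dirac equation, in terms of the adjoint symbol. -/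
theorem mem_span_dirac_iff (M : ℝ) (v : SpinorIndex → DiffPoly) :
    v ∈ Submodule.span DiffPoly (Set.range (dirac M)) ↔
      ∀ c, kleinGordon M ∣ (v ᵥ* dirac (-M)) c := by
  constructor
  · intro h c
    obtain ⟨w, rfl⟩ := (Submodule.mem_span_range_iff_exists_fun DiffPoly).mp h
    have : (∑ i, w i • dirac M i) = w ᵥ* dirac M := by
      ext1 k; simp [Matrix.vecMul, dotProduct]
    rw [this, Matrix.vecMul_vecMul, dirac_mul_dirac_neg, Matrix.vecMul_smul, Matrix.vecMul_one]
    exact ⟨-w c, by simp⟩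
  · intro h
    choose w hw using h
    have hv : v = (-w) ᵥ* dirac M := by
      have h1 : v ᵥ* dirac (-M) = kleinGordon M • w := by
        ext1 c; rw [hw]; rfl
      have h2 : kleinGordon M • v = kleinGordon M • ((-w) ᵥ* dirac M) := by
        have := congrArg (fun u => u ᵥ* dirac M) h1
        simp only [Matrix.vecMul_vecMul, dirac_neg_mul_dirac, Matrix.vecMul_smul,
          Matrix.vecMul_one, Matrix.smul_vecMul] at this
        rw [Matrix.neg_vecMul, smul_neg, ← this, neg_smul, neg_neg]
      ext1 c
      exact mul_left_cancel₀ (kleinGordon_ne_zero M) (congrFun h2 c)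
    rw [hv]
    refine (Submodule.mem_span_range_iff_exists_fun DiffPoly).mpr ⟨-w, ?_⟩
    ext1 k; simp [Matrix.vecMul, dotProduct]

/-! ### The mass shell -/

/-- The energy `√(y² + m²)`. -/
def energy (m : ℝ) (y : Fin 3 → ℝ) : ℝ := √(y 0 ^ 2 + y 1 ^ 2 + y 2 ^ 2 + m ^ 2)

/-- The point `∂_μ = i y_μ` with `y_0 = √(y² + m²)`. -/
def massShell (m : ℝ) (y : Fin 3 → ℝ) : Fin 4 → ℂ :=
  Fin.cons (Complex.I * energy m y) fun i => Complex.I * y i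

theorem energy_sq (m : ℝ) (y : Fin 3 → ℝ) :
    energy m y ^ 2 = y 0 ^ 2 + y 1 ^ 2 + y 2 ^ 2 + m ^ 2 :=
  Real.sq_sqrt (by positivity)

/-- If q were nonzero, the root d would have even multiplicity on the left and odd multiplicity on
the right, since d ≠ -d. -/
theorem eq_zero_of_sq_eq_mul_sq {d : ℂ} (hd : d ≠ 0) {p q : Polynomial ℂ}
    (h : p ^ 2 = (Polynomial.X - Polynomial.C d) * (Polynomial.X - Polynomial.C (-d)) * q ^ 2) :
    q = 0 := by
  by_contra hq
  have hq2 : q ^ 2 ≠ 0 := pow_ne_zero 2 hq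
  have hl : (Polynomial.X - Polynomial.C d) * (Polynomial.X - Polynomial.C (-d)) ≠ 0 :=
    mul_ne_zero (Polynomial.X_sub_C_ne_zero _) (Polynomial.X_sub_C_ne_zero _)
  have hp : p ≠ 0 := by
    rintro rfl
    exact mul_ne_zero hl hq2 (by rw [← h]; simp)
  have hsq : ∀ u : Polynomial ℂ, u ≠ 0 →
      (u ^ 2).rootMultiplicity d = 2 * u.rootMultiplicity d := fun u hu => by
    rw [pow_two, Polynomial.rootMultiplicity_mul (mul_ne_zero hu hu)]
    ring
  have hne : d ≠ -d := fun h => hd (by linear_combination h / 2)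
  have h4 := congrArg (Polynomial.rootMultiplicity d) h
  rw [Polynomial.rootMultiplicity_mul (mul_ne_zero hl hq2), Polynomial.rootMultiplicity_mul hl,
    Polynomial.rootMultiplicity_X_sub_C_self, Polynomial.rootMultiplicity_X_sub_C, if_neg hne,
    hsq p hp, hsq q hq] at h4
  omega

/-- `x² + y² + z² - m²` is not the quotient of two squares. -/
theorem eq_zero_of_sq_eq_sumSq_mul_sq {m : ℝ} {p q : MvPolynomial (Fin 3) ℂ}
    (h : p ^ 2 = (.X 0 ^ 2 + .X 1 ^ 2 + .X 2 ^ 2 - .C ((m : ℂ) ^ 2)) * q ^ 2) : q = 0 := by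
  -- On the line with the last two coordinates fixed to a, b, the quadric becomes X² - d² with d² =
  -- m² - a² - b² ≠ 0, a product of two distinct linear factors.
  have hline : ∀ a b : ℂ, a ^ 2 + b ^ 2 - (m : ℂ) ^ 2 ≠ 0 →
      MvPolynomial.aeval ![Polynomial.X, Polynomial.C a, Polynomial.C b] q = 0 := by
    intro a b hc
    set φ : MvPolynomial (Fin 3) ℂ →ₐ[ℂ] Polynomial ℂ :=
      MvPolynomial.aeval ![Polynomial.X, Polynomial.C a, Polynomial.C b] with hφ
    obtain ⟨d, hd⟩ := IsAlgClosed.exists_pow_nat_eq (-(a ^ 2 + b ^ 2 - (m : ℂ) ^ 2)) two_pos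
    have hd0 : d ≠ 0 := by
      rintro rfl
      apply hc
      linear_combination hd
    have h1 := congrArg φ h
    have h2 : φ (.X 0 ^ 2 + .X 1 ^ 2 + .X 2 ^ 2 - .C ((m : ℂ) ^ 2))
        = (Polynomial.X - Polynomial.C d) * (Polynomial.X - Polynomial.C (-d)) := by
      have h3 := congrArg (Polynomial.C : ℂ → Polynomial ℂ) hd
      simp only [map_pow, map_neg, map_sub, map_add] at h3
      simp [hφ]
      linear_combination h3
    rw [map_pow φ p 2, map_mul, h2, map_pow φ q 2] at h1
    exact eq_zero_of_sq_eq_mul_sq hd0 h1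
  -- Real a, b > |m| keep a² + b² - m² away from zero, and there are enough of them to detect a zero
  -- polynomial.
  have hinf : Set.Infinite ((fun r : ℝ => (r : ℂ)) '' Set.Ioi |m|) :=
    (Set.Ioi_infinite _).image Complex.ofReal_injective.injOn
  refine MvPolynomial.funext_set (s := ![Set.univ, (fun r : ℝ => (r : ℂ)) '' Set.Ioi |m|,
    (fun r : ℝ => (r : ℂ)) '' Set.Ioi |m|]) ?_ ?_
  · intro i
    fin_cases i
    · exact Set.infinite_univ
    · exact hinf
    · exact hinf
  · intro x hx
    obtain ⟨a, ha, hxa⟩ := hx 1 trivial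
    obtain ⟨b, hb, hxb⟩ := hx 2 trivial
    have hm := abs_nonneg m
    have h0 := hline (x 1) (x 2) (by
      have ha' : |m| < a := ha
      have hb' : |m| < b := hb
      have hne : a ^ 2 + b ^ 2 - m ^ 2 ≠ 0 := by
        rw [← sq_abs m]
        nlinarith
      rw [← hxa, ← hxb]
      change (a : ℂ) ^ 2 + (b : ℂ) ^ 2 - (m : ℂ) ^ 2 ≠ 0
      exact_mod_cast hne)
    have h1 := congrArg (Polynomial.eval (x 0)) h0
    rw [Polynomial.eval_zero] at h1
    rw [map_zero, ← h1, ← Polynomial.coe_evalRingHom, ← RingHom.coe_coe (MvPolynomial.aeval _),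
      ← RingHom.comp_apply]
    congr 1
    refine MvPolynomial.ringHom_ext ?_ ?_
    · intro r; simp
    · intro i; fin_cases i <;> simp

/-- A differential operator which vanishes on (an open part of) the positive mass shell
is a multiple of the Klein-Gordon operator. -/
theorem kleinGordon_dvd {m : ℝ} {p : DiffPoly}
    (h : ∀ y : Fin 3 → ℝ, 0 < y 2 → MvPolynomial.eval (massShell m y) p = 0) :
    kleinGordon m ∣ p := by
  set e := MvPolynomial.finSuccEquiv ℂ 3 with he
  set c : MvPolynomial (Fin 3) ℂ := .X 0 ^ 2 + .X 1 ^ 2 + .X 2 ^ 2 - .C ((m : ℂ) ^ 2) with hc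
  set k : Polynomial (MvPolynomial (Fin 3) ℂ) := Polynomial.X ^ 2 - Polynomial.C c with hk
  have hek : e (kleinGordon m) = k := by
    rw [kleinGordon_eq]
    have h1 : (1 : Fin 4) = Fin.succ 0 := rfl
    have h2 : (2 : Fin 4) = Fin.succ 1 := rfl
    have h3 : (3 : Fin 4) = Fin.succ 2 := rfl
    rw [h1, h2, h3]
    have hC : ∀ z : ℂ, e (.C z) = Polynomial.C (.C z) := fun z => by
      rw [he, MvPolynomial.finSuccEquiv_apply]; simp
    rw [map_add, hC]
    simp only [map_add, map_sub, map_pow, he, MvPolynomial.finSuccEquiv_X_zero,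
      MvPolynomial.finSuccEquiv_X_succ, hk, hc]
    ring
  have hmon : k.Monic := Polynomial.monic_X_pow_sub_C c two_ne_zero
  have hdeg : k.natDegree = 2 := Polynomial.natDegree_X_pow_sub_C
  -- As a polynomial in ∂_0 the Klein-Gordon symbol is monic of degree two, so the remainder is b
  -- ∂_0 + a. Vanishing on the shell gives a = -iω b, and squaring removes the root: a² = c b²,
  -- because c = -ω² at spatial derivatives i y. Since c is not a quotient of squares, b = 0 and
  -- then a = 0.
  set r := e p %ₘ k with hr
  obtain ⟨b, a, hab⟩ := Polynomial.exists_eq_X_add_C_of_natDegree_le_one (p := r) (by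
    have := Polynomial.natDegree_modByMonic_lt (e p) hmon (by
      intro h1; rw [h1, Polynomial.natDegree_one] at hdeg; omega)
    change (e p %ₘ k).natDegree ≤ 1
    omega)
  have hev : ∀ y : Fin 3 → ℝ, 0 < y 2 →
      MvPolynomial.eval (fun i => Complex.I * (y i : ℂ)) b * (Complex.I * energy m y)
        + MvPolynomial.eval (fun i => Complex.I * (y i : ℂ)) a = 0 := by
    intro y hy
    have h1 := h y hy
    rw [massShell, MvPolynomial.eval_eq_eval_mv_eval', ← he,
      ← Polynomial.modByMonic_add_div (e p) k, ← hr, hab] at h1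
    have hω : ((energy m y : ℝ) : ℂ) ^ 2 = y 0 ^ 2 + y 1 ^ 2 + y 2 ^ 2 + m ^ 2 := by
      exact_mod_cast energy_sq m y
    have hkz : Polynomial.eval (Complex.I * energy m y)
        (Polynomial.map (MvPolynomial.eval fun i => Complex.I * (y i : ℂ)) k) = 0 := by
      simp [hk, hc, mul_pow, hω]
      ring
    rw [Polynomial.map_add, Polynomial.map_mul, Polynomial.eval_add, Polynomial.eval_mul, hkz,
      zero_mul, add_zero] at h1
    simpa using h1
  have hsq : a ^ 2 = c * b ^ 2 := by
    refine MvPolynomial.funext_set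
      (s := fun _ => (fun r : ℝ => Complex.I * (r : ℂ)) '' Set.Ioi 0) (fun _ =>
        (Set.Ioi_infinite _).image (fun x _ y _ h => by simpa using h)) ?_
    intro x hx
    choose y hy hyx using fun i => hx i trivial
    have hxy : x = fun i => Complex.I * (y i : ℂ) := funext fun i => (hyx i).symm
    have h1 := hev y (hy 2)
    have hω : ((energy m y : ℝ) : ℂ) ^ 2 = y 0 ^ 2 + y 1 ^ 2 + y 2 ^ 2 + m ^ 2 := by
      exact_mod_cast energy_sq m y
    rw [← hxy] at h1
    have h2 : MvPolynomial.eval x c = -(y 0 ^ 2 + y 1 ^ 2 + y 2 ^ 2 + m ^ 2 : ℂ) := by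
      simp [hc, hxy, mul_pow]
      ring
    rw [map_mul, map_pow, map_pow, h2, ← hω]
    linear_combination (MvPolynomial.eval x a - MvPolynomial.eval x b * (Complex.I * energy m y)) * h1
      + MvPolynomial.eval x b ^ 2 * (energy m y : ℂ) ^ 2 * Complex.I_sq
  have hb : b = 0 := eq_zero_of_sq_eq_sumSq_mul_sq hsq
  have ha : a = 0 := by
    rw [hb] at hsq
    simpa using hsq
  have hr0 : r = 0 := by rw [hab, ha, hb]; simp
  have hdvd : k ∣ e p := (Polynomial.modByMonic_eq_zero_iff_dvd hmon).mp hr0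
  rw [← hek] at hdvd
  simpa using map_dvd e.symm hdvd

theorem eval_massShell_kleinGordon (m : ℝ) (y : Fin 3 → ℝ) :
    MvPolynomial.eval (massShell m y) (kleinGordon m) = 0 := by
  have hω : ((energy m y : ℝ) : ℂ) ^ 2 = y 0 ^ 2 + y 1 ^ 2 + y 2 ^ 2 + m ^ 2 := by
    exact_mod_cast energy_sq m y
  rw [kleinGordon_eq]
  have h1 : massShell m y 1 = Complex.I * y 0 := rfl
  have h2 : massShell m y 2 = Complex.I * y 1 := rfl
  have h3 : massShell m y 3 = Complex.I * y 2 := rfl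
  have h0 : massShell m y 0 = Complex.I * energy m y := rfl
  simp [h0, h1, h2, h3, mul_pow, hω]
  ring

end SusyQFT

namespace SusyQFT

/-! ### The Dirac symbol at points of complex momentum space -/

/-- The value of `slash` at a point. -/
def slashAt (k : Fin 4 → ℂ) : Matrix (Fin 2) (Fin 2) ℂ := ∑ μ, k μ • pauli μ

theorem slashAt_eq (k : Fin 4 → ℂ) :
    slashAt k = !![k 0 + k 3, k 1 - Complex.I * k 2; k 1 + Complex.I * k 2, k 0 - k 3] := by
  ext a b
  fin_cases a <;> fin_cases b <;> simp [slashAt, Fin.sum_univ_four, pauli] <;> ring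

theorem eval_slash (k : Fin 4 → ℂ) (a b : Fin 2) :
    MvPolynomial.eval k (slash a b) = slashAt k a b := by
  simp [slash, slashAt, Matrix.sum_apply, mul_comm]

theorem slashAt_injective : Function.Injective slashAt := fun k l h => by
  rw [slashAt_eq, slashAt_eq] at h
  have h00 := congrFun (congrFun h 0) 0
  have h01 := congrFun (congrFun h 0) 1
  have h10 := congrFun (congrFun h 1) 0
  have h11 := congrFun (congrFun h 1) 1
  simp at h00 h01 h10 h11
  have hI := Complex.I_mul_I
  ext μ
  fin_cases μ
  · change k 0 = l 0; linear_combination (h00 + h11) / 2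
  · change k 1 = l 1; linear_combination (h01 + h10) / 2
  · change k 2 = l 2
    linear_combination (-Complex.I) * (h10 - h01) / 2 + (k 2 - l 2) * hI
  · change k 3 = l 3; linear_combination (h00 - h11) / 2

/-- The value of the Dirac symbol at a point. -/
def diracAt (M : ℝ) (k : Fin 4 → ℂ) : Matrix SpinorIndex SpinorIndex ℂ :=
  Matrix.fromBlocks (-((M : ℂ) • 1)) (Complex.I • (slashAt k * epsUp))
    (-(Complex.I • ((slashAt k)ᵀ * epsUp))) (-((M : ℂ) • 1))

theorem eval_dirac (M : ℝ) (k : Fin 4 → ℂ) (r c : SpinorIndex) :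
    MvPolynomial.eval k (dirac M r c) = diracAt M k r c := by
  rcases r with a | a <;> rcases c with b | b <;>
    simp [dirac, diracAt, Matrix.mul_apply, eval_slash, Matrix.one_apply, apply_ite]
  all_goals rcases eq_or_ne a b with h | h <;> simp [h]

/-- The point with coordinates `∑_ν (δ(A)⁻¹ e_μ)_ν k_ν`. -/
def lorentzPoint (A : SL(2, ℂ)) (k : Fin 4 → ℂ) : Fin 4 → ℂ :=
  fun μ => ∑ ν, ((lorentz A⁻¹ (EuclideanSpace.single μ 1) ν : ℝ) : ℂ) * k ν

theorem eval_lorentzPoly (A : SL(2, ℂ)) (k : Fin 4 → ℂ) (p : DiffPoly) :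
    MvPolynomial.eval k (lorentzPoly A p) = MvPolynomial.eval (lorentzPoint A k) p := by
  rw [lorentzPoly, ← MvPolynomial.coe_aeval_eq_eval, ← MvPolynomial.coe_aeval_eq_eval]
  change (MvPolynomial.aeval k) (MvPolynomial.aeval _ p) = MvPolynomial.aeval _ p
  rw [← AlgHom.comp_apply, MvPolynomial.comp_aeval]
  congr 2
  funext μ
  simp [lorentzPoint]

/-! ### Lorentz covariance of the Dirac symbol -/

theorem adjugate_pauli (μ : Fin 4) : (pauli μ).adjugate = (metric μ : ℂ) • pauli μ := by
  ext a b
  fin_cases μ <;> fin_cases a <;> fin_cases b <;>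
    simp [pauli, metric, Matrix.adjugate_fin_two]

theorem trace_adjugate_fin_two (B : Matrix (Fin 2) (Fin 2) ℂ) :
    B.adjugate.trace = B.trace := by
  rw [Matrix.adjugate_fin_two, Matrix.trace_fin_two, Matrix.trace_fin_two]
  simp [add_comm]

theorem adjugate_adjugate_fin_two (B : Matrix (Fin 2) (Fin 2) ℂ) :
    B.adjugate.adjugate = B := by
  ext a b
  rw [Matrix.adjugate_fin_two, Matrix.adjugate_fin_two]
  fin_cases a <;> fin_cases b <;> simp

theorem metric_mul_self_complex (μ : Fin 4) : (metric μ : ℂ) * metric μ = 1 := by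
  exact_mod_cast metric_mul_self μ

theorem hermMatrix_single (μ : Fin 4) :
    hermMatrix (EuclideanSpace.single μ 1) = (metric μ : ℂ) • pauli μ := by
  rw [hermMatrix, Finset.sum_eq_single μ]
  · simp
  · intro ν _ hν; simp [hν]
  · simp

/-- `lorentzPoint` uses the transposed matrix of δ(A⁻¹). Taking 2 × 2 adjugates turns A⁻¹ back into
A, multiplies σ^μ by the metric sign and preserves traces, so the transposed inverse acts on σ^μ by
X ↦ A X A*. -/
theorem slashAt_lorentzPoint (A : SL(2, ℂ)) (k : Fin 4 → ℂ) :
    slashAt (lorentzPoint A k) = A.1 * slashAt k * (A.1)ᴴ := by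
  have key : ∀ ν, ∑ μ, ((lorentz A⁻¹ (EuclideanSpace.single μ 1) ν : ℝ) : ℂ) • pauli μ
      = A.1 * pauli ν * (A.1)ᴴ := by
    intro ν
    set D := A.1 * pauli ν * (A.1)ᴴ with hD
    set B := (A⁻¹).1 with hB
    set C := Bᴴ * pauli ν * B with hC
    have hBA : B = A.1.adjugate := Matrix.SpecialLinearGroup.coe_inv A
    have hDC : D = (metric ν : ℂ) • C.adjugate := by
      rw [hC, Matrix.adjugate_mul_distrib, Matrix.adjugate_mul_distrib, adjugate_pauli, hBA,
        ← Matrix.adjugate_conjTranspose, adjugate_adjugate_fin_two]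
      simp only [Matrix.smul_mul, Matrix.mul_smul, smul_smul, metric_mul_self_complex, one_smul,
        hD, Matrix.mul_assoc]
    have hDH : Dᴴ = D := by
      simp [hD, Matrix.conjTranspose_mul, pauli_isHermitian, Matrix.mul_assoc]
    have htr : ∀ μ, (pauli μ * D).trace = (metric ν * metric μ : ℂ) * (pauli μ * C).trace := by
      intro μ
      have hμ : pauli μ = (metric μ : ℂ) • (pauli μ).adjugate := by
        rw [adjugate_pauli, smul_smul, metric_mul_self_complex, one_smul]
      rw [hDC]
      nth_rw 1 [hμ]
      rw [Matrix.smul_mul, Matrix.mul_smul, ← Matrix.adjugate_mul_distrib, Matrix.trace_smul,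
        Matrix.trace_smul, trace_adjugate_fin_two, Matrix.trace_mul_comm, smul_smul, smul_eq_mul]
      ring
    have hcomp : ∀ μ, (lorentz A⁻¹ (EuclideanSpace.single μ 1) ν)
        = (pauli μ * D).trace.re / 2 := by
      intro μ
      rw [htr, ← Complex.ofReal_mul, Complex.re_ofReal_mul]
      have e1 : (pauli ν * (B * hermMatrix (EuclideanSpace.single μ 1) * Bᴴ)).trace
          = (metric μ : ℂ) * (pauli μ * C).trace := by
        rw [hermMatrix_single, Matrix.mul_smul, Matrix.smul_mul, Matrix.mul_smul,
          Matrix.trace_smul, smul_eq_mul]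
        congr 1
        calc (pauli ν * (B * pauli μ * Bᴴ)).trace = ((pauli ν * B) * (pauli μ * Bᴴ)).trace := by
              simp only [Matrix.mul_assoc]
          _ = ((pauli μ * Bᴴ) * (pauli ν * B)).trace := Matrix.trace_mul_comm _ _
          _ = _ := by simp only [hC, Matrix.mul_assoc]
      change metric ν * ((pauli ν * (B * hermMatrix (EuclideanSpace.single μ 1) * Bᴴ)).trace.re / 2)
        = _
      rw [e1, mul_assoc, Complex.re_ofReal_mul]
      ring
    have := hermMatrix_components hDH
    rw [hermMatrix] at this
    rw [← this]
    refine Finset.sum_congr rfl fun μ _ => ?_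
    rw [hcomp]
    change _ = ((metric μ * (metric μ * ((pauli μ * D).trace.re / 2)) : ℝ) : ℂ) • pauli μ
    rw [← mul_assoc (metric μ), metric_mul_self, one_mul]
  simp only [slashAt, lorentzPoint, Finset.sum_smul, mul_comm _ (k _), ← smul_smul]
  rw [Finset.sum_comm]
  simp only [← Finset.smul_sum, key, Finset.mul_sum, Finset.sum_mul, Matrix.mul_smul,
    Matrix.smul_mul]

theorem transpose_mul_epsUp_mul {B : Matrix (Fin 2) (Fin 2) ℂ} (h : B.det = 1) :
    Bᵀ * epsUp * B = epsUp := by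
  rw [Matrix.det_fin_two] at h
  ext a b
  fin_cases a <;> fin_cases b <;>
    simp [epsUp, epsLow, Matrix.mul_apply, Fin.sum_univ_two] 
  · ring
  · linear_combination -h
  · linear_combination h
  · ring

/-- Both A and Ā have determinant one and preserve ε, so the symbol at the transformed point is the
conjugate of the original by the spinor representation. This carries information from one point
along its orbit. -/
theorem spinorRep_mul_diracAt (A : SL(2, ℂ)) (M : ℝ) (k : Fin 4 → ℂ) :
    spinorRep A * diracAt M k = diracAt M (lorentzPoint A k) * spinorRep A := by
  have h1 := transpose_mul_epsUp_mul A.2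
  have h2 : (A.1)ᴴ * epsUp * (A.1).map (starRingEnd ℂ) = epsUp := by
    have : ((A.1).map (starRingEnd ℂ)).det = 1 := by
      rw [← RingHom.mapMatrix_apply, ← RingHom.map_det, A.2, map_one]
    exact transpose_mul_epsUp_mul this
  have h3 : ((A.1)ᴴ)ᵀ = (A.1).map (starRingEnd ℂ) := rfl
  rw [spinorRep, diracAt, diracAt, slashAt_lorentzPoint, Matrix.fromBlocks_multiply,
    Matrix.fromBlocks_multiply]
  congr 1
  · simp
  · rw [Matrix.smul_mul]
    simp only [Matrix.mul_smul, Matrix.zero_mul, Matrix.mul_zero, add_zero, zero_add,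
      Matrix.mul_assoc] at h2 ⊢
    rw [h2]
  · simp only [Matrix.mul_neg, Matrix.neg_mul, Matrix.mul_smul, Matrix.smul_mul, Matrix.zero_mul,
      Matrix.mul_zero, smul_zero, neg_zero, add_zero, zero_add, Matrix.transpose_mul, h3, Matrix.mul_assoc] at h1 ⊢
    rw [h1]
  · simp

/-! ### The reference point -/

/-- The point with `σ(k) = i diag(1, M²)`. -/
def refPoint (M : ℝ) : Fin 4 → ℂ :=
  ![Complex.I * ((1 + M ^ 2) / 2), 0, 0, Complex.I * ((1 - M ^ 2) / 2)]

theorem slashAt_refPoint (M : ℝ) :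
    slashAt (refPoint M) = Complex.I • !![1, 0; 0, (M : ℂ) ^ 2] := by
  rw [slashAt_eq]
  ext a b
  fin_cases a <;> fin_cases b <;> simp [refPoint] <;> ring

theorem eval_refPoint_kleinGordon (M : ℝ) :
    MvPolynomial.eval (refPoint M) (kleinGordon M) = 0 := by
  rw [kleinGordon_eq]
  simp [refPoint, mul_pow]
  ring

/-- Every point of the positive mass shell with `y_0 + y_3 > 0` is the image of the reference point
under a lower triangular matrix. -/
theorem exists_lorentzPoint_eq (M : ℝ) {y : Fin 3 → ℝ} (hy : 0 < y 2) :
    ∃ A : SL(2, ℂ), lorentzPoint A (refPoint M) = massShell M y := by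
  set w := energy M y with hw
  have hw0 : 0 ≤ w := Real.sqrt_nonneg _
  have hsq : w ^ 2 = y 0 ^ 2 + y 1 ^ 2 + y 2 ^ 2 + M ^ 2 := energy_sq M y
  have hpos : 0 < w + y 2 := by linarith
  -- A is a Cholesky factor: A diag(1, M²) A* must equal σ(y). The first column of σ(y) fixes the
  -- first column of A, determinant one fixes the remaining entry as 1/x, and the lower right entry
  -- then agrees by the mass-shell equation. Positivity of w + y₂ is all that is used, so M = 0 is
  -- allowed.
  set x := √(w + y 2) with hx
  have hx2 : x ^ 2 = w + y 2 := Real.sq_sqrt hpos.le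
  have hx0 : x ≠ 0 := (Real.sqrt_pos.mpr hpos).ne'
  have hxc : (x : ℂ) ≠ 0 := by exact_mod_cast hx0
  have hx2c : (x : ℂ) ^ 2 = w + y 2 := by exact_mod_cast hx2
  have hsqc : (w : ℂ) ^ 2 = y 0 ^ 2 + y 1 ^ 2 + y 2 ^ 2 + M ^ 2 := by exact_mod_cast hsq
  have hdet : (!![(x : ℂ), 0; (y 0 + Complex.I * y 1) / x, 1 / x]).det = 1 := by
    rw [Matrix.det_fin_two_of]; field_simp; ring
  let A : SL(2, ℂ) := ⟨!![(x : ℂ), 0; (y 0 + Complex.I * y 1) / x, 1 / x], hdet⟩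
  have hA : A.1 = !![(x : ℂ), 0; (y 0 + Complex.I * y 1) / x, 1 / x] := rfl
  refine ⟨A, slashAt_injective ?_⟩
  · rw [slashAt_lorentzPoint, slashAt_refPoint, slashAt_eq (massShell M y), hA]
    have h0 : massShell M y 0 = Complex.I * w := rfl
    have h1 : massShell M y 1 = Complex.I * y 0 := rfl
    have h2 : massShell M y 2 = Complex.I * y 1 := rfl
    have h3 : massShell M y 3 = Complex.I * y 2 := rfl
    rw [h0, h1, h2, h3]
    ext a b
    fin_cases a <;> fin_cases b <;>
      simp [Matrix.mul_apply, Fin.sum_univ_two, Matrix.conjTranspose_apply]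
    · linear_combination Complex.I * hx2c
    · field_simp
      ring
    · field_simp
    · field_simp
      linear_combination (-(w : ℂ) + y 2) * hx2c - hsqc - (y 1 : ℂ) ^ 2 * Complex.I_sq

end SusyQFT

namespace SusyQFT

/-! ### Covariant spinor expressions -/

theorem eval_vecMul_dirac (M : ℝ) (k : Fin 4 → ℂ) (v : SpinorIndex → DiffPoly) (c : SpinorIndex) :
    MvPolynomial.eval k ((v ᵥ* dirac M) c)
      = ((fun d => MvPolynomial.eval k (v d)) ᵥ* diracAt M k) c := by
  simp [Matrix.vecMul, dotProduct, eval_dirac]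

/-- On the mass shell, a consequence of the Dirac equation is annihilated by the adjoint symbol. -/
theorem vecMul_diracAt_eq_zero {M : ℝ} {k : Fin 4 → ℂ}
    (hk : MvPolynomial.eval k (kleinGordon M) = 0) {v : SpinorIndex → DiffPoly}
    (hv : v ∈ Submodule.span DiffPoly (Set.range (dirac M))) :
    (fun d => MvPolynomial.eval k (v d)) ᵥ* diracAt (-M) k = 0 := by
  ext c
  obtain ⟨w, hw⟩ := (mem_span_dirac_iff M v).mp hv c
  rw [← eval_vecMul_dirac, hw, map_mul, hk, zero_mul, Pi.zero_apply]

theorem diracAt_neg_mul_diracAt {M : ℝ} {k : Fin 4 → ℂ}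
    (hk : MvPolynomial.eval k (kleinGordon M) = 0) : diracAt (-M) k * diracAt M k = 0 := by
  have hmap : ∀ M, diracAt M k = (dirac M).map (MvPolynomial.eval k) := fun M => by
    ext r c; rw [Matrix.map_apply, eval_dirac]
  rw [hmap, hmap, ← Matrix.map_mul, dirac_neg_mul_dirac]
  ext r c
  simp [Matrix.map_apply, hk]

/-- The stabilizer of the reference point forces `E` to be a multiple of the first two rows of
the adjoint Dirac symbol. -/
theorem eq_smul_of_stabilizer {M : ℝ} {E₁ E₂ : Matrix (Fin 2) (Fin 2) ℂ}
    (hE₁ : ∀ A : SL(2, ℂ), lorentzPoint A (refPoint M) = refPoint M → E₁ * A.1 = A.1 * E₁)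
    (hE₂ : ∀ A : SL(2, ℂ), lorentzPoint A (refPoint M) = refPoint M →
      E₂ * (A.1).map (starRingEnd ℂ) = A.1 * E₂)
    (hD : E₁ * (Complex.I • (slashAt (refPoint M) * epsUp)) = (M : ℂ) • E₂) :
    ∃ α : ℂ, E₁ = (α * M) • 1 ∧ E₂ = α • Complex.I • (slashAt (refPoint M) * epsUp) := by
  -- This diagonal element forces E₁ to be diagonal and E₂ to be antidiagonal, since conjugation
  -- swaps its two eigenvalues.
  have hdet₁ : (!![Complex.I, 0; 0, -Complex.I]).det = 1 := by simp [Matrix.det_fin_two_of]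
  let A₁ : SL(2, ℂ) := ⟨!![Complex.I, 0; 0, -Complex.I], hdet₁⟩
  have hA₁ : A₁.1 = !![Complex.I, 0; 0, -Complex.I] := rfl
  -- A second stabilizer element, nondiagonal for every M: a rotation in disguise for M > 0 and a
  -- null rotation for M = 0. The factor r normalizes its determinant. It relates the remaining two
  -- entries of E₁ and those of E₂.
  set r : ℝ := (√(1 + M ^ 2))⁻¹ with hr
  have hr0 : r ≠ 0 := inv_ne_zero (Real.sqrt_pos.mpr (by positivity)).ne'
  have hr2 : r ^ 2 * (1 + M ^ 2) = 1 := by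
    rw [hr, inv_pow, Real.sq_sqrt (by positivity)]
    exact inv_mul_cancel₀ (by positivity)
  have hrc : (r : ℂ) ≠ 0 := by exact_mod_cast hr0
  have hr2c : (r : ℂ) ^ 2 * (1 + (M : ℂ) ^ 2) = 1 := by exact_mod_cast hr2
  have hdet₂ : (!![(r : ℂ), r; -(M : ℂ) ^ 2 * r, r]).det = 1 := by
    rw [Matrix.det_fin_two_of]
    linear_combination hr2c
  let A₂ : SL(2, ℂ) := ⟨!![(r : ℂ), r; -(M : ℂ) ^ 2 * r, r], hdet₂⟩
  have hA₂ : A₂.1 = !![(r : ℂ), r; -(M : ℂ) ^ 2 * r, r] := rfl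
  have hs₁ : lorentzPoint A₁ (refPoint M) = refPoint M := by
    apply slashAt_injective
    rw [slashAt_lorentzPoint, slashAt_refPoint, hA₁]
    ext a b
    fin_cases a <;> fin_cases b <;> simp [Matrix.mul_apply, Fin.sum_univ_two]
    linear_combination (-Complex.I * (M : ℂ) ^ 2) * Complex.I_mul_I
  have hs₂ : lorentzPoint A₂ (refPoint M) = refPoint M := by
    apply slashAt_injective
    rw [slashAt_lorentzPoint, slashAt_refPoint, hA₂]
    ext a b
    fin_cases a <;> fin_cases b <;> simp [Matrix.mul_apply, Fin.sum_univ_two]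
    · linear_combination Complex.I * hr2c
    · ring
    · ring
    · linear_combination Complex.I * (M : ℂ) ^ 2 * hr2c
  have h1 := hE₁ A₁ hs₁
  have h2 := hE₁ A₂ hs₂
  have h3 := hE₂ A₁ hs₁
  have h4 := hE₂ A₂ hs₂
  rw [hA₁] at h1 h3
  rw [hA₂] at h2 h4
  have hI := Complex.I_ne_zero
  have e01 : E₁ 0 1 = 0 := by
    have := congrFun (congrFun h1 0) 1
    simp [Matrix.mul_apply, Fin.sum_univ_two] at this
    have h : (2 * Complex.I) * E₁ 0 1 = 0 := by linear_combination -this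
    simpa using h
  have e10 : E₁ 1 0 = 0 := by
    have := congrFun (congrFun h1 1) 0
    simp [Matrix.mul_apply, Fin.sum_univ_two] at this
    have h : (2 * Complex.I) * E₁ 1 0 = 0 := by linear_combination this
    simpa using h
  have f00 : E₂ 0 0 = 0 := by
    have := congrFun (congrFun h3 0) 0
    simp [Matrix.mul_apply, Fin.sum_univ_two] at this
    have h : (2 * Complex.I) * E₂ 0 0 = 0 := by linear_combination -this
    simpa using h
  have f11 : E₂ 1 1 = 0 := by
    have := congrFun (congrFun h3 1) 1
    simp [Matrix.mul_apply, Fin.sum_univ_two] at this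
    have h : (2 * Complex.I) * E₂ 1 1 = 0 := by linear_combination this
    simpa using h
  have e11 : E₁ 1 1 = E₁ 0 0 := by
    have := congrFun (congrFun h2 0) 1
    simp [Matrix.mul_apply, Fin.sum_univ_two, e01] at this
    apply mul_left_cancel₀ hrc
    linear_combination -this
  have f10 : E₂ 1 0 = -(M : ℂ) ^ 2 * E₂ 0 1 := by
    have := congrFun (congrFun h4 0) 0
    simp [Matrix.mul_apply, Fin.sum_univ_two, f00] at this
    apply mul_left_cancel₀ hrc
    linear_combination -this
  -- The stabilizer alone leaves one constant in E₁ and one in E₂; the Dirac condition `hD` ties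
  -- them together. Taking α from E₂ rather than E₁ avoids dividing by M.
  have e00 : E₁ 0 0 = E₂ 0 1 * M := by
    have := congrFun (congrFun hD 0) 1
    rw [slashAt_refPoint] at this
    simp [Matrix.mul_apply, Fin.sum_univ_two, e01, epsUp, epsLow] at this
    linear_combination this
  refine ⟨E₂ 0 1, ?_, ?_⟩
  · ext a b
    fin_cases a <;> fin_cases b <;> simp [e01, e10, e11, e00]
  · rw [slashAt_refPoint]
    ext a b
    fin_cases a <;> fin_cases b <;>
      simp [f00, f11, f10, epsUp, epsLow]
    linear_combination (-E₂ 0 1 * (M : ℂ) ^ 2) * Complex.I_mul_I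

/-- The inclusion of undotted spinors. -/
def undotted : Matrix (Fin 2) SpinorIndex ℂ := Matrix.fromCols 1 0

theorem undotted_mul_spinorRep (A : SL(2, ℂ)) : undotted * spinorRep A = A.1 * undotted := by
  rw [undotted, spinorRep, Matrix.fromCols_mul_fromBlocks, Matrix.mul_fromCols]
  simp

theorem spinorRep_mul_inv (A : SL(2, ℂ)) : spinorRep A * spinorRep A⁻¹ = 1 := by
  have h : A.1 * (A⁻¹).1 = 1 := congrArg Subtype.val (mul_inv_cancel A)
  rw [spinorRep, spinorRep, Matrix.fromBlocks_multiply, ← Matrix.map_mul, h]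
  simp

theorem undotted_mul_diracAt (M : ℝ) (k : Fin 4 → ℂ) : undotted * diracAt M k
    = Matrix.fromCols (-((M : ℂ) • 1)) (Complex.I • (slashAt k * epsUp)) := by
  rw [undotted, diracAt, Matrix.fromCols_mul_fromBlocks]
  simp

/-- A left-handed spinor built linearly from a Majorana field by differential operators is a
multiple of its left-handed part, up to the Dirac equation. -/
theorem exists_eq_smul_of_covariant {M : ℝ} {p : Fin 2 → SpinorIndex → DiffPoly}
    (hp : ∀ (A : SL(2, ℂ)) b, (fun e => ∑ d, MvPolynomial.C (spinorRep A d e) * lorentzPoly A (p b d)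
      - ∑ c, MvPolynomial.C (A.1 b c) * p c e) ∈ Submodule.span DiffPoly (Set.range (dirac M))) :
    ∃ α : ℂ, ∀ b, p b - Pi.single (Sum.inl b) (MvPolynomial.C α)
      ∈ Submodule.span DiffPoly (Set.range (dirac M)) := by
  -- On the shell, multiplication by the symbol of opposite mass kills everything in the Dirac
  -- module, so E depends only on the class of p and is exactly covariant.
  obtain ⟨E, hE⟩ : ∃ E : (Fin 4 → ℂ) → Matrix (Fin 2) SpinorIndex ℂ, E = fun k =>
    (Matrix.of fun b d => MvPolynomial.eval k (p b d)) * diracAt (-M) k := ⟨_, rfl⟩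
  have hcov : ∀ (A : SL(2, ℂ)), E (lorentzPoint A (refPoint M)) * spinorRep A
      = A.1 * E (refPoint M) := by
    intro A
    rw [hE]
    simp only
    rw [Matrix.mul_assoc, ← spinorRep_mul_diracAt, ← Matrix.mul_assoc, ← Matrix.mul_assoc,
      ← sub_eq_zero, ← Matrix.sub_mul]
    ext b c
    have := congrFun (vecMul_diracAt_eq_zero (eval_refPoint_kleinGordon M) (hp A b)) c
    rw [Matrix.zero_apply]
    rw [Pi.zero_apply] at this
    rw [← this, Matrix.mul_apply, Matrix.vecMul, dotProduct]
    refine Finset.sum_congr rfl fun e _ => ?_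
    congr 1
    simp [Matrix.mul_apply, eval_lorentzPoly, mul_comm]
  have hcols : E (refPoint M) = Matrix.fromCols (E (refPoint M)).toCols₁ (E (refPoint M)).toCols₂ :=
    (Matrix.fromCols_toCols _).symm
  set E₁ := (E (refPoint M)).toCols₁
  set E₂ := (E (refPoint M)).toCols₂
  have hstab : ∀ A : SL(2, ℂ), lorentzPoint A (refPoint M) = refPoint M →
      E₁ * A.1 = A.1 * E₁ ∧ E₂ * (A.1).map (starRingEnd ℂ) = A.1 * E₂ := by
    intro A hA
    have := hcov A
    rw [hA, hcols, spinorRep, Matrix.fromCols_mul_fromBlocks, Matrix.mul_fromCols,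
      Matrix.fromCols_inj.eq_iff] at this
    simpa using this
  -- D(-M) D(M) = 0 on the shell; this supplies the link between the undotted and dotted blocks of
  -- E.
  have hdirac : E (refPoint M) * diracAt M (refPoint M) = 0 := by
    rw [hE]
    simp only
    rw [Matrix.mul_assoc, diracAt_neg_mul_diracAt (eval_refPoint_kleinGordon M), Matrix.mul_zero]
  rw [hcols, diracAt, Matrix.fromCols_mul_fromBlocks] at hdirac
  have hD := congrArg Matrix.toCols₂ hdirac
  rw [Matrix.toCols₂_fromCols] at hD
  obtain ⟨α, h1, h2⟩ := eq_smul_of_stabilizer (fun A hA => (hstab A hA).1)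
    (fun A hA => (hstab A hA).2) (by
      have h0 : E₁ * (Complex.I • (slashAt (refPoint M) * epsUp)) + -((M : ℂ) • E₂) = 0 := by
        have : (0 : Matrix (Fin 2) SpinorIndex ℂ).toCols₂ = 0 := rfl
        rw [this] at hD
        rw [← hD]
        simp
      rwa [← sub_eq_add_neg, sub_eq_zero] at h0)
  have href : E (refPoint M) = α • (undotted * diracAt (-M) (refPoint M)) := by
    rw [hcols, h1, h2, undotted_mul_diracAt]
    ext b c
    rcases c with c | c <;> simp [mul_assoc]
  -- The identity at the reference point is transported along its orbit, which contains every
  -- positive shell point with y₂ > 0, and vanishing there yields divisibility.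
  refine ⟨α, fun b => (mem_span_dirac_iff M _).mpr fun c => kleinGordon_dvd fun y hy => ?_⟩
  obtain ⟨A, hA⟩ := exists_lorentzPoint_eq M hy
  have hshell : E (massShell M y) = α • (undotted * diracAt (-M) (massShell M y)) := by
    have h3 := hcov A
    rw [href, Matrix.mul_smul, ← Matrix.mul_assoc, ← undotted_mul_spinorRep, Matrix.mul_assoc,
      spinorRep_mul_diracAt, hA, ← Matrix.mul_assoc, ← Matrix.smul_mul] at h3
    have h4 := congrArg (· * spinorRep A⁻¹) h3
    simpa only [Matrix.mul_assoc, spinorRep_mul_inv, Matrix.mul_one] using h4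
  have h5 := congrFun (congrFun hshell b) c
  rw [eval_vecMul_dirac]
  have h6 : (fun d => MvPolynomial.eval (massShell M y)
      ((p b - (Pi.single (Sum.inl b) (MvPolynomial.C α) : SpinorIndex → DiffPoly)) d))
      = fun d => MvPolynomial.eval (massShell M y) (p b d) - α * undotted b d := by
    funext d
    rcases d with d | d
    · rcases eq_or_ne d b with h | h
      · subst h; simp [undotted]
      · simp [undotted, h, Ne.symm h]
    · simp [undotted]
  rw [h6]
  simp only [hE, Matrix.mul_apply, Matrix.of_apply, Matrix.smul_apply, smul_eq_mul] at h5
  simp only [Matrix.vecMul, dotProduct, sub_mul, Finset.sum_sub_distrib, h5, Finset.mul_sum,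
    mul_assoc, sub_self]

end SusyQFT

namespace SusyQFT

/-! ### The supercharges on the scalar fields -/

section ScalarReduction

variable {H : Type*} [NormedAddCommGroup H] [InnerProductSpace ℂ H] {s f : ℕ}
  {T : ScalarMajoranaTheory H s f} {m : Fin s → ℝ} {M : Fin f → ℝ}

theorem IsFree.act_scalar_eq_zero (hfree : IsFree T m M) {j : Fin s} {p : DiffPoly}
    (h : kleinGordon (m j) ∣ p) : act p (T.scalar j) = 0 := by
  obtain ⟨q, rfl⟩ := h
  rw [mul_comm, act_mul, hfree.scalar_eq, act_field_zero]

theorem IsFree.sum_act_spinor_eq_zero (hfree : IsFree T m M) {B : Fin f}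
    {v : SpinorIndex → DiffPoly} (h : v ∈ Submodule.span DiffPoly (Set.range (dirac (M B)))) :
    ∑ c, act (v c) (T.spinor B c) = 0 := by
  obtain ⟨w, rfl⟩ := (Submodule.mem_span_range_iff_exists_fun DiffPoly).mp h
  have : ∀ c, act ((∑ i, w i • dirac (M B) i) c) (T.spinor B c)
      = ∑ i, act (w i) (act (dirac (M B) i c) (T.spinor B c)) := fun c => by
    rw [Finset.sum_apply, act_sum]
    exact Finset.sum_congr rfl fun i _ => by rw [Pi.smul_apply, smul_eq_mul, act_mul]
  simp only [this]
  rw [Finset.sum_comm]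
  refine Finset.sum_eq_zero fun i _ => ?_
  rw [← act_field_sum, hfree.spinor_eq, act_field_zero]

theorem IsFree.sum_act_spinor_congr (hfree : IsFree T m M) {B : Fin f}
    {v w : SpinorIndex → DiffPoly}
    (h : v - w ∈ Submodule.span DiffPoly (Set.range (dirac (M B)))) :
    ∑ c, act (v c) (T.spinor B c) = ∑ c, act (w c) (T.spinor B c) := by
  rw [← sub_eq_zero, ← Finset.sum_sub_distrib, ← hfree.sum_act_spinor_eq_zero h]
  simp only [Pi.sub_apply, act_sub]

theorem IsIndependent.spinor_sub_mem (hind : IsIndependent T m M)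
    {p q : Fin f → SpinorIndex → DiffPoly}
    (h : ∑ A, ∑ c, act (p A c) (T.spinor A c) = ∑ A, ∑ c, act (q A c) (T.spinor A c))
    (A : Fin f) : p A - q A ∈ Submodule.span DiffPoly (Set.range (dirac (M A))) := by
  refine hind.spinor (fun A => p A - q A) ?_ A
  simp only [Pi.sub_apply, act_sub, Finset.sum_sub_distrib]
  rw [h, sub_self]

theorem sum_act_single (B : Fin f) (i : SpinorIndex) (p : DiffPoly) :
    ∑ c, act ((Pi.single i p : SpinorIndex → DiffPoly) c) (T.spinor B c)
      = act p (T.spinor B i) := by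
  rw [Finset.sum_eq_single i]
  · rw [Pi.single_eq_same]
  · intro c _ hc
    rw [Pi.single_eq_of_ne hc, act_zero_left]
  · simp

/-- The supercharges map a scalar field to a linear combination, without derivatives, of
spinor fields. -/
theorem exists_commField_Q_scalar (hfree : IsFree T m M) (hind : IsIndependent T m M)
    (S : Supersymmetry T) : ∃ α : Fin s → Fin f → ℂ, ∀ a j,
      Complex.I • commField (S.Q a) (T.scalar j) = ∑ B, α j B • T.spinor B (Sum.inl a) := by
  obtain ⟨p, hp⟩ := S.scalar_tensor
  have key : ∀ j B, ∃ α : ℂ, ∀ b, p b j B - Pi.single (Sum.inl b) (MvPolynomial.C α)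
      ∈ Submodule.span DiffPoly (Set.range (dirac (M B))) := by
    intro j B
    refine exists_eq_smul_of_covariant fun A b => ?_
    have h := lorentz_covariance_field S (p := fun a => p a j) (j := j) (fun a => hp a j) A b
    have h2 : ∑ c, A.1 b c • ∑ B, ∑ e, act (p c j B e) (T.spinor B e)
        = ∑ B, ∑ e, act (∑ c, MvPolynomial.C (A.1 b c) * p c j B e) (T.spinor B e) := by
      simp only [Finset.smul_sum, act_sum, act_C_mul]
      rw [Finset.sum_comm]
      exact Finset.sum_congr rfl fun B _ => Finset.sum_comm
    rw [h2] at h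
    exact hind.spinor_sub_mem h B
  choose α hα using key
  refine ⟨α, fun a j => ?_⟩
  rw [hp]
  refine Finset.sum_congr rfl fun B _ => ?_
  rw [hfree.sum_act_spinor_congr (hα j B a), sum_act_single, act_C]

theorem commField_Qbar_scalar (S : Supersymmetry T) {α : Fin s → Fin f → ℂ}
    (hα : ∀ a j, Complex.I • commField (S.Q a) (T.scalar j)
      = ∑ B, α j B • T.spinor B (Sum.inl a)) (a : Fin 2) (j : Fin s) :
    Complex.I • commField (S.Qbar a) (T.scalar j)
      = ∑ B, (starRingEnd ℂ) (α j B) • T.spinor B (Sum.inr a) := by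
  have h1 := (T.scalar_hermitian j).commField (S.Q_adjoint a)
  rw [hα] at h1
  exact h1.unique (IsAdjointField.sum _ fun B _ => (T.spinor_majorana B a).smul _)

/-- In the column `Sum.inr 1` of the opposite-mass symbol, only the row `Sum.inl 0` survives under
the stated vanishing, and its entry is -i times the (0,0) entry of σ. This reads off the on-shell
coefficient of f_0 from a field relation. -/
theorem eval_eq_zero_of_mem {M : ℝ} {v : SpinorIndex → DiffPoly} {k : Fin 4 → ℂ}
    (hk : MvPolynomial.eval k (kleinGordon M) = 0) (h00 : slashAt k 0 0 ≠ 0)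
    (hv : v ∈ Submodule.span DiffPoly (Set.range (dirac M))) (hr : v (Sum.inr 1) = 0)
    (hl : v (Sum.inl 1) = 0) :
    MvPolynomial.eval k (v (Sum.inl 0)) = 0 := by
  have h := congrFun (vecMul_diracAt_eq_zero hk hv) (Sum.inr 1)
  simp only [Matrix.vecMul, dotProduct, Fintype.sum_sum_type, Fin.sum_univ_two, hr, hl,
    map_zero, zero_mul, add_zero, Pi.zero_apply, diracAt, Matrix.fromBlocks_apply₁₂,
    Matrix.fromBlocks_apply₂₂] at h
  simpa [epsUp, epsLow, Matrix.mul_apply, h00] using h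

/-- Only fields of equal mass are connected by the supercharges. -/
theorem mass_eq_of_ne_zero (hfree : IsFree T m M) (hind : IsIndependent T m M)
    (S : Supersymmetry T) {α : Fin s → Fin f → ℂ}
    (hα : ∀ a j, Complex.I • commField (S.Q a) (T.scalar j)
      = ∑ B, α j B • T.spinor B (Sum.inl a)) {j : Fin s} {B : Fin f} (h : α j B ≠ 0) :
    m j = M B := by
  -- The Klein-Gordon operator of mass m_j annihilates the left side of `hα`, hence also the
  -- combination of spinors. On the shell of mass M_B its symbol is m_j² - M_B².
  have h1 : ∑ B, ∑ c, act ((fun B => (Pi.single (Sum.inl 0)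
      (MvPolynomial.C (α j B) * kleinGordon (m j)) : SpinorIndex → DiffPoly)) B c)
      (T.spinor B c) = 0 := by
    simp only [sum_act_single, act_C_mul]
    have := congrArg (act (kleinGordon (m j))) (hα 0 j)
    rw [act_field_smul, ← commField_act, hfree.scalar_eq, act_field_sum] at this
    simp only [act_field_smul] at this
    rw [← this]
    ext g : 1
    simp [commField_apply]
  have h2 := hind.spinor _ h1 B
  have h3 := eval_eq_zero_of_mem (eval_refPoint_kleinGordon (M B))
    (by rw [slashAt_refPoint]; simp) h2 (by simp) (by simp)
  have h4 : MvPolynomial.eval (refPoint (M B)) (kleinGordon (m j)) = (m j : ℂ) ^ 2 - (M B) ^ 2 := by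
    have := eval_refPoint_kleinGordon (M B)
    rw [kleinGordon_eq] at this ⊢
    simp only [map_add, map_sub, MvPolynomial.eval_C] at this ⊢
    linear_combination this
  rw [Pi.single_eq_same, map_mul, MvPolynomial.eval_C, h4] at h3
  have h5 : m j ^ 2 = M B ^ 2 := by
    have := (mul_eq_zero.mp h3).resolve_left h
    exact_mod_cast sub_eq_zero.mp this
  exact (sq_eq_sq₀ (hfree.scalar_mass_nonneg j) (hfree.spinor_mass_nonneg B)).mp h5

end ScalarReduction

end SusyQFT

namespace SusyQFT

/-! ### The coefficients of the complex scalars -/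

theorem eval_conjPoly (k : Fin 4 → ℂ) (p : DiffPoly) :
    MvPolynomial.eval k (conjPoly p)
      = (starRingEnd ℂ) (MvPolynomial.eval (fun μ => (starRingEnd ℂ) (k μ)) p) := by
  induction p using MvPolynomial.induction_on with
  | C a => simp [conjPoly]
  | add p q hp hq => simp only [map_add, hp, hq]
  | mul_X p i hp => simp only [map_mul, hp]; simp [conjPoly]

/-- The reference point is purely imaginary, so conjugating the coefficients of an operator
exchanges its values at k and -k. For this reason the dual coefficients are read off at `-refPoint`.
-/
theorem conj_refPoint (M : ℝ) (μ : Fin 4) : (starRingEnd ℂ) (refPoint M μ) = (-refPoint M) μ := by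
  fin_cases μ <;> simp [refPoint, map_ofNat (starRingEnd ℂ) 2]

theorem eval_neg_refPoint_kleinGordon (M : ℝ) :
    MvPolynomial.eval (-refPoint M) (kleinGordon M) = 0 := by
  rw [← eval_refPoint_kleinGordon M, kleinGordon_eq]
  simp

theorem slashAt_neg (k : Fin 4 → ℂ) : slashAt (-k) = -slashAt k := by
  simp [slashAt]

/-- `∂_0 + ∂_3` is injective modulo the Klein-Gordon equation. -/
theorem kleinGordon_dvd_of_dvd_slash_mul {m : ℝ} {p : DiffPoly}
    (h : kleinGordon m ∣ slash 0 0 * p) : kleinGordon m ∣ p := by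
  refine kleinGordon_dvd fun y hy => ?_
  obtain ⟨q, hq⟩ := h
  have h1 := congrArg (MvPolynomial.eval (massShell m y)) hq
  rw [map_mul, map_mul, eval_massShell_kleinGordon, zero_mul, eval_slash, slashAt_eq] at h1
  refine (mul_eq_zero.mp h1).resolve_left ?_
  have h2 : massShell m y 0 + massShell m y 3 = Complex.I * ((energy m y + y 2 : ℝ) : ℂ) := by
    push_cast
    rw [mul_add]
    rfl
  have h3 : 0 ≤ energy m y := Real.sqrt_nonneg _
  have h4 : energy m y + y 2 ≠ 0 := by positivity
  simp only [Matrix.of_apply, Matrix.cons_val', Matrix.cons_val_zero, Matrix.cons_val_fin_one]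
  rw [h2]
  exact mul_ne_zero Complex.I_ne_zero (by exact_mod_cast h4)

section Coefficients

variable {H : Type*} [NormedAddCommGroup H] [InnerProductSpace ℂ H] {s f : ℕ}
  {T : ScalarMajoranaTheory H s f} {m : Fin s → ℝ} {M : Fin f → ℝ}

theorem commField_zero_left {dom : Submodule ℂ H} (φ : Field dom) :
    commField (0 : Module.End ℂ dom) φ = 0 := by
  ext g : 1
  simp [commField_apply]

theorem anticommField_zero {dom : Submodule ℂ H} (R : Module.End ℂ dom) :
    anticommField R (0 : Field dom) = 0 := LinearMap.comp_zero _

/-- A combination of derivatives of the scalar fields that commutes with the supercharges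
vanishes. -/
theorem dvd_of_commField_eq_zero (hind : IsIndependent T m M) (S : Supersymmetry T)
    {r : Fin s → DiffPoly} (h : commField (S.Q 0) (∑ j, act (r j) (T.scalar j)) = 0)
    (h' : commField (S.Qbar 0) (∑ j, act (r j) (T.scalar j)) = 0) (j : Fin s) :
    kleinGordon (m j) ∣ r j := by
  refine kleinGordon_dvd_of_dvd_slash_mul ?_
  refine hind.scalar (fun j => slash 0 0 * r j) ?_ j
  -- By the Jacobi identity {Q_0, Q̄_0}, which acts as -2i(∂_0 + ∂_3), annihilates the combination.
  have h1 := anticommField_commField (S.Q 0) (S.Qbar 0) (∑ j, act (r j) (T.scalar j))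
  rw [h, h', anticommField_zero, anticommField_zero, add_zero, commField_sum] at h1
  simp only [commField_act, commField_anticomm_scalar, act_field_smul] at h1
  rw [← Finset.smul_sum] at h1
  have h2 := (smul_eq_zero.mp h1.symm).resolve_left (by simp)
  rw [← h2]
  exact Finset.sum_congr rfl fun j _ => by rw [act_mul, act_comm]

theorem eq_zero_of_commField_eq_zero (hfree : IsFree T m M) (hind : IsIndependent T m M)
    (S : Supersymmetry T) {r : Fin s → DiffPoly}
    (h : commField (S.Q 0) (∑ j, act (r j) (T.scalar j)) = 0)
    (h' : commField (S.Qbar 0) (∑ j, act (r j) (T.scalar j)) = 0) :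
    ∑ j, act (r j) (T.scalar j) = 0 :=
  Finset.sum_eq_zero fun j _ =>
    hfree.act_scalar_eq_zero (dvd_of_commField_eq_zero hind S h h' j)

/-- A constant divisible by the Klein-Gordon polynomial is zero, as evaluation at a shell point
shows. -/
theorem coeff_eq_zero_of_commField_eq_zero (hind : IsIndependent T m M) (S : Supersymmetry T)
    {v : Fin s → ℂ} (h : commField (S.Q 0) (scalarComb T v) = 0)
    (h' : commField (S.Qbar 0) (scalarComb T v) = 0) : v = 0 := by
  funext j
  have e : scalarComb T v = ∑ j, act (MvPolynomial.C (v j)) (T.scalar j) := by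
    simp only [act_C, scalarComb]
  rw [e] at h h'
  obtain ⟨q, hq⟩ := dvd_of_commField_eq_zero hind S h h' j
  have := congrArg (MvPolynomial.eval (refPoint (m j))) hq
  rwa [map_mul, eval_refPoint_kleinGordon, zero_mul, MvPolynomial.eval_C] at this

theorem commField_Q_eq (S : Supersymmetry T) {α : Fin s → Fin f → ℂ}
    (hα : ∀ a j, Complex.I • commField (S.Q a) (T.scalar j)
      = ∑ B, α j B • T.spinor B (Sum.inl a)) (a : Fin 2) (j : Fin s) :
    commField (S.Q a) (T.scalar j) = (-Complex.I) • ∑ B, α j B • T.spinor B (Sum.inl a) := by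
  rw [← hα, smul_smul]; simp

theorem commField_Qbar_eq (S : Supersymmetry T) {α : Fin s → Fin f → ℂ}
    (hα : ∀ a j, Complex.I • commField (S.Q a) (T.scalar j)
      = ∑ B, α j B • T.spinor B (Sum.inl a)) (a : Fin 2) (j : Fin s) :
    commField (S.Qbar a) (T.scalar j)
      = (-Complex.I) • ∑ B, (starRingEnd ℂ) (α j B) • T.spinor B (Sum.inr a) := by
  rw [← commField_Qbar_scalar S hα, smul_smul]; simp

theorem sum_act_smul_spinor (r : Fin s → DiffPoly) (α : Fin s → Fin f → ℂ) (i : SpinorIndex) :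
    ∑ j, act (r j) ((-Complex.I) • ∑ B, α j B • T.spinor B i)
      = (-Complex.I) • ∑ B, ∑ c, act ((Pi.single i (∑ j, MvPolynomial.C (α j B) * r j) :
          SpinorIndex → DiffPoly) c) (T.spinor B c) := by
  simp only [sum_act_single, act_field_smul, act_field_sum, ← Finset.smul_sum, act_sum, act_C_mul]
  rw [Finset.sum_comm]

theorem IsIndependent.spinor_add_sub_mem (hind : IsIndependent T m M)
    {p p' q : Fin f → SpinorIndex → DiffPoly}
    (h : ∑ A, ∑ c, act (p A c) (T.spinor A c) + ∑ A, ∑ c, act (p' A c) (T.spinor A c)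
      = ∑ A, ∑ c, act (q A c) (T.spinor A c)) (A : Fin f) :
    p A + p' A - q A ∈ Submodule.span DiffPoly (Set.range (dirac (M A))) := by
  refine hind.spinor_sub_mem (p := fun A => p A + p' A) ?_ A
  simpa only [Pi.add_apply, act_add, Finset.sum_add_distrib] using h

/-- The coefficients of the fields dual to the Majorana fields. -/
theorem exists_dual_coefficients (hfree : IsFree T m M) (hind : IsIndependent T m M)
    (S : Supersymmetry T) {α : Fin s → Fin f → ℂ}
    (hα : ∀ a j, Complex.I • commField (S.Q a) (T.scalar j)
      = ∑ B, α j B • T.spinor B (Sum.inl a)) :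
    ∃ c : Fin f → Fin s → ℂ, (∀ A j, c A j ≠ 0 → m j = M A) ∧
      (∀ A B, ∑ j, c A j * α j B = 0) ∧
      ∀ A B, ∑ j, (starRingEnd ℂ) (c A j) * α j B = if A = B then 2 else 0 := by
  obtain ⟨q, hq⟩ := S.spinor_tensor
  have hmass : ∀ {j B}, α j B ≠ 0 → m j = M B := mass_eq_of_ne_zero hfree hind S hα
  have hbar : ∀ A, anticommField (S.Qbar 0) (T.spinor A (Sum.inl 0))
      = ∑ j, act (conjPoly (q 0 A (Sum.inr 0) j)) (T.scalar j) := fun A => by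
    have h1 := (T.spinor_majorana A 0).symm.anticommField (S.Q_adjoint 0)
    rw [hq] at h1
    exact h1.unique (IsAdjointField.sum _ fun j _ => (T.scalar_hermitian j).act _)
  -- Q_0² = 0 applied to f̄^A_0, with the coefficient of f^B_0 evaluated on the shell.
  have hzero : ∀ A B, ∑ j, α j B * MvPolynomial.eval (-refPoint (M B)) (q 0 A (Sum.inr 0) j) = 0 := by
    intro A B
    have h1 := commField_anticommField (S.Q 0) (S.Q 0) (T.spinor A (Sum.inr 0))
    rw [S.Q_Q, commField_zero_left, hq, commField_sum] at h1
    simp only [commField_act, commField_Q_eq S hα] at h1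
    rw [sum_act_smul_spinor, ← two_smul ℂ, smul_smul] at h1
    have h2 := hind.spinor _ ((smul_eq_zero.mp h1).resolve_left (by simp)) B
    have h3 := eval_eq_zero_of_mem (eval_neg_refPoint_kleinGordon (M B))
      (by rw [slashAt_neg, slashAt_refPoint]; simp) h2 (by simp) (by simp)
    simpa [map_sum] using h3
  -- The Jacobi identity for (Q_0, Q̄_0) on f^A_0: the coefficient of f^B_0 is 2(∂_0 + ∂_3) if A = B
  -- and zero otherwise. The term from [Q̄_0, ·] contains only f̄_0 and does not contribute.
  have htwo : ∀ A B, ∑ j, α j B *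
      (starRingEnd ℂ) (MvPolynomial.eval (-refPoint (M B)) (q 0 A (Sum.inr 0) j))
        = if A = B then 2 * Complex.I else 0 := by
    intro A B
    have h1 := commField_anticommField (S.Q 0) (S.Qbar 0) (T.spinor A (Sum.inl 0))
    rw [hbar, hq, commField_sum, commField_sum, commField_anticomm_spinor] at h1
    simp only [commField_act, commField_Q_eq S hα, commField_Qbar_eq S hα] at h1
    rw [sum_act_smul_spinor, sum_act_smul_spinor] at h1
    have h2 : (-2 * Complex.I) • act (slash 0 0) (T.spinor A (Sum.inl 0))
        = (-Complex.I) • ∑ B, ∑ c, act ((Pi.single (Sum.inl 0)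
            (if A = B then MvPolynomial.C 2 * slash 0 0 else 0) : SpinorIndex → DiffPoly) c)
              (T.spinor B c) := by
      simp only [sum_act_single]
      rw [Finset.sum_eq_single A]
      · rw [if_pos rfl, act_C_mul, smul_smul]; ring_nf
      · intro B _ hB
        rw [if_neg (Ne.symm hB), act_zero_left]
      · simp
    rw [h2, ← smul_add] at h1
    have h5 := congrArg (fun φ : Field T.dom => Complex.I • φ) h1
    simp only [smul_smul, mul_neg, Complex.I_mul_I, neg_neg, one_smul] at h5
    have h3 := hind.spinor_add_sub_mem h5 B
    have h4 := eval_eq_zero_of_mem (eval_refPoint_kleinGordon (M B))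
      (by rw [slashAt_refPoint]; simp) h3 (by simp) (by simp)
    simp only [Pi.sub_apply, Pi.add_apply, Pi.single_eq_same, map_sub, map_add, map_sum, map_mul,
      MvPolynomial.eval_C, eval_conjPoly, conj_refPoint] at h4
    rw [Pi.single_eq_of_ne (by simp), map_zero, add_zero, sub_eq_zero] at h4
    rw [show (-refPoint (M B)) = fun μ => (-refPoint (M B)) μ from rfl, h4]
    split_ifs
    · rw [map_mul, eval_slash, slashAt_refPoint]; simp
    · simp
  -- The expected relation is q = (∂_0 + ∂_3) c, and ∂_0 + ∂_3 equals -i at `-refPoint`, whence c =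
  -- i q. For m_j ≠ M_A this value has no on-shell meaning, and c is set to zero. The sums with α
  -- are unaffected for M_A = M_B and vanish for M_A ≠ M_B, because α connects equal masses only.
  obtain ⟨c, hc⟩ : ∃ c : Fin f → Fin s → ℂ, ∀ A j, c A j = if m j = M A then
    Complex.I * MvPolynomial.eval (-refPoint (M A)) (q 0 A (Sum.inr 0) j) else 0 :=
      ⟨_, fun _ _ => rfl⟩
  have hc1 : ∀ {A B j}, M A = M B → α j B ≠ 0 →
      c A j = Complex.I * MvPolynomial.eval (-refPoint (M B)) (q 0 A (Sum.inr 0) j) :=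
    fun hAB hj => by rw [hc, if_pos ((hmass hj).trans hAB.symm), hAB]
  have hc2 : ∀ {A B j}, M A ≠ M B → α j B ≠ 0 → c A j = 0 :=
    fun hAB hj => by rw [hc, if_neg fun h => hAB (h.symm.trans (hmass hj))]
  refine ⟨c, fun A j h => by_contra fun h' => h (by rw [hc, if_neg h']), fun A B => ?_,
    fun A B => ?_⟩
  · by_cases hAB : M A = M B
    · trans Complex.I * 0
      · rw [← hzero A B, Finset.mul_sum]
        refine Finset.sum_congr rfl fun j _ => ?_
        by_cases hj : α j B = 0
        · simp [hj]
        · rw [hc1 hAB hj]; ring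
      · rw [mul_zero]
    · refine Finset.sum_eq_zero fun j _ => ?_
      by_cases hj : α j B = 0
      · simp [hj]
      · rw [hc2 hAB hj, zero_mul]
  · by_cases hAB : M A = M B
    · trans (-Complex.I) * (if A = B then 2 * Complex.I else 0)
      · rw [← htwo A B, Finset.mul_sum]
        refine Finset.sum_congr rfl fun j _ => ?_
        by_cases hj : α j B = 0
        · simp [hj]
        · rw [hc1 hAB hj, map_mul, Complex.conj_I]; ring
      · split_ifs
        · linear_combination -2 * Complex.I_mul_I
        · simp
    · rw [if_neg fun h => hAB (congrArg M h)]
      refine Finset.sum_eq_zero fun j _ => ?_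
      by_cases hj : α j B = 0
      · simp [hj]
      · rw [hc2 hAB hj, map_zero, zero_mul]

theorem commField_Q_scalarComb (S : Supersymmetry T) {α : Fin s → Fin f → ℂ}
    (hα : ∀ a j, Complex.I • commField (S.Q a) (T.scalar j)
      = ∑ B, α j B • T.spinor B (Sum.inl a)) (a : Fin 2) (v : Fin s → ℂ) :
    Complex.I • commField (S.Q a) (scalarComb T v)
      = ∑ B, (∑ j, v j * α j B) • T.spinor B (Sum.inl a) := by
  simp only [scalarComb, commField_sum, commField_smul, Finset.smul_sum]
  simp only [smul_comm Complex.I, hα, Finset.smul_sum, smul_smul, Finset.sum_smul]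
  rw [Finset.sum_comm]

theorem commField_Qbar_scalarComb (S : Supersymmetry T) {α : Fin s → Fin f → ℂ}
    (hα : ∀ a j, Complex.I • commField (S.Q a) (T.scalar j)
      = ∑ B, α j B • T.spinor B (Sum.inl a)) (a : Fin 2) (v : Fin s → ℂ) :
    Complex.I • commField (S.Qbar a) (scalarComb T v)
      = ∑ B, (∑ j, v j * (starRingEnd ℂ) (α j B)) • T.spinor B (Sum.inr a) := by
  simp only [scalarComb, commField_sum, commField_smul, Finset.smul_sum]
  simp only [smul_comm Complex.I, commField_Qbar_scalar S hα, Finset.smul_sum, smul_smul,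
    Finset.sum_smul]
  rw [Finset.sum_comm]

/-! ### Counting the scalar fields -/

theorem coeff_eq_zero_of_mul_eq_zero (hind : IsIndependent T m M) (S : Supersymmetry T)
    {α : Fin s → Fin f → ℂ} (hα : ∀ a j, Complex.I • commField (S.Q a) (T.scalar j)
      = ∑ B, α j B • T.spinor B (Sum.inl a)) {v : Fin s → ℂ}
    (h : ∀ B, ∑ j, v j * α j B = 0) (h' : ∀ B, ∑ j, v j * (starRingEnd ℂ) (α j B) = 0) : v = 0 := by
  have h1 := commField_Q_scalarComb S hα 0 v
  have h2 := commField_Qbar_scalarComb S hα 0 v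
  simp only [h, zero_smul, Finset.sum_const_zero] at h1
  simp only [h', zero_smul, Finset.sum_const_zero] at h2
  exact coeff_eq_zero_of_commField_eq_zero hind S
    ((smul_eq_zero.mp h1).resolve_left Complex.I_ne_zero)
    ((smul_eq_zero.mp h2).resolve_left Complex.I_ne_zero)

/-- Duality says that N = (α, ᾱ) has the left inverse L built from c̄/2 and c/2. The rows of NL - 1
are annihilated by N and hence vanish, so N is invertible and therefore square. -/
theorem card_scalar_eq (hind : IsIndependent T m M) (S : Supersymmetry T)
    {α : Fin s → Fin f → ℂ} (hα : ∀ a j, Complex.I • commField (S.Q a) (T.scalar j)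
      = ∑ B, α j B • T.spinor B (Sum.inl a)) {c : Fin f → Fin s → ℂ}
    (h0 : ∀ A B, ∑ j, c A j * α j B = 0)
    (h2 : ∀ A B, ∑ j, (starRingEnd ℂ) (c A j) * α j B = if A = B then 2 else 0) :
    s = 2 * f := by
  set N : Matrix (Fin s) (Fin f ⊕ Fin f) ℂ :=
    Matrix.of fun j => Sum.elim (fun B => α j B) fun B => (starRingEnd ℂ) (α j B) with hN
  set L : Matrix (Fin f ⊕ Fin f) (Fin s) ℂ :=
    Matrix.of fun A j => 2⁻¹ * Sum.elim (fun A => (starRingEnd ℂ) (c A j)) (fun A => c A j) A with hL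
  have h0' : ∀ A B, ∑ j, (starRingEnd ℂ) (c A j) * (starRingEnd ℂ) (α j B) = 0 := fun A B => by
    simpa using congrArg (starRingEnd ℂ) (h0 A B)
  have h2' : ∀ A B, ∑ j, c A j * (starRingEnd ℂ) (α j B) = if A = B then 2 else 0 := fun A B => by
    have h := congrArg (starRingEnd ℂ) (h2 A B)
    rw [map_sum, apply_ite (starRingEnd ℂ), map_ofNat, map_zero] at h
    simpa only [map_mul, Complex.conj_conj] using h
  have hLN : L * N = 1 := by
    ext A B
    rw [Matrix.mul_apply, Matrix.one_apply]
    simp only [hL, hN, Matrix.of_apply, mul_assoc, ← Finset.mul_sum]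
    rcases A with A | A <;> rcases B with B | B <;>
      simp only [Sum.elim_inl, Sum.elim_inr, h0, h2, h0', h2', Sum.inl.injEq, Sum.inr.injEq,
        reduceCtorEq, if_false, mul_zero] <;> split_ifs <;> norm_num
  have hNL : N * L = 1 := by
    have h3 : (N * L - 1) * N = 0 := by
      rw [Matrix.sub_mul, Matrix.mul_assoc, hLN, Matrix.mul_one, Matrix.one_mul, sub_self]
    ext j k
    rw [← sub_eq_zero, ← Matrix.sub_apply]
    refine congrFun (coeff_eq_zero_of_mul_eq_zero hind S hα (v := (N * L - 1 : Matrix (Fin s) (Fin s) ℂ) j)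
      (fun B => ?_) fun B => ?_) k
    · exact congrFun (congrFun h3 j) (Sum.inl B)
    · exact congrFun (congrFun h3 j) (Sum.inr B)
  have := Matrix.square_of_invertible N L hNL hLN
  simp at this
  omega

end Coefficients

end SusyQFT

namespace SusyQFT

/-! ### The Wess-Zumino multiplets -/

theorem conjPoly_slash (a b : Fin 2) : conjPoly (slash a b) = slash b a := by
  simp only [slash, map_sum, map_mul]
  refine Finset.sum_congr rfl fun μ _ => ?_
  have h := congrFun (congrFun (pauli_isHermitian μ) b) a
  rw [Matrix.conjTranspose_apply] at h
  simp only [conjPoly, MvPolynomial.map_C, MvPolynomial.map_X]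
  rw [← h]
  rfl

section WessZumino

variable {H : Type*} [NormedAddCommGroup H] [InnerProductSpace ℂ H] {s f : ℕ}
  {T : ScalarMajoranaTheory H s f} {m : Fin s → ℝ} {M : Fin f → ℝ}

theorem commField_anticomm_scalarComb (S : Supersymmetry T) (a b : Fin 2) (v : Fin s → ℂ) :
    commField (anticomm (S.Q a) (S.Qbar b)) (scalarComb T v)
      = (-2 * Complex.I) • act (slash a b) (scalarComb T v) := by
  simp only [scalarComb, commField_sum, commField_smul, commField_anticomm_scalar, act_field_sum,
    act_field_smul, Finset.smul_sum]
  exact Finset.sum_congr rfl fun j _ => smul_comm _ _ _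

theorem isAdjointField_scalarComb (T : ScalarMajoranaTheory H s f) (v : Fin s → ℂ) :
    IsAdjointField (scalarComb T v) (scalarComb T fun j => (starRingEnd ℂ) (v j)) :=
  IsAdjointField.sum _ fun j _ => (T.scalar_hermitian j).smul _

theorem dirac_row_inr_zero (hfree : IsFree T m M) (A : Fin f) :
    Complex.I • act (slash 0 0) (T.spinor A (Sum.inl 1))
      - Complex.I • act (slash 1 0) (T.spinor A (Sum.inl 0))
      = (M A : ℂ) • T.spinor A (Sum.inr 0) := by
  have h := hfree.spinor_eq A (Sum.inr 0)
  rw [dirac_eq] at h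
  simp only [Fintype.sum_sum_type, Fin.sum_univ_two, Matrix.fromBlocks_apply₂₁,
    Matrix.fromBlocks_apply₂₂, Matrix.of_apply, Matrix.cons_val', Matrix.cons_val_zero,
    Matrix.cons_val_one, Matrix.cons_val_fin_one, act_neg, act_C_mul, act_C, act_zero_left] at h
  rw [← sub_eq_zero, ← h]
  abel

/-- The dual scalars and the Majorana fields form Wess-Zumino multiplets. -/
theorem isWessZumino_of_dual (hfree : IsFree T m M) (hind : IsIndependent T m M)
    (S : Supersymmetry T) {α : Fin s → Fin f → ℂ}
    (hα : ∀ a j, Complex.I • commField (S.Q a) (T.scalar j)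
      = ∑ B, α j B • T.spinor B (Sum.inl a)) {c : Fin f → Fin s → ℂ}
    (hm : ∀ A j, c A j ≠ 0 → m j = M A) (h0 : ∀ A B, ∑ j, c A j * α j B = 0)
    (h2 : ∀ A B, ∑ j, (starRingEnd ℂ) (c A j) * α j B = if A = B then 2 else 0) (A : Fin f) :
    IsWessZumino S (scalarComb T (c A)) (scalarComb T fun j => (starRingEnd ℂ) (c A j))
      (T.spinor A) (M A) := by
  set φ := scalarComb T (c A) with hφ
  set φd := scalarComb T (fun j => (starRingEnd ℂ) (c A j)) with hφd
  have hadj : IsAdjointField φ φd := isAdjointField_scalarComb T (c A)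
  have h0' : ∀ A B, ∑ j, (starRingEnd ℂ) (c A j) * (starRingEnd ℂ) (α j B) = 0 := fun A B => by
    simpa using congrArg (starRingEnd ℂ) (h0 A B)
  have h2' : ∀ A B, ∑ j, c A j * (starRingEnd ℂ) (α j B) = if A = B then 2 else 0 := fun A B => by
    have h := congrArg (starRingEnd ℂ) (h2 A B)
    rw [map_sum, apply_ite (starRingEnd ℂ), map_ofNat, map_zero] at h
    simpa only [map_mul, Complex.conj_conj] using h
  have hI : ∀ {ψ χ : Field T.dom}, Complex.I • ψ = (2 : ℂ) • χ → ψ = (-2 * Complex.I) • χ := by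
    intro ψ χ h
    rw [show (-2 * Complex.I) = -Complex.I * 2 by ring, mul_smul, ← h, smul_smul]
    simp
  have hQφ : ∀ a, commField (S.Q a) φ = 0 := fun a => by
    have h := commField_Q_scalarComb S hα a (c A)
    simp only [h0, zero_smul, Finset.sum_const_zero] at h
    exact (smul_eq_zero.mp h).resolve_left Complex.I_ne_zero
  have hQbarφd : ∀ a, commField (S.Qbar a) φd = 0 := fun a => by
    have h := commField_Qbar_scalarComb S hα a (fun j => (starRingEnd ℂ) (c A j))
    simp only [h0', zero_smul, Finset.sum_const_zero] at h
    exact (smul_eq_zero.mp h).resolve_left Complex.I_ne_zero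
  have hQφd : ∀ a, Complex.I • commField (S.Q a) φd = (2 : ℂ) • T.spinor A (Sum.inl a) := fun a => by
    rw [hφd, commField_Q_scalarComb S hα a]
    simp [h2, ite_smul]
  have hQbarφ : ∀ a, Complex.I • commField (S.Qbar a) φ = (2 : ℂ) • T.spinor A (Sum.inr a) :=
    fun a => by
      rw [hφ, commField_Qbar_scalarComb S hα a]
      simp [h2', ite_smul]
  -- Since [Q, φ] = 0, only one term of the Jacobi identity for (Q_a, Q̄_b) on φ remains.
  have hQfbar : ∀ a b, anticommField (S.Q a) (T.spinor A (Sum.inr b)) = act (slash a b) φ := by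
    intro a b
    have h1 := anticommField_commField (S.Q a) (S.Qbar b) φ
    rw [hQφ, anticommField_zero, add_zero, hI (hQbarφ b), anticommField_smul, hφ,
      commField_anticomm_scalarComb] at h1
    exact (smul_right_inj (by simp : (-2 * Complex.I) ≠ 0)).mp h1
  have hQbarf : ∀ a b, anticommField (S.Qbar a) (T.spinor A (Sum.inl b)) = act (slash b a) φd := by
    intro a b
    have h1 := (T.spinor_majorana A b).symm.anticommField (S.Q_adjoint a)
    rw [hQfbar] at h1
    rw [h1.unique (hadj.act _), conjPoly_slash]
  -- {Q_a, Q_b} = 0 on φ† makes {Q_a, f_b} antisymmetric, leaving {Q_0, f_1} as the only unknown.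
  have hanti : ∀ a b, anticommField (S.Q a) (T.spinor A (Sum.inl b))
      + anticommField (S.Q b) (T.spinor A (Sum.inl a)) = 0 := by
    intro a b
    have h1 := anticommField_commField (S.Q a) (S.Q b) φd
    rw [S.Q_Q, commField_zero_left, hI (hQφd a), hI (hQφd b), anticommField_smul,
      anticommField_smul, ← smul_add] at h1
    exact (smul_eq_zero.mp h1).resolve_left (by simp)
  have hQ01 : anticommField (S.Q 0) (T.spinor A (Sum.inl 1)) = (-Complex.I * M A) • φ := by
    obtain ⟨q, hq⟩ := S.spinor_tensor
    -- {Q_0, f_1} + iMφ is a differential combination of scalars, so it vanishes as soon as it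
    -- commutes with Q_0 and Q̄_0.
    have hX : anticommField (S.Q 0) (T.spinor A (Sum.inl 1)) + (Complex.I * M A) • φ
        = ∑ j, act (q 0 A (Sum.inl 1) j + MvPolynomial.C (Complex.I * M A * c A j))
          (T.scalar j) := by
      rw [hq, hφ, scalarComb, Finset.smul_sum, ← Finset.sum_add_distrib]
      exact Finset.sum_congr rfl fun j _ => by rw [act_add, act_C, smul_smul]
    have hQX : commField (S.Q 0)
        (anticommField (S.Q 0) (T.spinor A (Sum.inl 1)) + (Complex.I * M A) • φ) = 0 := by
      have h1 := commField_anticommField (S.Q 0) (S.Q 0) (T.spinor A (Sum.inl 1))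
      rw [S.Q_Q, commField_zero_left, ← two_smul ℂ] at h1
      rw [commField_add, commField_smul, hQφ, smul_zero, add_zero]
      exact (smul_eq_zero.mp h1).resolve_left (by simp)
    -- The Jacobi identity yields derivatives of f_0 and f_1, and the Dirac equation combines them
    -- into M f̄_0, cancelling the contribution of iMφ.
    have hQbarX : commField (S.Qbar 0)
        (anticommField (S.Q 0) (T.spinor A (Sum.inl 1)) + (Complex.I * M A) • φ) = 0 := by
      have h1 := commField_anticommField (S.Q 0) (S.Qbar 0) (T.spinor A (Sum.inl 1))
      rw [hQbarf, commField_act, hI (hQφd 0), commField_anticomm_spinor, act_field_smul] at h1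
      rw [commField_add, commField_smul, hI (hQbarφ 0), eq_sub_of_add_eq' h1, smul_smul,
        show Complex.I * M A * (-2 * Complex.I) = 2 * (M A : ℂ) by
          linear_combination (-2 * (M A : ℂ)) * Complex.I_mul_I, mul_smul (2 : ℂ),
        ← dirac_row_inr_zero hfree A]
      module
    have h1 : anticommField (S.Q 0) (T.spinor A (Sum.inl 1)) + (Complex.I * M A) • φ = 0 := by
      rw [hX] at hQX hQbarX ⊢
      exact eq_zero_of_commField_eq_zero hfree hind S hQX hQbarX
    rw [eq_neg_of_add_eq_zero_left h1, ← neg_smul, neg_mul]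
  have hQf : ∀ a b, anticommField (S.Q a) (T.spinor A (Sum.inl b))
      = (-Complex.I * M A * epsLow a b) • φ := by
    have hdiag : ∀ a, anticommField (S.Q a) (T.spinor A (Sum.inl a)) = 0 := fun a => by
      have h1 := hanti a a
      rw [← two_smul ℂ] at h1
      exact (smul_eq_zero.mp h1).resolve_left (by simp)
    intro a b
    fin_cases a <;> fin_cases b
    · simp [hdiag, epsLow]
    · simpa [epsLow] using hQ01
    · have h1 := hanti 1 0
      rw [hQ01] at h1
      simpa [epsLow] using eq_neg_of_add_eq_zero_left h1
    · simp [hdiag, epsLow]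
  refine ⟨hadj, T.spinor_majorana A, ?_, hfree.spinor_eq A, hQφ, hQbarφd, hQφd, hQbarφ, hQf,
    fun a b => ?_, hQfbar, hQbarf⟩
  · rw [hφ, scalarComb, act_field_sum]
    refine Finset.sum_eq_zero fun j _ => ?_
    by_cases hj : c A j = 0
    · rw [hj, zero_smul, act_field_zero]
    · rw [act_field_smul, ← hm A j hj, hfree.scalar_eq, smul_zero]
  · have h1 := (T.spinor_majorana A b).anticommField (S.Q_adjoint a)
    rw [hQf] at h1
    rw [h1.unique (hadj.smul _)]
    congr 1
    fin_cases a <;> fin_cases b <;> simp [epsLow]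

end WessZumino

end SusyQFT

namespace SusyQFT

/-! ### Decomposition into irreducible multiplets -/

section Decomposition

variable {H : Type*} [NormedAddCommGroup H] [InnerProductSpace ℂ H] {s f : ℕ}
  {T : ScalarMajoranaTheory H s f} {m : Fin s → ℝ} {M : Fin f → ℝ}

/-! ### Complex coordinates on the space of Hermitian scalars -/

theorem re_mem_realSpan (c : Fin s → ℂ) : (fun j => (c j).re) ∈ realSpan c :=
  Submodule.subset_span (Set.mem_insert _ _)

theorem im_mem_realSpan (c : Fin s → ℂ) : (fun j => (c j).im) ∈ realSpan c :=
  Submodule.subset_span (Set.mem_insert_of_mem _ rfl)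

theorem realSpan_le {c : Fin s → ℂ} {V : Submodule ℝ (Fin s → ℝ)}
    (hr : (fun j => (c j).re) ∈ V) (hi : (fun j => (c j).im) ∈ V) : realSpan c ≤ V := by
  refine Submodule.span_le.mpr ?_
  rintro v (rfl | rfl)
  exacts [hr, hi]

/-- The real linear functional `v ↦ ∑_j v_j α_{jB}`. -/
def pairing (α : Fin s → Fin f → ℂ) (B : Fin f) : (Fin s → ℝ) →ₗ[ℝ] ℂ where
  toFun v := ∑ j, (v j : ℂ) * α j B
  map_add' v w := by simp [add_mul, Finset.sum_add_distrib]
  map_smul' t v := by simp [Finset.mul_sum, mul_assoc]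

theorem pairing_apply (α : Fin s → Fin f → ℂ) (B : Fin f) (v : Fin s → ℝ) :
    pairing α B v = ∑ j, (v j : ℂ) * α j B := rfl

theorem conj_pairing (α : Fin s → Fin f → ℂ) (B : Fin f) (v : Fin s → ℝ) :
    (starRingEnd ℂ) (pairing α B v) = ∑ j, (v j : ℂ) * (starRingEnd ℂ) (α j B) := by
  simp [pairing_apply]

/-- For real v the sums with ᾱ are the conjugates of those with α, so the pairings alone embed ℝ^s
into ℂ^f. -/
theorem eq_zero_of_pairing_eq_zero (hind : IsIndependent T m M) (S : Supersymmetry T)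
    {α : Fin s → Fin f → ℂ} (hα : ∀ a j, Complex.I • commField (S.Q a) (T.scalar j)
      = ∑ B, α j B • T.spinor B (Sum.inl a)) {v : Fin s → ℝ} (h : ∀ B, pairing α B v = 0) :
    v = 0 := by
  have h1 := coeff_eq_zero_of_mul_eq_zero hind S hα (v := fun j => (v j : ℂ)) h fun B => by
    rw [← conj_pairing, h, map_zero]
  funext j
  exact Complex.ofReal_eq_zero.mp (congrFun h1 j)

section Dual

variable {α : Fin s → Fin f → ℂ} {c : Fin f → Fin s → ℂ}
  (h0 : ∀ A B, ∑ j, c A j * α j B = 0)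
  (h2 : ∀ A B, ∑ j, (starRingEnd ℂ) (c A j) * α j B = if A = B then 2 else 0)

include h0 h2

theorem pairing_re (A B : Fin f) :
    pairing α B (fun j => (c A j).re) = if A = B then 1 else 0 := by
  have : pairing α B (fun j => (c A j).re)
      = 2⁻¹ * (∑ j, c A j * α j B + ∑ j, (starRingEnd ℂ) (c A j) * α j B) := by
    rw [pairing_apply, ← Finset.sum_add_distrib, Finset.mul_sum]
    refine Finset.sum_congr rfl fun j _ => ?_
    rw [Complex.re_eq_add_conj]; ring
  rw [this, h0, h2]
  split_ifs <;> norm_num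

theorem pairing_im (A B : Fin f) :
    pairing α B (fun j => (c A j).im) = if A = B then Complex.I else 0 := by
  have : pairing α B (fun j => (c A j).im)
      = (2 * Complex.I)⁻¹ * (∑ j, c A j * α j B - ∑ j, (starRingEnd ℂ) (c A j) * α j B) := by
    rw [pairing_apply, ← Finset.sum_sub_distrib, Finset.mul_sum]
    refine Finset.sum_congr rfl fun j _ => ?_
    rw [Complex.im_eq_sub_conj]; ring
  rw [this, h0, h2]
  split_ifs
  · field_simp
    simp
  · simp

theorem realSpan_le_ker_pairing {A B : Fin f} (hAB : A ≠ B) :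
    realSpan (c A) ≤ LinearMap.ker (pairing α B) :=
  realSpan_le (by rw [LinearMap.mem_ker, pairing_re h0 h2, if_neg hAB])
    (by rw [LinearMap.mem_ker, pairing_im h0 h2, if_neg hAB])

theorem pairing_comb (B : Fin f) (z : Fin f → ℂ) :
    pairing α B (∑ A, ((z A).re • (fun j => (c A j).re) + (z A).im • fun j => (c A j).im))
      = z B := by
  rw [map_sum, Finset.sum_eq_single B]
  · rw [map_add, map_smul, map_smul, pairing_re h0 h2, pairing_im h0 h2, if_pos rfl, if_pos rfl]
    simp
  · intro A _ hA
    rw [map_add, map_smul, map_smul, pairing_re h0 h2, pairing_im h0 h2, if_neg hA, if_neg hA]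
    simp
  · simp

/-- The pairings send Re c_A to e_A and Im c_A to i e_A. The decomposition is that of ℂ^f into its
coordinate lines, pulled back along the embedding. -/
theorem isInternal_realSpan (hind : IsIndependent T m M) (S : Supersymmetry T)
    (hα : ∀ a j, Complex.I • commField (S.Q a) (T.scalar j)
      = ∑ B, α j B • T.spinor B (Sum.inl a)) :
    DirectSum.IsInternal fun A => realSpan (c A) := by
  rw [DirectSum.isInternal_submodule_iff_iSupIndep_and_iSup_eq_top]
  constructor
  · intro A
    rw [Submodule.disjoint_def]
    intro v hv hv'
    refine eq_zero_of_pairing_eq_zero hind S hα fun B => ?_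
    by_cases hAB : A = B
    · subst hAB
      have : ⨆ B, ⨆ (_ : B ≠ A), realSpan (c B) ≤ LinearMap.ker (pairing α A) :=
        iSup₂_le fun B hB => realSpan_le_ker_pairing h0 h2 hB
      exact this hv'
    · exact realSpan_le_ker_pairing h0 h2 hAB hv
  · rw [eq_top_iff]
    intro v _
    have h : v = ∑ A, ((pairing α A v).re • (fun j => (c A j).re)
        + (pairing α A v).im • fun j => (c A j).im) := by
      rw [← sub_eq_zero]
      refine eq_zero_of_pairing_eq_zero hind S hα fun B => ?_
      rw [map_sub, pairing_comb h0 h2 B fun A => pairing α A v, sub_self]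
    rw [h]
    refine Submodule.sum_mem _ fun A _ => Submodule.mem_iSup_of_mem A ?_
    exact add_mem (Submodule.smul_mem _ _ (re_mem_realSpan _))
      (Submodule.smul_mem _ _ (im_mem_realSpan _))

theorem finrank_realSpan (hind : IsIndependent T m M) (S : Supersymmetry T)
    (hα : ∀ a j, Complex.I • commField (S.Q a) (T.scalar j)
      = ∑ B, α j B • T.spinor B (Sum.inl a)) (A : Fin f) :
    Module.finrank ℝ (realSpan (c A)) = 2 := by
  have hbij : Function.Bijective ((pairing α A).domRestrict (realSpan (c A))) := by
    constructor
    · rw [← LinearMap.ker_eq_bot, LinearMap.ker_eq_bot']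
      intro v hv
      refine Subtype.ext (eq_zero_of_pairing_eq_zero hind S hα fun B => ?_)
      by_cases hAB : A = B
      · subst hAB; exact hv
      · exact realSpan_le_ker_pairing h0 h2 hAB v.2
    · intro z
      refine ⟨⟨z.re • (fun j => (c A j).re) + z.im • fun j => (c A j).im,
        add_mem (Submodule.smul_mem _ _ (re_mem_realSpan _))
          (Submodule.smul_mem _ _ (im_mem_realSpan _))⟩, ?_⟩
      rw [LinearMap.domRestrict_apply]
      simp only
      rw [map_add, map_smul, map_smul, pairing_re h0 h2, pairing_im h0 h2, if_pos rfl, if_pos rfl]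
      simp
  rw [(LinearEquiv.ofBijective _ hbij).finrank_eq, Complex.finrank_real_complex]

end Dual

/-! ### Submultiplets and irreducibility -/

theorem act_scalarComb_mem_scalarSpan {V : Submodule ℝ (Fin s → ℝ)} {v : Fin s → ℂ}
    (hr : (fun j => (v j).re) ∈ V) (hi : (fun j => (v j).im) ∈ V) (p : DiffPoly) :
    act p (scalarComb T v) ∈ scalarSpan T V := by
  have h : act p (scalarComb T v) = act p (scalarComb T fun j => ((v j).re : ℂ))
      + Complex.I • act p (scalarComb T fun j => ((v j).im : ℂ)) := by
    rw [← act_field_smul, ← act_field_add]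
    congr 1
    simp only [scalarComb, Finset.smul_sum, smul_smul, ← Finset.sum_add_distrib, ← add_smul]
    refine Finset.sum_congr rfl fun j _ => ?_
    rw [mul_comm, Complex.re_add_im]
  rw [h]
  exact add_mem (Submodule.subset_span ⟨p, _, hr, rfl⟩)
    (Submodule.smul_mem _ _ (Submodule.subset_span ⟨p, _, hi, rfl⟩))

theorem smul_scalarComb_mem_scalarSpan {V : Submodule ℝ (Fin s → ℝ)} {v : Fin s → ℂ}
    (hr : (fun j => (v j).re) ∈ V) (hi : (fun j => (v j).im) ∈ V) (z : ℂ) :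
    z • scalarComb T v ∈ scalarSpan T V := by
  rw [← act_C]
  exact act_scalarComb_mem_scalarSpan hr hi _

theorem spinorComb_single (A : Fin f) (t : ℝ) (i : SpinorIndex) :
    spinorComb T (Pi.single A t) i = (t : ℂ) • T.spinor A i := by
  rw [spinorComb, Finset.sum_eq_single A]
  · rw [Pi.single_eq_same]
  · intro B _ hB
    rw [Pi.single_eq_of_ne hB, Complex.ofReal_zero, zero_smul]
  · simp

theorem smul_spinor_mem_spinorSpan {W : Submodule ℝ (Fin f → ℝ)} {A : Fin f}
    (hA : Pi.single A (1 : ℝ) ∈ W) (z : ℂ) (i : SpinorIndex) :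
    z • T.spinor A i ∈ spinorSpan T W := by
  refine Submodule.smul_mem _ _ (Submodule.subset_span ⟨1, _, hA, i, ?_⟩)
  rw [act_one, spinorComb_single, Complex.ofReal_one, one_smul]

theorem spinorSpan_bot : spinorSpan T (⊥ : Submodule ℝ (Fin f → ℝ)) = ⊥ := by
  rw [spinorSpan, Submodule.span_eq_bot]
  rintro F ⟨p, w, hw, i, rfl⟩
  rw [(Submodule.mem_bot ℝ).mp hw]
  simp [spinorComb, act_field_zero]

/-- A normal form that remembers V: at every point of complex momentum space the coefficient vector
lies in the complexification of V. Membership of a field in `scalarSpan` can thus be turned into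
membership of vectors in V. -/
theorem exists_of_mem_scalarSpan {V : Submodule ℝ (Fin s → ℝ)} {F : Field T.dom}
    (hF : F ∈ scalarSpan T V) : ∃ r : Fin s → DiffPoly, F = ∑ j, act (r j) (T.scalar j) ∧
      ∀ k, (fun j => (MvPolynomial.eval k (r j)).re) ∈ V ∧
        (fun j => (MvPolynomial.eval k (r j)).im) ∈ V := by
  induction hF using Submodule.span_induction with
  | mem F hF =>
    obtain ⟨p, v, hv, rfl⟩ := hF
    refine ⟨fun j => p * MvPolynomial.C (v j : ℂ), ?_, fun k => ⟨?_, ?_⟩⟩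
    · simp only [scalarComb, act_field_sum, act_mul, act_C]
    · convert V.smul_mem (MvPolynomial.eval k p).re hv using 1
      funext j; simp
    · convert V.smul_mem (MvPolynomial.eval k p).im hv using 1
      funext j; simp
  | zero => exact ⟨0, by simp [act_zero_left], fun k => by simp [← Pi.zero_def]⟩
  | add F G _ _ hF hG =>
    obtain ⟨r, rfl, hr⟩ := hF
    obtain ⟨r', rfl, hr'⟩ := hG
    refine ⟨fun j => r j + r' j, by simp only [act_add, Finset.sum_add_distrib],
      fun k => ⟨?_, ?_⟩⟩
    · convert V.add_mem (hr k).1 (hr' k).1 using 1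
      funext j; simp
    · convert V.add_mem (hr k).2 (hr' k).2 using 1
      funext j; simp
  | smul z F _ hF =>
    obtain ⟨r, rfl, hr⟩ := hF
    refine ⟨fun j => z • r j, by simp only [act_smul, Finset.smul_sum], fun k => ⟨?_, ?_⟩⟩
    · convert V.sub_mem (V.smul_mem z.re (hr k).1) (V.smul_mem z.im (hr k).2) using 1
      funext j; simp [MvPolynomial.smul_eval]
    · convert V.add_mem (V.smul_mem z.re (hr k).2) (V.smul_mem z.im (hr k).1) using 1
      funext j; simp [MvPolynomial.smul_eval]

theorem eq_bot_or_single_mem {A : Fin f} {W : Submodule ℝ (Fin f → ℝ)}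
    (hW : W ≤ Submodule.span ℝ {Pi.single A (1 : ℝ)}) : W = ⊥ ∨ Pi.single A (1 : ℝ) ∈ W := by
  rw [or_iff_not_imp_left]
  intro h
  obtain ⟨w, hw, hw0⟩ := Submodule.exists_mem_ne_zero_of_ne_bot h
  obtain ⟨t, rfl⟩ := Submodule.mem_span_singleton.mp (hW hw)
  have ht : t ≠ 0 := fun h => hw0 (by rw [h, zero_smul])
  have := W.smul_mem t⁻¹ hw
  rwa [smul_smul, inv_mul_cancel₀ ht, one_smul] at this

/-- W' lies in a line, so it is zero or contains f^A. In the first case the scalars of V' commute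
with all supercharges and vanish. In the second, {Q_0, f̄_0} = (∂_0 + ∂_3)φ^A is built from V', and
its coefficients i c_{Aj} at the reference point force Re c_A and Im c_A into V'. -/
theorem isIrreducibleMultiplet_of_dual (hind : IsIndependent T m M)
    (S : Supersymmetry T) {α : Fin s → Fin f → ℂ}
    (hα : ∀ a j, Complex.I • commField (S.Q a) (T.scalar j)
      = ∑ B, α j B • T.spinor B (Sum.inl a)) {c : Fin f → Fin s → ℂ}
    (hm : ∀ A j, c A j ≠ 0 → m j = M A) (h0 : ∀ A B, ∑ j, c A j * α j B = 0)
    (h2 : ∀ A B, ∑ j, (starRingEnd ℂ) (c A j) * α j B = if A = B then 2 else 0) {A : Fin f}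
    (hWZ : IsWessZumino S (scalarComb T (c A)) (scalarComb T fun j => (starRingEnd ℂ) (c A j))
      (T.spinor A) (M A)) :
    IsIrreducibleMultiplet S (realSpan (c A)) (Submodule.span ℝ {Pi.single A (1 : ℝ)}) := by
  have hsingle : Pi.single A (1 : ℝ) ∈ Submodule.span ℝ {(Pi.single A (1 : ℝ) : Fin f → ℝ)} :=
    Submodule.mem_span_singleton_self _
  have hI : ∀ {ψ χ : Field T.dom}, Complex.I • ψ = χ → ψ = (-Complex.I) • χ := by
    intro ψ χ h
    rw [← h, smul_smul]
    simp
  have hr := re_mem_realSpan (c A)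
  have hi := im_mem_realSpan (c A)
  have hr' : (fun j => ((starRingEnd ℂ) (c A j)).re) ∈ realSpan (c A) := by simpa using hr
  have hi' : (fun j => ((starRingEnd ℂ) (c A j)).im) ∈ realSpan (c A) := by
    simp only [Complex.conj_im]
    exact neg_mem hi
  refine ⟨⟨fun v hv a => ⟨?_, ?_⟩, fun w hw a i => ?_⟩, fun h => ?_, fun V' hV W' hW hsub => ?_⟩
  · rw [hI (commField_Q_scalarComb S hα a _)]
    refine Submodule.smul_mem _ _ (Submodule.sum_mem _ fun B _ => ?_)
    rw [← pairing_apply]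
    by_cases hAB : A = B
    · subst hAB
      exact smul_spinor_mem_spinorSpan hsingle _ _
    · rw [realSpan_le_ker_pairing h0 h2 hAB hv, zero_smul]
      exact zero_mem _
  · rw [hI (commField_Qbar_scalarComb S hα a _)]
    refine Submodule.smul_mem _ _ (Submodule.sum_mem _ fun B _ => ?_)
    rw [← conj_pairing]
    by_cases hAB : A = B
    · subst hAB
      exact smul_spinor_mem_spinorSpan hsingle _ _
    · rw [realSpan_le_ker_pairing h0 h2 hAB hv, map_zero, zero_smul]
      exact zero_mem _
  · obtain ⟨t, rfl⟩ := Submodule.mem_span_singleton.mp hw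
    rw [← Pi.single_smul, smul_eq_mul, mul_one, spinorComb_single, anticommField_smul,
      anticommField_smul]
    rcases i with b | b
    · rw [hWZ.Q_f, hWZ.Qbar_f]
      exact ⟨Submodule.smul_mem _ _ (smul_scalarComb_mem_scalarSpan hr hi _),
        Submodule.smul_mem _ _ (act_scalarComb_mem_scalarSpan hr' hi' _)⟩
    · rw [hWZ.Q_fbar, hWZ.Qbar_fbar]
      exact ⟨Submodule.smul_mem _ _ (act_scalarComb_mem_scalarSpan hr hi _),
        Submodule.smul_mem _ _ (smul_scalarComb_mem_scalarSpan hr' hi' _)⟩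
  · rw [h.2, Submodule.mem_bot] at hsingle
    simpa using congrFun hsingle A
  · rcases eq_bot_or_single_mem hW with hW' | hW'
    · refine Or.inl ⟨?_, hW'⟩
      rw [Submodule.eq_bot_iff]
      intro v hv
      have h1 := hsub.scalar v hv 0
      rw [hW', spinorSpan_bot, Submodule.mem_bot, Submodule.mem_bot] at h1
      have h3 := coeff_eq_zero_of_commField_eq_zero hind S h1.1 h1.2
      funext j
      exact Complex.ofReal_eq_zero.mp (congrFun h3 j)
    · refine Or.inr ⟨le_antisymm hV ?_, le_antisymm hW ?_⟩
      · have h1 := (hsub.spinor _ hW' 0 (Sum.inr 0)).1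
        rw [spinorComb_single, Complex.ofReal_one, one_smul, hWZ.Q_fbar] at h1
        obtain ⟨r, hr, hrV⟩ := exists_of_mem_scalarSpan h1
        have h3 := hind.scalar (fun j => slash 0 0 * MvPolynomial.C (c A j) - r j) (by
          simp only [act_sub, Finset.sum_sub_distrib]
          rw [← hr, scalarComb]
          simp only [act_field_sum, act_mul, act_C, sub_self])
        have h4 : ∀ j, MvPolynomial.eval (refPoint (M A)) (r j) = Complex.I * c A j := by
          intro j
          by_cases hj : c A j = 0
          -- Here m_j may differ from M_A, so divisibility says nothing at this point. Instead all
          -- vectors of V' ≤ V_A vanish in the coordinate j.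
          · have hV0 : ∀ v ∈ V', v j = 0 := fun v hv => by
              have : realSpan (c A) ≤ LinearMap.ker (LinearMap.proj (R := ℝ) j) :=
                realSpan_le (by simp [hj]) (by simp [hj])
              exact this (hV hv)
            rw [hj, mul_zero]
            exact Complex.ext (hV0 _ (hrV _).1) (hV0 _ (hrV _).2)
          · obtain ⟨q, hq⟩ := h3 j
            have h5 := congrArg (MvPolynomial.eval (refPoint (M A))) hq
            rw [map_mul, hm A j hj, eval_refPoint_kleinGordon, zero_mul, map_sub, map_mul,
              eval_slash, slashAt_refPoint, MvPolynomial.eval_C, sub_eq_zero] at h5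
            rw [← h5]
            simp
        have h5 := hrV (refPoint (M A))
        simp only [h4, Complex.I_mul_re, Complex.I_mul_im] at h5
        refine realSpan_le h5.2 ?_
        convert neg_mem h5.1 using 1
        funext j; simp
      · rwa [Submodule.span_singleton_le_iff_mem]

/-- The coefficients of the complex scalars decompose the multiplet. -/
theorem exists_isWessZuminoDecomposition (hfree : IsFree T m M) (hind : IsIndependent T m M)
    (S : Supersymmetry T) : s = 2 * f ∧ ∃ c : Fin f → Fin s → ℂ,
      IsWessZuminoDecomposition S M c ∧ ∀ A j, c A j ≠ 0 → m j = M A := by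
  obtain ⟨α, hα⟩ := exists_commField_Q_scalar hfree hind S
  obtain ⟨c, hm, h0, h2⟩ := exists_dual_coefficients hfree hind S hα
  have hWZ := isWessZumino_of_dual hfree hind S hα hm h0 h2
  exact ⟨card_scalar_eq hind S hα h0 h2, c, ⟨finrank_realSpan h0 h2 hind S hα,
    isInternal_realSpan h0 h2 hind S hα,
    fun A => isIrreducibleMultiplet_of_dual hind S hα hm h0 h2 (hWZ A), hWZ⟩, hm⟩

end Decomposition

end SusyQFT

namespace SusyQFT

/-! ### The Pauli-Jordan function -/

open MeasureTheory FourierTransform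

/-- The covector `k_μ / 2π` as a point of Euclidean space. -/
def momentum (k : Spacetime) : Spacetime :=
  WithLp.toLp 2 fun μ => (2 * Real.pi)⁻¹ * (metric μ * k μ)

theorem inner_momentum (x k : Spacetime) :
    ⟪x, momentum k⟫_ℝ = (2 * Real.pi)⁻¹ * minkowski k x := by
  simp only [PiLp.inner_apply, momentum, minkowski, Finset.mul_sum]
  refine Finset.sum_congr rfl fun μ _ => ?_
  simp
  ring

theorem minkowskiFourier_eq (g : Test) (k : Spacetime) :
    minkowskiFourier g k = (𝓕 g : Test) (momentum k) := by
  rw [SchwartzMap.fourier_coe, Real.fourier_eq', minkowskiFourier]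
  refine integral_congr_ae (Filter.Eventually.of_forall fun x => ?_)
  simp only
  rw [inner_momentum, smul_eq_mul, mul_comm]
  congr 2
  have : (Real.pi : ℂ) ≠ 0 := by exact_mod_cast Real.pi_ne_zero
  push_cast
  field_simp

theorem minkowskiFourier_translate (a : Spacetime) (g : Test) (k : Spacetime) :
    minkowskiFourier (translate a g) k
      = Complex.exp (-(Complex.I * minkowski k a)) * minkowskiFourier g k := by
  rw [minkowskiFourier, minkowskiFourier, ← integral_const_mul,
    ← integral_add_right_eq_self (μ := volume) _ a]
  refine integral_congr_ae (Filter.Eventually.of_forall fun x => ?_)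
  have h1 : minkowski k (x + a) = minkowski k x + minkowski k a := by
    simp [minkowski, mul_add, Finset.sum_add_distrib]
  simp only [SchwartzMap.compSubConstCLM_apply, add_sub_cancel_right, h1]
  push_cast
  rw [mul_add, neg_add, Complex.exp_add]
  ring

theorem minkowskiFourier_testPoly_X (μ : Fin 4) (g : Test) (k : Spacetime) :
    minkowskiFourier (testPoly (MvPolynomial.X μ) g) k
      = -(Complex.I * (metric μ * k μ)) * minkowskiFourier g k := by
  rw [testPoly_X, negPartial_apply, minkowskiFourier_eq, minkowskiFourier_eq]
  have h : (𝓕 (-(∂_{EuclideanSpace.single μ (1 : ℝ)} g) : Test) : Test)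
      = -(𝓕 (∂_{EuclideanSpace.single μ (1 : ℝ)} g : Test) : Test) :=
    map_neg (FourierTransform.fourierCLM ℂ Test) _
  have ht : (fun x : Spacetime => ⟪x, EuclideanSpace.single μ (1 : ℝ)⟫_ℝ).HasTemperateGrowth := by
    fun_prop
  rw [h, SchwartzMap.fourier_lineDerivOp_eq, neg_apply, smul_apply,
    SchwartzMap.smulLeftCLM_apply_apply ht]
  have h2 : ⟪momentum k, EuclideanSpace.single μ (1 : ℝ)⟫_ℝ
      = (2 * Real.pi)⁻¹ * (metric μ * k μ) := by
    simp [EuclideanSpace.inner_single_right, momentum]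
  rw [h2]
  have : (Real.pi : ℂ) ≠ 0 := by exact_mod_cast Real.pi_ne_zero
  simp only [Complex.real_smul, smul_eq_mul]
  push_cast
  field_simp

theorem minkowskiFourier_add (g h : Test) (k : Spacetime) :
    minkowskiFourier (g + h) k = minkowskiFourier g k + minkowskiFourier h k := by
  simp only [minkowskiFourier_eq]
  have : (𝓕 (g + h) : Test) = 𝓕 g + 𝓕 h := map_add (FourierTransform.fourierCLM ℂ Test) g h
  rw [this, add_apply]

theorem minkowskiFourier_smul (c : ℂ) (g : Test) (k : Spacetime) :
    minkowskiFourier (c • g) k = c * minkowskiFourier g k := by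
  simp only [minkowskiFourier_eq]
  have : (𝓕 (c • g) : Test) = c • 𝓕 g := map_smul (FourierTransform.fourierCLM ℂ Test) c g
  rw [this, smul_apply, smul_eq_mul]

/-! #### Decay on the mass shell -/

theorem continuous_momentum : Continuous momentum := by
  unfold momentum
  fun_prop

theorem continuous_shellPoint (m η : ℝ) : Continuous (shellPoint m η) := by
  refine (PiLp.continuous_toLp 2 _).comp (continuous_pi fun μ => ?_)
  refine Fin.cases ?_ (fun i => ?_) μ
  · simp only [Fin.cons_zero]
    fun_prop
  · simp only [Fin.cons_succ]
    fun_prop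

theorem continuous_minkowskiFourier_shellPoint (m η : ℝ) (g : Test) :
    Continuous fun p => minkowskiFourier g (shellPoint m η p) := by
  simp only [minkowskiFourier_eq]
  exact (𝓕 g : Test).continuous.comp (continuous_momentum.comp (continuous_shellPoint m η))

/-- The spatial momentum is bounded by the full four-momentum, so Schwartz decay of ĝ on ℝ⁴
restricts to decay in p on the shell. -/
theorem norm_le_norm_momentum_shellPoint (m : ℝ) {η : ℝ} (hη : η ^ 2 = 1)
    (p : EuclideanSpace ℝ (Fin 3)) :
    ‖p‖ ≤ 2 * Real.pi * ‖momentum (shellPoint m η p)‖ := by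
  have hpi := Real.pi_pos
  refine le_of_sq_le_sq ?_ (by positivity)
  rw [mul_pow, EuclideanSpace.real_norm_sq_eq, EuclideanSpace.real_norm_sq_eq, Fin.sum_univ_four,
    Fin.sum_univ_three]
  simp only [momentum, metric, shellPoint]
  have e1 : (Fin.cons (η * √(‖p‖ ^ 2 + m ^ 2)) (fun i => η * p i) : Fin 4 → ℝ) 1 = η * p 0 := rfl
  have e2 : (Fin.cons (η * √(‖p‖ ^ 2 + m ^ 2)) (fun i => η * p i) : Fin 4 → ℝ) 2 = η * p 1 := rfl
  have e3 : (Fin.cons (η * √(‖p‖ ^ 2 + m ^ 2)) (fun i => η * p i) : Fin 4 → ℝ) 3 = η * p 2 := rfl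
  simp only [e1, e2, e3, Fin.cons_zero, Matrix.cons_val_zero, Matrix.cons_val_one, Matrix.cons_val,
    mul_pow, hη, inv_pow]
  field_simp
  nlinarith [sq_nonneg √(‖p‖ ^ 2 + m ^ 2)]

theorem exists_norm_minkowskiFourier_le (m : ℝ) {η : ℝ} (hη : η ^ 2 = 1) (g : Test) :
    ∃ C, ∀ p, ‖minkowskiFourier g (shellPoint m η p)‖ ≤ C * (1 + ‖p‖) ^ (-4 : ℝ) := by
  obtain ⟨C, hC⟩ : ∃ C, ∀ x, (1 + ‖x‖) ^ 4 * ‖(𝓕 g : Test) x‖ ≤ C := ⟨_, fun x => by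
    simpa using SchwartzMap.one_add_le_sup_seminorm_apply (𝕜 := ℂ) (m := (4, 0)) (k := 4) (n := 0)
      le_rfl le_rfl (𝓕 g : Test) x⟩
  refine ⟨(2 * Real.pi) ^ 4 * C, fun p => ?_⟩
  have h1 := hC (momentum (shellPoint m η p))
  have h2 := norm_le_norm_momentum_shellPoint m hη p
  have hpi := Real.two_le_pi
  have h3 : 1 + ‖p‖ ≤ 2 * Real.pi * (1 + ‖momentum (shellPoint m η p)‖) := by linarith
  rw [minkowskiFourier_eq, Real.rpow_neg (by positivity), ← div_eq_mul_inv,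
    le_div_iff₀ (by positivity)]
  have h4 : (1 + ‖p‖) ^ (4 : ℝ) = (1 + ‖p‖) ^ 4 := by exact_mod_cast Real.rpow_natCast _ 4
  rw [h4]
  calc _ ≤ ‖(𝓕 g : Test) (momentum (shellPoint m η p))‖
        * (2 * Real.pi * (1 + ‖momentum (shellPoint m η p)‖)) ^ 4 := by gcongr
    _ = (2 * Real.pi) ^ 4 * ((1 + ‖momentum (shellPoint m η p)‖) ^ 4
        * ‖(𝓕 g : Test) (momentum (shellPoint m η p))‖) := by ring
    _ ≤ _ := by gcongr

/-- The product `ĝ(k) ĥ(-k)` on the mass shell. -/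
def shellProduct (m η : ℝ) (g h : Test) (p : EuclideanSpace ℝ (Fin 3)) : ℂ :=
  minkowskiFourier g (shellPoint m η p) * minkowskiFourier h (shellPoint m (-η) p)

theorem continuous_shellProduct (m η : ℝ) (g h : Test) : Continuous (shellProduct m η g h) :=
  (continuous_minkowskiFourier_shellPoint m η g).mul
    (continuous_minkowskiFourier_shellPoint m (-η) h)

theorem exists_norm_shellProduct_le (m : ℝ) {η : ℝ} (hη : η ^ 2 = 1) (g h : Test) :
    ∃ C, ∀ p, ‖shellProduct m η g h p‖ ≤ C * (1 + ‖p‖) ^ (-4 : ℝ) := by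
  obtain ⟨C, hC⟩ := exists_norm_minkowskiFourier_le m hη g
  obtain ⟨C', hC'⟩ := exists_norm_minkowskiFourier_le m (η := -η) (by rwa [neg_sq]) h
  have hC0 : 0 ≤ C := by
    have := (norm_nonneg _).trans (hC 0)
    simpa using this
  have hC'0 : 0 ≤ C' := by
    have := (norm_nonneg _).trans (hC' 0)
    simpa using this
  refine ⟨C * C', fun p => ?_⟩
  rw [shellProduct, norm_mul]
  have h1 : (1 + ‖p‖) ^ (-4 : ℝ) ≤ 1 :=
    Real.rpow_le_one_of_one_le_of_nonpos (by linarith [norm_nonneg p]) (by norm_num)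
  have h0 : 0 ≤ (1 + ‖p‖) ^ (-4 : ℝ) := by positivity
  calc _ ≤ (C * (1 + ‖p‖) ^ (-4 : ℝ)) * (C' * (1 + ‖p‖) ^ (-4 : ℝ)) := by
        gcongr
        exacts [hC p, hC' p]
    _ ≤ (C * (1 + ‖p‖) ^ (-4 : ℝ)) * (C' * 1) := by gcongr
    _ = _ := by ring

theorem integrable_shellProduct (m : ℝ) {η : ℝ} (hη : η ^ 2 = 1) (g h : Test) :
    Integrable (shellProduct m η g h) := by
  obtain ⟨C, hC⟩ := exists_norm_shellProduct_le m hη g h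
  refine ((integrable_one_add_norm (by simp; norm_num)).const_mul C).mono'
    (continuous_shellProduct m η g h).aestronglyMeasurable (Filter.Eventually.of_forall hC)

/-- The singularity 1/‖p‖ of 1/ω at m = 0 is integrable in three dimensions: the radial measure
contributes r², which leaves r (1 + r)⁻⁴ ≤ (1 + r)⁻³. -/
theorem integrable_inv_norm_mul :
    Integrable fun p : EuclideanSpace ℝ (Fin 3) => ‖p‖⁻¹ * (1 + ‖p‖) ^ (-4 : ℝ) := by
  rw [integrable_fun_norm_addHaar volume (f := fun y => y⁻¹ * (1 + y) ^ (-4 : ℝ))]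
  have h1 : Integrable fun y : ℝ => (1 + ‖y‖) ^ (-3 : ℝ) :=
    integrable_one_add_norm (by simp)
  refine h1.integrableOn.mono' ?_ ?_
  · exact Measurable.aestronglyMeasurable (by fun_prop)
  · refine (ae_restrict_mem measurableSet_Ioi).mono fun y (hy : 0 < y) => ?_
    have h2 : (1 + y) ^ (-3 : ℝ) = (1 + y) * (1 + y) ^ (-4 : ℝ) := by
      nth_rw 2 [← Real.rpow_one (1 + y)]
      rw [← Real.rpow_add (by positivity)]
      norm_num
    have h0 : 0 ≤ (1 + y) ^ (-4 : ℝ) := by positivity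
    rw [Real.norm_of_nonneg hy.le, h2, finrank_euclideanSpace_fin, smul_eq_mul,
      Real.norm_of_nonneg (by positivity)]
    calc _ = y * (1 + y) ^ (-4 : ℝ) := by field_simp
      _ ≤ _ := by gcongr; linarith

theorem integrable_inv_energy_mul_shellProduct (m : ℝ) {η : ℝ} (hη : η ^ 2 = 1) (g h : Test) :
    Integrable fun p => ((2 * √(‖p‖ ^ 2 + m ^ 2) : ℝ) : ℂ)⁻¹ * shellProduct m η g h p := by
  obtain ⟨C, hC⟩ := exists_norm_shellProduct_le m hη g h
  refine (integrable_inv_norm_mul.const_mul C).mono' ?_ ?_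
  · refine AEStronglyMeasurable.mul (Measurable.aestronglyMeasurable (by fun_prop))
      (continuous_shellProduct m η g h).aestronglyMeasurable
  · have h0 : ∀ᵐ p : EuclideanSpace ℝ (Fin 3), p ≠ 0 := Measure.ae_ne volume 0
    refine h0.mono fun p hp => ?_
    have hp0 : 0 < ‖p‖ := norm_pos_iff.mpr hp
    have h1 : ‖p‖ ≤ √(‖p‖ ^ 2 + m ^ 2) := Real.le_sqrt_of_sq_le (by nlinarith [sq_nonneg m])
    have h2 : ‖((2 * √(‖p‖ ^ 2 + m ^ 2) : ℝ) : ℂ)⁻¹‖ ≤ ‖p‖⁻¹ := by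
      rw [norm_inv, Complex.norm_real, Real.norm_of_nonneg (by positivity)]
      gcongr
      linarith
    rw [norm_mul]
    calc _ ≤ ‖p‖⁻¹ * (C * (1 + ‖p‖) ^ (-4 : ℝ)) := by
          gcongr
          exact hC p
      _ = _ := by ring

/-! #### Linearity -/

/-- Positive and negative frequencies converge separately, so additivity can be proved for each of
them. -/
theorem pauliJordan_eq (m : ℝ) (g h : Test) : pauliJordan m g h
    = Complex.I * ((2 * Real.pi : ℝ) : ℂ)⁻¹ ^ 3 *
      ((∫ p, ((2 * √(‖p‖ ^ 2 + m ^ 2) : ℝ) : ℂ)⁻¹ * shellProduct m 1 g h p)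
        - ∫ p, ((2 * √(‖p‖ ^ 2 + m ^ 2) : ℝ) : ℂ)⁻¹ * shellProduct m (-1) g h p) := by
  rw [← integral_sub (integrable_inv_energy_mul_shellProduct m (by norm_num) g h)
    (integrable_inv_energy_mul_shellProduct m (by norm_num) g h), pauliJordan]
  simp only [shellProduct, neg_neg, mul_sub]

theorem pauliJordan_add_left (m : ℝ) (g g' h : Test) :
    pauliJordan m (g + g') h = pauliJordan m g h + pauliJordan m g' h := by
  have key : ∀ η : ℝ, η ^ 2 = 1 →
      ∫ p, ((2 * √(‖p‖ ^ 2 + m ^ 2) : ℝ) : ℂ)⁻¹ * shellProduct m η (g + g') h p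
      = (∫ p, ((2 * √(‖p‖ ^ 2 + m ^ 2) : ℝ) : ℂ)⁻¹ * shellProduct m η g h p)
        + ∫ p, ((2 * √(‖p‖ ^ 2 + m ^ 2) : ℝ) : ℂ)⁻¹ * shellProduct m η g' h p := fun η hη => by
    rw [← integral_add (integrable_inv_energy_mul_shellProduct m hη g h)
      (integrable_inv_energy_mul_shellProduct m hη g' h)]
    simp only [shellProduct, minkowskiFourier_add, add_mul, mul_add]
  rw [pauliJordan_eq, pauliJordan_eq, pauliJordan_eq, key 1 (by norm_num), key (-1) (by norm_num)]
  ring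

theorem pauliJordan_smul_left (m : ℝ) (c : ℂ) (g h : Test) :
    pauliJordan m (c • g) h = c * pauliJordan m g h := by
  have key : ∀ η : ℝ,
      ∫ p, ((2 * √(‖p‖ ^ 2 + m ^ 2) : ℝ) : ℂ)⁻¹ * shellProduct m η (c • g) h p
      = c * ∫ p, ((2 * √(‖p‖ ^ 2 + m ^ 2) : ℝ) : ℂ)⁻¹ * shellProduct m η g h p := fun η => by
    rw [← integral_const_mul]
    simp only [shellProduct, minkowskiFourier_smul, mul_assoc, mul_left_comm c]
  rw [pauliJordan_eq, pauliJordan_eq, key, key]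
  ring

/-- The smeared Pauli-Jordan function is linear in the first test function. -/
def pauliJordanLeft (m : ℝ) (h : Test) : Test →ₗ[ℂ] ℂ where
  toFun g := pauliJordan m g h
  map_add' g g' := pauliJordan_add_left m g g' h
  map_smul' c g := pauliJordan_smul_left m c g h

theorem pauliJordanLeft_apply (m : ℝ) (g h : Test) :
    pauliJordanLeft m h g = pauliJordan m g h := rfl

theorem pauliJordan_antisymm (m : ℝ) (g h : Test) : pauliJordan m g h = -pauliJordan m h g := by
  rw [pauliJordan, pauliJordan, ← mul_neg, ← integral_neg]
  congr 2
  funext p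
  ring

/-! #### Removing a derivative -/

/-- The point with time coordinate zero and the given spatial coordinates. -/
def spatial (a : EuclideanSpace ℝ (Fin 3)) : Spacetime := WithLp.toLp 2 (Fin.cons 0 a)

theorem minkowski_shellPoint_spatial (m η : ℝ) (p a : EuclideanSpace ℝ (Fin 3)) :
    minkowski (shellPoint m η p) (spatial a) = -(η * ⟪p, a⟫_ℝ) := by
  rw [minkowski, Fin.sum_univ_succ, PiLp.inner_apply, Finset.mul_sum, ← Finset.sum_neg_distrib]
  simp only [shellPoint, spatial, Fin.cons_zero, Fin.cons_succ, mul_zero, zero_add]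
  refine Finset.sum_congr rfl fun i _ => ?_
  have h : metric i.succ = -1 := by fin_cases i <;> rfl
  rw [h]
  simp
  ring

theorem minkowskiFourier_translate_testPoly (m η : ℝ) (h : Test) (p a : EuclideanSpace ℝ (Fin 3)) :
    minkowskiFourier (testPoly (MvPolynomial.X 0) (translate (spatial a) h)) (shellPoint m η p)
      = -(Complex.I * (η * √(‖p‖ ^ 2 + m ^ 2))) * (Complex.exp (Complex.I * (η * ⟪p, a⟫_ℝ))
        * minkowskiFourier h (shellPoint m η p)) := by
  rw [minkowskiFourier_testPoly_X, minkowskiFourier_translate, minkowski_shellPoint_spatial]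
  have h1 : shellPoint m η p 0 = η * √(‖p‖ ^ 2 + m ^ 2) := rfl
  have h2 : metric 0 = 1 := rfl
  rw [h1, h2]
  push_cast
  simp

/-- The time derivative contributes iω and -iω to the two frequency parts. This cancels the weight
1/2ω and turns the difference into a sum. Replacing h by its spatial translates gives the Fourier
transform of this sum, which vanishes, so the sum is zero by inversion. -/
theorem shellProduct_add_neg_eq_zero {m : ℝ} {G : Test}
    (hG : ∀ h, pauliJordan m G (testPoly (MvPolynomial.X 0) h) = 0) (h : Test)
    (p : EuclideanSpace ℝ (Fin 3)) :
    shellProduct m 1 G h p + shellProduct m (-1) G h (-p) = 0 := by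
  have hc1 := continuous_shellProduct m 1 G h
  have hc2 := continuous_shellProduct m (-1) G h
  have hi1 := integrable_shellProduct m (η := 1) (by norm_num) G h
  have hi2 := integrable_shellProduct m (η := -1) (by norm_num) G h
  set w : EuclideanSpace ℝ (Fin 3) → ℂ :=
    fun p => shellProduct m 1 G h p + shellProduct m (-1) G h (-p) with hw
  have hwc : Continuous w := hc1.add (hc2.comp continuous_neg)
  have hwi : Integrable w := hi1.add hi2.comp_neg
  have hphase : ∀ (η : ℝ) (a : EuclideanSpace ℝ (Fin 3)) (u : EuclideanSpace ℝ (Fin 3) → ℂ),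
      Integrable u → Integrable fun p => Complex.exp (Complex.I * (η * ⟪p, a⟫_ℝ)) * u p := by
    intro η a u hu
    refine hu.bdd_mul (c := 1) (Continuous.aestronglyMeasurable (by fun_prop))
      (Filter.Eventually.of_forall fun p => ?_)
    rw [mul_comm, ← Complex.ofReal_mul, Complex.norm_exp_ofReal_mul_I]
  have key : ∀ a : EuclideanSpace ℝ (Fin 3),
      ∫ p, Complex.exp (Complex.I * ((-1 : ℝ) * ⟪p, a⟫_ℝ)) * w p = 0 := by
    intro a
    have h1 := hG (translate (spatial a) h)
    rw [pauliJordan] at h1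
    have h2 := (mul_eq_zero.mp h1).resolve_left (by simp [Real.pi_ne_zero])
    have h3 : (∫ p, Complex.exp (Complex.I * ((-1 : ℝ) * ⟪p, a⟫_ℝ)) * shellProduct m 1 G h p)
        + ∫ p, Complex.exp (Complex.I * ((1 : ℝ) * ⟪p, a⟫_ℝ)) * shellProduct m (-1) G h p = 0 := by
      rw [← integral_add (hphase _ a _ hi1) (hphase _ a _ hi2)]
      rw [← mul_zero (-2 * Complex.I), ← h2, ← integral_const_mul]
      refine integral_congr_ae ((Measure.ae_ne volume (0 : EuclideanSpace ℝ (Fin 3))).mono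
        fun p hp => ?_)
      simp only
      have hω : ((√(‖p‖ ^ 2 + m ^ 2) : ℝ) : ℂ) ≠ 0 := by
        have := norm_pos_iff.mpr hp
        have : 0 < √(‖p‖ ^ 2 + m ^ 2) := Real.sqrt_pos.mpr (by positivity)
        exact_mod_cast this.ne'
      rw [minkowskiFourier_translate_testPoly, minkowskiFourier_translate_testPoly, shellProduct,
        shellProduct, neg_neg]
      push_cast
      field_simp
      linear_combination (Complex.exp (-(Complex.I * ⟪p, a⟫_ℝ))
          * minkowskiFourier G (shellPoint m 1 p) * minkowskiFourier h (shellPoint m (-1) p)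
        + Complex.exp (Complex.I * ⟪p, a⟫_ℝ) * minkowskiFourier G (shellPoint m (-1) p)
          * minkowskiFourier h (shellPoint m 1 p)) * Complex.I_mul_I
    -- The two parts carry opposite phases; reflecting p in the second gives both the same phase.
    rw [← integral_neg_eq_self (f := fun p => Complex.exp (Complex.I * ((1 : ℝ) * ⟪p, a⟫_ℝ)) * _),
      ← integral_add (hphase _ a _ hi1)] at h3
    · rw [← h3]
      refine integral_congr_ae (Filter.Eventually.of_forall fun p => ?_)
      simp only [hw, inner_neg_left]
      push_cast
      ring_nf
    · simpa using hphase (-1) a _ hi2.comp_neg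
  have hF : 𝓕 w = 0 := by
    funext a
    rw [Real.fourier_eq', Pi.zero_apply, ← key ((2 * Real.pi) • a)]
    refine integral_congr_ae (Filter.Eventually.of_forall fun p => ?_)
    simp only [inner_smul_right, smul_eq_mul]
    push_cast
    ring_nf
  have hinv := hwc.fourierInv_fourier_eq hwi (by rw [hF]; exact integrable_zero _ _ _)
  rw [hF] at hinv
  have : w p = 0 := by
    rw [← hinv, Real.fourierInv_eq]
    simp
  exact this

/-- If the time derivative of `D_m(G, ·)` vanishes, so does `D_m(G, ·)`. -/
theorem pauliJordan_eq_zero {m : ℝ} {G : Test}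
    (hG : ∀ h, pauliJordan m G (testPoly (MvPolynomial.X 0) h) = 0) (h : Test) :
    pauliJordan m G h = 0 := by
  have h1 := shellProduct_add_neg_eq_zero hG h
  have h2 := shellProduct_add_neg_eq_zero hG (testPoly (MvPolynomial.X 0) h)
  have h0 : metric 0 = 1 := rfl
  have hs : ∀ η p, shellPoint m η p 0 = η * √(‖p‖ ^ 2 + m ^ 2) := fun _ _ => rfl
  -- Replacing h by its time derivative changes the relative sign of the two terms, so for ω ≠ 0
  -- each vanishes separately.
  have h3 : ∀ p, √(‖p‖ ^ 2 + m ^ 2) ≠ 0 → shellProduct m 1 G h p = 0 := by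
    intro p hp
    have e1 := h1 p
    have e2 := h2 p
    simp only [shellProduct, minkowskiFourier_testPoly_X, neg_neg, hs, h0, norm_neg] at e1 e2 ⊢
    have hp' : 2 * Complex.I * ((√(‖p‖ ^ 2 + m ^ 2) : ℝ) : ℂ) ≠ 0 := by
      simpa using hp
    refine (mul_eq_zero.mp ?_).resolve_left hp'
    push_cast at e2
    linear_combination e2 + Complex.I * ((√(‖p‖ ^ 2 + m ^ 2) : ℝ) : ℂ) * e1
  rw [pauliJordan]
  refine mul_eq_zero_of_right _ (integral_eq_zero_of_ae (Filter.Eventually.of_forall fun p => ?_))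
  -- At ω = 0 the weight is `0⁻¹ = 0`.
  by_cases hp : √(‖p‖ ^ 2 + m ^ 2) = 0
  · simp [hp]
  · have e1 := h3 p hp
    have e2 := h1 (-p)
    rw [h3 (-p) (by rwa [norm_neg]), zero_add, neg_neg] at e2
    simp only [shellProduct, neg_neg] at e1 e2
    simp [e1, e2]

end SusyQFT

namespace SusyQFT

/-! ### Commutators of the Wess-Zumino multiplets -/

section Commutators

variable {H : Type*} [NormedAddCommGroup H] [InnerProductSpace ℂ H] {s f : ℕ}
  {T : ScalarMajoranaTheory H s f} {m : Fin s → ℝ} {M : Fin f → ℝ}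

/-- The graded Jacobi identity for Q, F, Φ without its term [Φ, F]. It trades an anticommutator of
spinors for a commutator of scalars. -/
theorem anticomm_eq_comm_of_comm_eq_zero {dom : Submodule ℂ H} {F Q Φ : Module.End ℂ dom}
    (h : comm Φ F = 0) : anticomm F (Q * Φ - Φ * Q) = comm (Q * F + F * Q) Φ := by
  have h1 : Φ * F = F * Φ := sub_eq_zero.mp h
  have h2 : Q * Φ * F = Q * F * Φ := by rw [mul_assoc, h1, mul_assoc]
  have h3 : Φ * F * Q = F * Φ * Q := by rw [h1]
  simp only [anticomm, comm, mul_sub, sub_mul, mul_add, add_mul, ← mul_assoc, h2, h3]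
  abel

theorem comm_swap {dom : Submodule ℂ H} (R S : Module.End ℂ dom) : comm R S = -comm S R := by
  simp [comm]

theorem comm_smul_left {dom : Submodule ℂ H} (z : ℂ) (R S : Module.End ℂ dom) :
    comm (z • R) S = z • comm R S := by
  simp [comm, smul_sub]

theorem comm_smul_right {dom : Submodule ℂ H} (z : ℂ) (R S : Module.End ℂ dom) :
    comm R (z • S) = z • comm R S := by
  simp [comm, smul_sub]

theorem comm_sum_left {dom : Submodule ℂ H} {ι : Type*} (t : Finset ι)
    (R : ι → Module.End ℂ dom) (S : Module.End ℂ dom) :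
    comm (∑ i ∈ t, R i) S = ∑ i ∈ t, comm (R i) S := by
  simp [comm, Finset.sum_mul, Finset.mul_sum]

theorem comm_sum_right {dom : Submodule ℂ H} {ι : Type*} (t : Finset ι)
    (R : Module.End ℂ dom) (S : ι → Module.End ℂ dom) :
    comm R (∑ i ∈ t, S i) = ∑ i ∈ t, comm R (S i) := by
  simp [comm, Finset.sum_mul, Finset.mul_sum]

theorem anticomm_smul_right {dom : Submodule ℂ H} (z : ℂ) (R S : Module.End ℂ dom) :
    anticomm R (z • S) = z • anticomm R S := by
  simp [anticomm, smul_add]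

theorem scalarComb_apply (v : Fin s → ℂ) (g : Test) :
    scalarComb T v g = ∑ j, v j • T.scalar j g := by
  simp [scalarComb]

/-- Combinations of scalar fields of mass `μ` have commutators that are derivatives of `D_μ`. -/
theorem exists_comm_scalarComb (hfree : IsFree T m M) {μ : ℝ} {v : Fin s → ℂ}
    (hv : ∀ j, v j ≠ 0 → m j = μ) (w : Fin s → ℂ) : ∃ D : DiffPoly, ∀ g h,
      comm (scalarComb T v g) (scalarComb T w h)
        = (-Complex.I * pauliJordan μ (testPoly D g) h) • (1 : Module.End ℂ T.dom) := by
  obtain ⟨d, hd⟩ := hfree.scalar_ccr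
  refine ⟨∑ j, ∑ k, MvPolynomial.C (v j * w k) * d j k, fun g h => ?_⟩
  simp only [scalarComb_apply, comm_sum_left, comm_smul_left]
  simp only [comm_sum_right, comm_smul_right, hd]
  simp only [← testPolyHom_apply, map_sum, LinearMap.sum_apply]
  simp only [← pauliJordanLeft_apply, map_sum, Finset.mul_sum, Finset.sum_smul, Finset.smul_sum]
  refine Finset.sum_congr rfl fun j _ => Finset.sum_congr rfl fun k _ => ?_
  -- The commutator carries the mass of its first field, which is μ wherever v does not vanish.
  by_cases hj : v j = 0
  · simp [hj]
  · rw [hv j hj, map_mul, testPolyHom_apply, testPolyHom_apply, testPoly_C, smul_smul, smul_smul,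
      Module.End.mul_apply, LinearMap.smul_apply, Module.End.one_apply, map_smul, smul_eq_mul]
    congr 1
    ring

theorem smul_one_injective (T : ScalarMajoranaTheory H s f) {z w : ℂ}
    (h : z • (1 : Module.End ℂ T.dom) = w • (1 : Module.End ℂ T.dom)) : z = w := by
  have h1 := congrArg (fun R : Module.End ℂ T.dom => R T.vac) h
  simp only [LinearMap.smul_apply, Module.End.one_apply] at h1
  refine smul_left_injective ℂ (fun h0 => ?_) h1
  have := T.vac_norm
  rw [h0] at this
  simp at this

theorem pauliJordan_add_right (μ : ℝ) (g h h' : Test) :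
    pauliJordan μ g (h + h') = pauliJordan μ g h + pauliJordan μ g h' := by
  rw [pauliJordan_antisymm, pauliJordan_add_left, pauliJordan_antisymm μ g h,
    pauliJordan_antisymm μ g h']
  ring

theorem pauliJordan_smul_right (μ : ℝ) (z : ℂ) (g h : Test) :
    pauliJordan μ g (z • h) = z * pauliJordan μ g h := by
  rw [pauliJordan_antisymm, pauliJordan_smul_left, pauliJordan_antisymm μ g h]
  ring

theorem slash_trace : slash 0 0 + slash 1 1 = MvPolynomial.C 2 * MvPolynomial.X 0 := by
  rw [slash_eq]
  simp only [Matrix.of_apply, Matrix.cons_val', Matrix.cons_val_zero, Matrix.cons_val_one,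
    Matrix.cons_val_fin_one, map_ofNat]
  ring

/-- A commutator of scalar fields is determined by its derivatives `σ^μ_{aā} ∂_μ`. -/
theorem comm_eq_of_slash {φ ψ : Field T.dom} {D : DiffPoly} {κ : ℂ} {μ : ℝ}
    (hD : ∀ g h, comm (φ g) (ψ h)
      = (-Complex.I * pauliJordan μ (testPoly D g) h) • (1 : Module.End ℂ T.dom))
    (hslash : ∀ a g h, comm (φ g) (act (slash a a) ψ h)
      = (κ * pauliJordan μ g (testPoly (slash a a) h)) • (1 : Module.End ℂ T.dom)) (g h : Test) :
    comm (φ g) (ψ h) = (κ * pauliJordan μ g h) • (1 : Module.End ℂ T.dom) := by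
  have hX : ∀ h, testPoly (slash 0 0) h + testPoly (slash 1 1) h
      = (2 : ℂ) • testPoly (MvPolynomial.X 0) h := fun h => by
    rw [← LinearMap.add_apply, ← testPoly_add, slash_trace, testPoly_mul, testPoly_C]
    rfl
  -- The first argument is D g - iκ g, whose Pauli-Jordan pairing with h is the discrepancy up to
  -- the factor -i. The two hypotheses add up to its vanishing on time derivatives, since the trace
  -- of the slash symbol is 2∂_0.
  have key : ∀ h, pauliJordan μ (testPoly D g + (-Complex.I * κ) • g)
      (testPoly (MvPolynomial.X 0) h) = 0 := by
    intro h
    have h1 : ∀ a, -Complex.I * pauliJordan μ (testPoly D g) (testPoly (slash a a) h)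
        = κ * pauliJordan μ g (testPoly (slash a a) h) := fun a =>
      smul_one_injective T (by rw [← hD, ← hslash, act_apply])
    have h2 : -Complex.I * (2 * pauliJordan μ (testPoly D g) (testPoly (MvPolynomial.X 0) h))
        = κ * (2 * pauliJordan μ g (testPoly (MvPolynomial.X 0) h)) := by
      rw [← pauliJordan_smul_right μ 2, ← pauliJordan_smul_right μ 2, ← hX, pauliJordan_add_right,
        pauliJordan_add_right, mul_add, mul_add, h1, h1]
    rw [pauliJordan_add_left, pauliJordan_smul_left]
    linear_combination (Complex.I / 2) * h2
      + pauliJordan μ (testPoly D g) (testPoly (MvPolynomial.X 0) h) * Complex.I_mul_I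
  have h1 := pauliJordan_eq_zero key h
  rw [pauliJordan_add_left, pauliJordan_smul_left] at h1
  rw [hD]
  congr 1
  linear_combination -Complex.I * h1 - κ * pauliJordan μ g h * Complex.I_mul_I

theorem comm_scalarComb_spinor (hfree : IsFree T m M) (v : Fin s → ℂ) (A : Fin f)
    (i : SpinorIndex) (g h : Test) : comm (scalarComb T v g) (T.spinor A i h) = 0 := by
  rw [scalarComb_apply, comm_sum_left]
  exact Finset.sum_eq_zero fun j _ => by rw [comm_smul_left, hfree.mixed_ccr, smul_zero]

theorem anticomm_spinor_commField (hfree : IsFree T m M) (v : Fin s → ℂ) (R : Module.End ℂ T.dom)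
    (A : Fin f) (i : SpinorIndex) (g h : Test) :
    anticomm (T.spinor A i g) (commField R (scalarComb T v) h)
      = comm (anticommField R (T.spinor A i) g) (scalarComb T v h) :=
  anticomm_eq_comm_of_comm_eq_zero (comm_scalarComb_spinor hfree v A i h g)

/-- The commutators of Wess-Zumino multiplets follow from those of the Majorana fields. -/
theorem hasWessZuminoCommutators (hfree : IsFree T m M) (S : Supersymmetry T)
    {c : Fin f → Fin s → ℂ} (hm : ∀ A j, c A j ≠ 0 → m j = M A)
    (hWZ : ∀ A, IsWessZumino S (scalarComb T (c A))
      (scalarComb T fun j => (starRingEnd ℂ) (c A j)) (T.spinor A) (M A))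
    (hN : IsNormalized T M) : HasWessZuminoCommutators T M c := by
  have hφφd : ∀ A B g h,
      comm (scalarComb T (c A) g) (scalarComb T (fun j => (starRingEnd ℂ) (c B j)) h)
        = (if A = B then -2 * Complex.I * pauliJordan (M A) g h else 0) •
          (1 : Module.End ℂ T.dom) := by
    intro A B g h
    obtain ⟨D, hD⟩ := exists_comm_scalarComb hfree (hm A) fun j => (starRingEnd ℂ) (c B j)
    rw [comm_eq_of_slash (κ := if A = B then -2 * Complex.I else 0) hD (fun a g h => ?_) g h]
    · split_ifs <;> simp
    -- Inserting 2 f̄^A = i[Q̄, φ^A] into {f^B, f̄^A} produces the commutator of {Q̄, f^B}, a slash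
    -- derivative of φ^B†, with φ^A.
    have h1 := congrArg (fun F : Field T.dom => anticomm (T.spinor B (Sum.inl a) h) (F g))
      ((hWZ A).Qbar_φ a)
    simp only [LinearMap.smul_apply, anticomm_smul_right] at h1
    rw [anticomm_spinor_commField hfree, (hWZ B).Qbar_f, hN, comm_swap, smul_smul] at h1
    have h2 := congrArg (fun R : Module.End ℂ T.dom => Complex.I • R) h1
    simp only [smul_neg, smul_smul, Complex.I_mul_I, neg_smul, one_smul, neg_neg] at h2
    rw [h2]
    congr 1
    by_cases hAB : A = B
    · subst hAB
      rw [if_pos rfl, if_pos rfl, pauliJordan_antisymm]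
      ring
    · rw [if_neg (Ne.symm hAB), if_neg hAB]
      ring
  refine ⟨hφφd, fun A B g h => ?_, fun A B a b g h => ?_,
    fun A B d g h => comm_scalarComb_spinor hfree _ B d g h⟩
  · obtain ⟨D, hD⟩ := exists_comm_scalarComb hfree (hm A) (c B)
    rw [comm_eq_of_slash (κ := 0) hD (fun a g h => ?_) g h]
    · simp
    -- The same exchange with [Q, φ^A] = 0 shows that the slash derivatives of [φ^A, φ^B] vanish.
    have h1 := anticomm_spinor_commField hfree (c A) (S.Q a) B (Sum.inr a) h g
    rw [(hWZ A).Q_φ, (hWZ B).Q_fbar, comm_swap] at h1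
    rw [zero_mul, zero_smul, ← neg_eq_zero, ← h1]
    simp [anticomm]
  -- Inserting 2 f^B_b = i[Q_b, φ^B†] leaves [{Q_b, f^A_a}, φ^B†], where {Q_b, f^A_a} is a multiple
  -- of φ^A without derivatives, so the scalar commutator applies directly.
  · have h1 := congrArg (fun F : Field T.dom => anticomm (T.spinor A (Sum.inl a) g) (F h))
      ((hWZ B).Q_φd b)
    simp only [LinearMap.smul_apply, anticomm_smul_right] at h1
    rw [anticomm_spinor_commField hfree, (hWZ A).Q_f, LinearMap.smul_apply, comm_smul_left, hφφd,
      smul_smul, smul_smul] at h1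
    have h2 := congrArg (fun R : Module.End ℂ T.dom => (2⁻¹ : ℂ) • R) h1
    simp only [smul_smul] at h2
    rw [inv_mul_cancel₀ (by norm_num), one_smul] at h2
    rw [← h2]
    congr 1
    have he : epsLow b a = -epsLow a b := by
      fin_cases a <;> fin_cases b <;> simp [epsLow]
    rw [he]
    split_ifs
    · linear_combination (-Complex.I * epsLow a b * M A * pauliJordan (M A) g h)
        * Complex.I_mul_I
    · ring

end Commutators

end SusyQFT

end

theorem mainTheorem7 {H : Type*} [NormedAddCommGroup H] [InnerProductSpace ℂ H] [CompleteSpace H]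
    {s f : ℕ} (T : ScalarMajoranaTheory H s f) (m : Fin s → ℝ) (M : Fin f → ℝ)
    (hfree : IsFree T m M) (hind : IsIndependent T m M) (S : Supersymmetry T) :
    s = 2 * f ∧
      ∃ c : Fin f → Fin s → ℂ, IsWessZuminoDecomposition S M c ∧
        (∀ A j, c A j ≠ 0 → m j = M A) ∧
        (IsNormalized T M → HasWessZuminoCommutators T M c) := by
  obtain ⟨hs, c, hc, hm⟩ := exists_isWessZuminoDecomposition hfree hind S
  exact ⟨hs, c, hc, hm, hasWessZuminoCommutators hfree S hm hc.isWessZumino⟩
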